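/- \textbf{Definitions.} A \emph{map} is a connected graph (loops and multiple edges allowed) cellularly embedded in a closed oriented surface of arbitrary genus, up to orientation-preserving homeomorphism. It is \emph{rooted} if a corner is marked; the \emph{root half-edge} is the half-edge that follows this corner in clockwise order around its vertex. The map with one vertex and no edge is included among rooted maps. A map is \emph{Eulerian} if all its vertices have even degree. All trees are plane trees. Their vertices of degree $1$ are called \emph{leaves}, the other ones \emph{nodes}. A \emph{blossoming tree} is a plane tree with a marked leaf, the \emph{root leaf}, whose leaves are each declared opening or closing, such that the root leaf is opening and there are as many opening as closing leaves. Leaves are ordered by the clockwise walk around the tree that starts with the root leaf. The \emph{height} of a closing leaf $c$ is the number of opening leaves before $c$ (root leaf included) minus the number of closing leaves before $c$. The tree is \emph{balanced} if all these heights are positive. An \emph{Eulerian tree} is a blossoming tree in which every node has even degree and every node of degree $2k$ has exactly $k-1$ adjacent opening leaves, not counting the root leaf. An \emph{enriched Eulerian tree} is a balanced Eulerian tree together with a choice, for each closing leaf of height $h$, of an integer $\iota\in\{0,\dots,h-1\}$, its \emph{matching-index}. A \emph{forward matching} of a blossoming tree is a perfect matching of its opening leaves (root leaf included) with its closing leaves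 such that in each pair the opening leaf comes before the closing leaf. Let $R$ be a commutative ring and $(g_k)_{k\ge1}$ elements of $R$ (for instance, indeterminates). For $i,k\ge 1$ let $\mathcal P^{(i)}_k$ be the set of paths of length $2k-1$ with steps $\pm1$, from height $i$ to height $i-1$, that stay nonnegative. Consider the system for power series $r_i(t)\in R[[t]]$, $i\ge1$, $$ r_i(t)=i+\sum_{k\ge1}t^k g_k\sum_{\wp\in\mathcal P^{(i)}_k}\ \prod_{\substack{\text{descending steps}\\ h\to h-1\text{ of }\wp}} r_h(t),\qquad i\ge 1. \tag{$*$}$$ \textbf{Theorem.} The following three families are in bijection: (a) enriched Eulerian trees; (b) Eulerian trees endowed with a forward matching; (c) rooted Eulerian maps (of arbitrary genus). More precisely: 1. There is a bijection from (a) to (b) that keeps the tree and encodes the forward matching by the matching-indices: if $c$ is a closing leaf of height $h$ and matching-index $\iota$, and $o_1<\dots<o_h$ are the opening leaves before $c$ that are not matched with a closing leaf before $c$, then $c$ is matched with $o_{h-\iota}$. 2. There is a bijection from (b) to (c) given by closing the tree: the two leaves of each matched pair, with their incident edges, are merged into one edge, the nodes with the clockwise order of their half-edges become the vertices of the map, and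 the root half-edge is the half-edge that carried the root leaf. The tree without nodes corresponds by convention to the map without edges. 3. For every $k\ge1$ these bijections preserve the number of nodes of degree $2k$ in (a) and (b), which is the number of vertices of degree $2k$ in (c). In particular they preserve the total half-degree $E$ of the nodes (resp. vertices), which in (c) is the number of edges. 4. The system $(*)$ has exactly one solution $(r_i(t))_{i\ge1}$, and $r_1(t)$ is the counting series of each of the three families: for every $E\ge0$ each family has finitely many members of total half-degree $E$, and the coefficient of $t^E$ in $r_1(t)$ is the sum over these members of the product of a weight $g_k$ for each node (resp. vertex) of degree $2k$, $k\ge1$. -/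

import Mathlib

open scoped PowerSeries

/-! ### Rooted maps -/

/-- A connected map with at least one edge on an oriented closed surface (of arbitrary genus), with
labelled half-edges: `rot` sends a half-edge to the next one in clockwise order around its vertex,
`opp` to the other half of its edge, and `root` is the half-edge that follows the marked corner in
clockwise order around the root vertex. -/
structure HalfEdgeMap where
  numHalfEdges : ℕ
  rot : Equiv.Perm (Fin numHalfEdges)
  opp : Equiv.Perm (Fin numHalfEdges)
  opp_opp : ∀ d, opp (opp d) = d
  opp_ne : ∀ d, opp d ≠ d
  connected : ∀ d d', ∃ p ∈ Subgroup.closure {rot, opp}, p d = d'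
  root : Fin numHalfEdges

namespace HalfEdgeMap

/-- The vertices are the cycles of `rot` (fixed points included). -/
def Vertex (M : HalfEdgeMap) : Type := Quotient (Equiv.Perm.SameCycle.setoid M.rot)

/-- The vertex at which a half-edge starts. -/
def vertexOf (M : HalfEdgeMap) (d : Fin M.numHalfEdges) : M.Vertex :=
  Quotient.mk (Equiv.Perm.SameCycle.setoid M.rot) d

instance (M : HalfEdgeMap) : Finite M.Vertex :=
  inferInstanceAs (Finite (Quotient (Equiv.Perm.SameCycle.setoid M.rot)))

noncomputable instance (M : HalfEdgeMap) : Fintype M.Vertex := Fintype.ofFinite _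

/-- The degree of a vertex is its number of half-edges (a loop counts twice). -/
noncomputable def degree (M : HalfEdgeMap) (v : M.Vertex) : ℕ :=
  Nat.card {d // M.vertexOf d = v}

/-- The multiset of the degrees of the vertices. -/
noncomputable def degrees (M : HalfEdgeMap) : Multiset ℕ :=
  (Finset.univ : Finset M.Vertex).val.map M.degree

/-- The half-edges are grouped two by two into edges. -/
def numEdges (M : HalfEdgeMap) : ℕ := M.numHalfEdges / 2

/-- Isomorphism of rooted maps: relabelling of the half-edges. -/
def Iso (M N : HalfEdgeMap) : Prop :=
  ∃ e : Fin M.numHalfEdges ≃ Fin N.numHalfEdges,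
    e M.root = N.root ∧ (∀ d, e (M.rot d) = N.rot (e d)) ∧ ∀ d, e (M.opp d) = N.opp (e d)

instance setoid : Setoid HalfEdgeMap where
  r := Iso
  iseqv :=
    { refl := fun _ => ⟨Equiv.refl _, rfl, fun _ => rfl, fun _ => rfl⟩
      symm := by
        rintro M N ⟨e, h0, h1, h2⟩
        refine ⟨e.symm, by simp [← h0], fun d => ?_, fun d => ?_⟩
        · rw [Equiv.symm_apply_eq, h1, Equiv.apply_symm_apply]
        · rw [Equiv.symm_apply_eq, h2, Equiv.apply_symm_apply]
      trans := by
        rintro M N P ⟨e, h0, h1, h2⟩ ⟨f, k0, k1, k2⟩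
        exact ⟨e.trans f, by simp [h0, k0], fun d => by simp [h1, k1], fun d => by simp [h2, k2]⟩ }

theorem Iso.numEdges_eq {M N : HalfEdgeMap} (h : Iso M N) : M.numEdges = N.numEdges := by
  obtain ⟨e, -⟩ := h
  have := Fintype.card_congr e
  simp only [Fintype.card_fin] at this
  simp [numEdges, this]

theorem Iso.degrees_eq {M N : HalfEdgeMap} (h : Iso M N) : M.degrees = N.degrees := by
  obtain ⟨e, -, h1, -⟩ := h
  have hz : ∀ (k : ℤ) d, e ((M.rot ^ k) d) = (N.rot ^ k) (e d) := by
    have hn : ∀ (k : ℕ) d, e ((M.rot ^ k) d) = (N.rot ^ k) (e d) := by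
      intro k
      induction k with
      | zero => intro d; simp
      | succ k ih => intro d; rw [pow_succ, pow_succ, Equiv.Perm.mul_apply, ih, h1]; rfl
    intro k d
    obtain ⟨n, rfl | rfl⟩ := k.eq_nat_or_neg
    · simpa using hn n d
    · rw [zpow_neg, zpow_neg, Equiv.Perm.eq_inv_iff_eq, zpow_natCast, zpow_natCast, ← hn]
      simp
  have hs : ∀ a b, M.rot.SameCycle a b ↔ N.rot.SameCycle (e a) (e b) := by
    intro a b
    constructor
    · rintro ⟨k, hk⟩
      exact ⟨k, by rw [← hz, hk]⟩
    · rintro ⟨k, hk⟩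
      exact ⟨k, e.injective (by rw [hz, hk])⟩
  let q : M.Vertex ≃ N.Vertex := Quotient.congr e hs
  have hq : ∀ v, N.degree (q v) = M.degree v := by
    intro v
    refine (Nat.card_congr (e.subtypeEquiv fun d => ?_)).symm
    change M.vertexOf d = v ↔ q (M.vertexOf d) = q v
    exact q.injective.eq_iff.symm
  unfold degrees
  rw [← Finset.map_univ_equiv q, Finset.map_val, Multiset.map_map]
  exact Multiset.map_congr rfl fun v _ => (hq v).symm

end HalfEdgeMap

/-- A rooted (connected) map of arbitrary genus: the map with one vertex and no edge, or an
isomorphism class of maps with at least one edge and a marked corner. -/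
inductive RootedMap : Type
  | vertexMap : RootedMap
  | ofClass (c : Quotient HalfEdgeMap.setoid) : RootedMap

namespace RootedMap

/-- The multiset of vertex degrees. -/
noncomputable def degrees : RootedMap → Multiset ℕ
  | vertexMap => {0}
  | ofClass c => Quotient.lift HalfEdgeMap.degrees (fun _ _ h => HalfEdgeMap.Iso.degrees_eq h) c

/-- The number of edges. -/
def numEdges : RootedMap → ℕ
  | vertexMap => 0
  | ofClass c => Quotient.lift HalfEdgeMap.numEdges (fun _ _ h => HalfEdgeMap.Iso.numEdges_eq h) c

/-- A map is Eulerian if all its vertices have even degree. -/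
def IsEulerian (M : RootedMap) : Prop := ∀ d ∈ M.degrees, Even d

end RootedMap

/-- Rooted Eulerian maps. -/
def RootedEulerianMap : Type := {M : RootedMap // M.IsEulerian}

/-! ### Blossoming trees -/

/-- A plane tree rooted at a leaf, with its other leaves declared opening or closing. The root leaf
is not represented: a term describes what lies at the other end of the edge at the root leaf, either
a leaf, or a node, whose subtrees are listed in clockwise order starting after the edge that leads
towards the root leaf. -/
inductive PlantedTree : Type
  | opening : PlantedTree
  | closing : PlantedTree
  | node (n : ℕ) (child : Fin n → PlantedTree) : PlantedTree

namespace PlantedTree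

/-- The subtree reached by descending from the root along the given child numbers. -/
def subtreeAt : PlantedTree → List ℕ → Option PlantedTree
  | T, [] => some T
  | node n child, j :: a => if h : j < n then (child ⟨j, h⟩).subtreeAt a else none
  | opening, _ :: _ => none
  | closing, _ :: _ => none

/-- Each node has degree at least two (a vertex of degree one is a leaf). -/
def IsProper : PlantedTree → Prop
  | opening => True
  | closing => True
  | node n child => 1 ≤ n ∧ ∀ j, (child j).IsProper

/-- Each node has even degree, and a node of degree `2 * k` has `k - 1` adjacent opening leaves
(the root leaf not counted). -/
def IsEulerian : PlantedTree → Prop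
  | opening => True
  | closing => True
  | node n child =>
      (∃ k, n + 1 = 2 * k ∧ Nat.card {j // child j = opening} + 1 = k) ∧ ∀ j, (child j).IsEulerian

/-- The multiset of the degrees of the nodes. -/
def nodeDegrees : PlantedTree → Multiset ℕ
  | opening => 0
  | closing => 0
  | node n child => (n + 1) ::ₘ ∑ j, (child j).nodeDegrees

/-- Leaves are designated by `⊥` for the root leaf and by the address of the leaf otherwise. The order
(lexicographic on addresses, `⊥` first) is that of the clockwise walk from the root leaf. -/
abbrev LeafPosition : Type := WithBot (List ℕ)

/-- The opening leaves; the root leaf is one of them. -/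
def openingLeaves (T : PlantedTree) : Set LeafPosition :=
  {x | x = ⊥ ∨ ∃ a : List ℕ, x = (a : LeafPosition) ∧ T.subtreeAt a = some opening}

/-- The closing leaves. -/
def closingLeaves (T : PlantedTree) : Set LeafPosition :=
  {x | ∃ a : List ℕ, x = (a : LeafPosition) ∧ T.subtreeAt a = some closing}

/-- The height of a closing leaf `c`: the level at which the corresponding down-step of the leaf-path
starts. The path starts at level one, right after the root leaf. -/
noncomputable def height (T : PlantedTree) (c : LeafPosition) : ℤ :=
  ({o ∈ T.openingLeaves | o < c}.ncard : ℤ) - ({c' ∈ T.closingLeaves | c' < c}.ncard : ℤ)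

end PlantedTree

/-- A blossoming tree. -/
structure BlossomingTree where
  tree : PlantedTree
  proper : tree.IsProper
  card_eq : tree.openingLeaves.ncard = tree.closingLeaves.ncard

namespace BlossomingTree

/-- The leaf-path stays nonnegative, that is, the heights of the closing leaves are positive. -/
def IsBalanced (T : BlossomingTree) : Prop := ∀ c ∈ T.tree.closingLeaves, 0 < T.tree.height c

end BlossomingTree

/-- Assignment of an integer in `[0 .. h - 1]`, the matching-index, to each closing leaf of
height `h`. -/
structure MatchingAssignment (T : BlossomingTree) where
  index : T.tree.closingLeaves → ℕ
  index_lt : ∀ c, (index c : ℤ) < T.tree.height c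

/-- A perfect matching of the opening leaves with the closing leaves, such that in each pair the
opening leaf comes first in the clockwise walk. -/
structure ForwardMatching (T : BlossomingTree) where
  toEquiv : T.tree.openingLeaves ≃ T.tree.closingLeaves
  forward : ∀ o : T.tree.openingLeaves, (o : PlantedTree.LeafPosition) < (toEquiv o : PlantedTree.LeafPosition)

/-- The opening leaves before the closing leaf `c` that are matched with none of the closing leaves
before `c`. -/
def ForwardMatching.available {T : BlossomingTree} (m : ForwardMatching T)
    (c : T.tree.closingLeaves) : Set T.tree.openingLeaves :=
  {o | (o : PlantedTree.LeafPosition) < (c : PlantedTree.LeafPosition) ∧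
    ¬ (m.toEquiv o : PlantedTree.LeafPosition) < (c : PlantedTree.LeafPosition)}

/-- The forward matching `m` is the one encoded by the matching-indices: for each closing leaf `c` of
height `h` and matching-index `ι`, if `o_1 < ... < o_h` are the opening leaves before `c` that are
not matched when `c` is visited, then `c` is matched with `o_(h - ι)`. -/
def MatchingAssignment.Encodes {T : BlossomingTree} (a : MatchingAssignment T)
    (m : ForwardMatching T) : Prop :=
  ∀ c : T.tree.closingLeaves,
    m.toEquiv.symm c ∈ m.available c ∧
    ({o ∈ m.available c | o ≤ m.toEquiv.symm c}.ncard : ℤ) = T.tree.height c - (a.index c : ℤ)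

/-- Enriched Eulerian trees. -/
structure EnrichedEulerianTree where
  tree : BlossomingTree
  eulerian : tree.tree.IsEulerian
  balanced : tree.IsBalanced
  assignment : MatchingAssignment tree

/-- Eulerian trees endowed with a forward matching. -/
structure MatchedEulerianTree where
  tree : BlossomingTree
  eulerian : tree.tree.IsEulerian
  matching : ForwardMatching tree

/-- The multiset of the degrees of the nodes. -/
def EnrichedEulerianTree.degrees (S : EnrichedEulerianTree) : Multiset ℕ := S.tree.tree.nodeDegrees

/-- The multiset of the degrees of the nodes. -/
def MatchedEulerianTree.degrees (S : MatchedEulerianTree) : Multiset ℕ := S.tree.tree.nodeDegrees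

/-! ### Closing a tree into a map -/

namespace PlantedTree

/-- The half-edges incident to the nodes: `(a, 0)` is the one that leads from the node at address `a`
towards the root leaf, and `(a, j + 1)` the one that leads to child number `j`. -/
def halfEdges (T : PlantedTree) : Set (List ℕ × ℕ) :=
  {x | ∃ n child, T.subtreeAt x.1 = some (node n child) ∧ x.2 ≤ n}

/-- The half-edge at the end of which a leaf is attached (for trees with at least one node). -/
def stem : LeafPosition → List ℕ × ℕ
  | ⊥ => ([], 0)
  | (a : List ℕ) => (a.dropLast, a.getLastD 0 + 1)

end PlantedTree

/-- The rooted map `M` is obtained from the blossoming tree `T` by merging the leaves matched by `m`: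
its vertices are the nodes of `T`, with their half-edges in the same clockwise order, its edges are
the edges of `T` between two nodes and one edge for each matched pair, and its root half-edge is the
one that carried the root leaf. -/
def HalfEdgeMap.IsClosure {T : BlossomingTree} (m : ForwardMatching T) (M : HalfEdgeMap) : Prop :=
  ∃ f : List ℕ × ℕ → Fin M.numHalfEdges,
    Set.BijOn f T.tree.halfEdges Set.univ ∧
    M.root = f ([], 0) ∧
    (∀ a n child, T.tree.subtreeAt a = some (.node n child) →
      (∀ j < n, M.rot (f (a, j)) = f (a, j + 1)) ∧ M.rot (f (a, n)) = f (a, 0)) ∧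
    (∀ a j n child, T.tree.subtreeAt (a ++ [j]) = some (.node n child) →
      M.opp (f (a, j + 1)) = f (a ++ [j], 0)) ∧
    ∀ o : T.tree.openingLeaves,
      M.opp (f (PlantedTree.stem o)) = f (PlantedTree.stem (m.toEquiv o))

/-- Closure, including the nodeless tree (a single edge from the root leaf to a closing leaf), which
corresponds by convention to the map with one vertex and no edge. -/
def RootedMap.IsClosure {T : BlossomingTree} (m : ForwardMatching T) : RootedMap → Prop
  | vertexMap => T.tree = .closing
  | ofClass c => ∃ M : HalfEdgeMap, Quotient.mk HalfEdgeMap.setoid M = c ∧ M.IsClosure m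

/-! ### Counting series -/

/-- Half of the total degree, for a multiset of even degrees. -/
def halfDegree (s : Multiset ℕ) : ℕ := (s.map (· / 2)).sum

/-- A weight `g k` per vertex of degree `2 * k`, for `k ≥ 1` (the only vertex of degree `0` that
occurs is that of the map without edges, which has weight `1` by convention). -/
def degreeWeight {R : Type*} [CommRing R] (g : ℕ → R) (s : Multiset ℕ) : R :=
  ((s.filter (0 < ·)).map fun d => g (d / 2)).prod

/-- `F` is the generating series of the family `A`, whose members have a multiset of vertex degrees
given by `deg`: the variable marks half of the total degree, and each vertex of degree `2 * k` has
weight `g k`. -/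
def IsCountingSeries {R : Type*} [CommRing R] (g : ℕ → R) {A : Type*} (deg : A → Multiset ℕ)
    (F : R⟦X⟧) : Prop :=
  ∀ E : ℕ, {x : A | halfDegree (deg x) = E}.Finite ∧
    PowerSeries.coeff E F = ∑ᶠ x ∈ {x : A | halfDegree (deg x) = E}, degreeWeight g (deg x)

/-- The height after `j` steps of the path that starts at height `i` and whose `l`-th step is `+1` if
`p l = true` and `-1` otherwise. -/
def pathHeight {n : ℕ} (i : ℕ) (p : Fin n → Bool) (j : ℕ) : ℤ :=
  (i : ℤ) + ∑ l : Fin n, if (l : ℕ) < j then (if p l then 1 else -1) else 0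

/-- The paths of length `2 * k - 1` with steps `+1` and `-1`, from height `i` to height `i - 1`, that
stay nonnegative. -/
def dyckPaths (k i : ℕ) : Finset (Fin (2 * k - 1) → Bool) :=
  Finset.univ.filter fun p =>
    (∀ j ≤ 2 * k - 1, 0 ≤ pathHeight i p j) ∧ pathHeight i p (2 * k - 1) = (i : ℤ) - 1

/-- The sum over these paths of the product of `r h` over the descending steps from `h` to `h - 1`. -/
noncomputable def pathSum {R : Type*} [CommRing R] (r : ℕ → R⟦X⟧) (k i : ℕ) : R⟦X⟧ :=
  ∑ p ∈ dyckPaths k i, ∏ l ∈ Finset.univ.filter fun l => p l = false, r (pathHeight i p l).toNat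

/-- The series `r 1, r 2, ...` satisfy, for `i ≥ 1`, the equation
`r i = i + ∑_{k ≥ 1} t ^ k * g k * pathSum r k i`, with the convention `r 0 = 0`.
The equation is written coefficient by coefficient; the terms with `k > E` do not contribute to the
coefficient of `t ^ E`. -/
def SatisfiesRecursion {R : Type*} [CommRing R] (g : ℕ → R) (r : ℕ → R⟦X⟧) : Prop :=
  r 0 = 0 ∧ ∀ i ≥ 1, ∀ E : ℕ,
    PowerSeries.coeff E (r i) = PowerSeries.coeff E (i : R⟦X⟧) +
      ∑ k ∈ Finset.Icc 1 E,
        PowerSeries.coeff E (PowerSeries.X ^ k * PowerSeries.C (g k) * pathSum r k i)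

/-! From (a) to (b): read the closing leaves in clockwise order. If the earlier ones are already
matched injectively with earlier openings, the number of free openings before a closing leaf is
exactly its height (`ncard_unmatched`). Choosing a partner thus amounts to choosing a rank among h
elements, which is a matching-index. Existence and uniqueness follow by induction along the order of
the leaves, and every forward matching forces the tree to be balanced.

From (b) to (c): closing is explicit, and its inverse rests on Eulerian orientations. Orient each
matched edge from its opening to its closing end and each tree edge from child to parent. A node of
degree 2k then has k outgoing half-edges, so the orientation is Eulerian.

Injectivity: suppose two trees close to the same map and take the first address at which they
differ. A closing leaf there is detected by its partner, which comes earlier. If one tree has an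
opening leaf and the other a node, compare the two orientations on the vertices of the subtree at
that node: the edge above it is reversed and nothing compensates for it across the boundary, against
conservation of flow (`eq_of_boundary`, `not_node_of_agree`).

Surjectivity: a map with even degrees has an Eulerian orientation. Explore it depth first from the
root. A half-edge whose opposite has been visited becomes a closing leaf. Otherwise it becomes an
opening leaf as soon as some Eulerian orientation, unchanged on what has been visited, makes it
outgoing. Otherwise it is forced to be incoming, and it must lead to a new vertex, which is explored
as a node. The invariant behind the last claim is `Blocked`: no unit of excess can be moved between
the current vertex and another incompletely visited one without touching the visited part
(`explorable`). By connectedness everything gets visited.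

Counting: a tree carries as many index assignments as the product of its heights, and this product
vanishes if the tree is not balanced. Let the leaf-path start at an arbitrary level i. An Eulerian
tree other than a single opening leaf lowers the level by one, so the children of the root node
trace a path from i to i - 1 with one descending step per non-opening child. Paths that become
negative contribute zero, since such a subtree has weight zero at level 0
(`IsEulerian.levelWeight_zero`). This is the system (`sum_treeWeight_arity`). Its solution is unique
because the factor t^k makes each coefficient depend only on lower ones. -/

namespace PlantedTree

/-! ### Addresses and subtrees -/

/-- The pairs formed by the address of a vertex and by the subtree at this vertex. -/
noncomputable def positions : PlantedTree → Multiset (List ℕ × PlantedTree)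
  | opening => {([], opening)}
  | closing => {([], closing)}
  | node n child => ([], node n child) ::ₘ
      ∑ j, (child j).positions.map fun x => ((j : ℕ) :: x.1, x.2)

@[simp] theorem subtreeAt_nil (T : PlantedTree) : T.subtreeAt [] = some T := by
  cases T <;> simp [subtreeAt]

@[simp] theorem subtreeAt_opening_cons (j : ℕ) (a : List ℕ) :
    opening.subtreeAt (j :: a) = none := by simp [subtreeAt]

@[simp] theorem subtreeAt_closing_cons (j : ℕ) (a : List ℕ) :
    closing.subtreeAt (j :: a) = none := by simp [subtreeAt]

theorem subtreeAt_node_cons (n : ℕ) (child : Fin n → PlantedTree) (j : ℕ) (a : List ℕ) :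
    (node n child).subtreeAt (j :: a) =
      if h : j < n then (child ⟨j, h⟩).subtreeAt a else none := by
  rw [subtreeAt]

@[simp] theorem subtreeAt_node_cons_fin (n : ℕ) (child : Fin n → PlantedTree) (j : Fin n)
    (a : List ℕ) : (node n child).subtreeAt ((j : ℕ) :: a) = (child j).subtreeAt a := by
  simp [subtreeAt_node_cons]

theorem subtreeAt_node_cons_eq_some {n : ℕ} {child : Fin n → PlantedTree} {j : ℕ} {a : List ℕ}
    {S : PlantedTree} : (node n child).subtreeAt (j :: a) = some S ↔
      ∃ i : Fin n, (i : ℕ) = j ∧ (child i).subtreeAt a = some S := by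
  rw [subtreeAt_node_cons]
  constructor
  · intro h
    split_ifs at h with hj
    exact ⟨⟨j, hj⟩, rfl, h⟩
  · rintro ⟨i, rfl, h⟩
    simp [h]

theorem subtreeAt_append (T : PlantedTree) (a b : List ℕ) :
    T.subtreeAt (a ++ b) = (T.subtreeAt a).bind fun S => S.subtreeAt b := by
  induction a generalizing T with
  | nil => simp
  | cons j a ih =>
    cases T with
    | opening => simp
    | closing => simp
    | node n child =>
      rw [List.cons_append, subtreeAt_node_cons, subtreeAt_node_cons]
      split_ifs with h
      · exact ih _
      · rfl

theorem subtreeAt_concat_eq_some {T : PlantedTree} {a : List ℕ} {j : ℕ} {S : PlantedTree} :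
    T.subtreeAt (a ++ [j]) = some S ↔
      ∃ n child, T.subtreeAt a = some (node n child) ∧ ∃ i : Fin n, (i : ℕ) = j ∧ child i = S := by
  rw [subtreeAt_append]
  constructor
  · intro h
    obtain ⟨U, hU, h⟩ := Option.bind_eq_some_iff.1 h
    cases U with
    | opening => simp at h
    | closing => simp at h
    | node n child =>
      obtain ⟨i, hi, h⟩ := subtreeAt_node_cons_eq_some.1 h
      exact ⟨n, child, hU, i, hi, by simpa using h⟩
  · rintro ⟨n, child, hU, i, rfl, rfl⟩
    simp [hU]

/-- Connects the partial function `subtreeAt`, in which leaves and half-edges are defined, with the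
recursive multiset, over which sums and products are taken. -/
theorem mem_positions {T : PlantedTree} {a : List ℕ} {S : PlantedTree} :
    (a, S) ∈ T.positions ↔ T.subtreeAt a = some S := by
  induction T generalizing a S with
  | opening => cases a <;> simp [positions, eq_comm]
  | closing => cases a <;> simp [positions, eq_comm]
  | node n child ih =>
    rw [positions, Multiset.mem_cons, Multiset.mem_sum]
    cases a with
    | nil => simp [eq_comm]
    | cons j a =>
      rw [subtreeAt_node_cons_eq_some]
      simp only [Prod.mk.injEq, reduceCtorEq, false_and, Finset.mem_univ, Multiset.mem_map, true_and,
        List.cons.injEq, Prod.exists, false_or]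
      refine exists_congr fun i => ⟨?_, ?_⟩
      · rintro ⟨b, U, h, ⟨h1, rfl⟩, rfl⟩
        exact ⟨h1, ih i |>.1 h⟩
      · rintro ⟨h1, h⟩
        exact ⟨a, S, (ih i).2 h, ⟨h1, rfl⟩, rfl⟩

theorem nodup_positions (T : PlantedTree) : T.positions.Nodup := by
  induction T with
  | opening => simp [positions]
  | closing => simp [positions]
  | node n child ih =>
    rw [positions, Multiset.nodup_cons]
    constructor
    · simp [Multiset.mem_sum]
    · change ((Finset.univ : Finset (Fin n)).val.bind _).Nodup
      rw [Multiset.nodup_bind]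
      refine ⟨fun j _ => (ih j).map ?_, Finset.univ.nodup.pairwise ?_⟩
      · rintro ⟨a, S⟩ ⟨b, U⟩ h
        simpa using h
      · intro i _ j _ hij
        rw [Function.onFun, Multiset.disjoint_left]
        rintro x hi hj
        obtain ⟨y, -, rfl⟩ := Multiset.mem_map.1 hi
        obtain ⟨z, -, hz⟩ := Multiset.mem_map.1 hj
        simp only [Prod.mk.injEq, List.cons.injEq] at hz
        exact hij (Fin.ext hz.1.1.symm)

theorem finite_addresses (T : PlantedTree) : {a | T.subtreeAt a ≠ none}.Finite := by
  classical
  refine ((T.positions.map Prod.fst).toFinset.finite_toSet).subset fun a ha => ?_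
  obtain ⟨S, hS⟩ := Option.ne_none_iff_exists'.1 ha
  simp only [Finset.mem_coe, Multiset.mem_toFinset, Multiset.mem_map]
  exact ⟨(a, S), mem_positions.2 hS, rfl⟩

theorem finite_openingLeaves (T : PlantedTree) : T.openingLeaves.Finite := by
  refine ((Set.Finite.image (fun a : List ℕ => (a : LeafPosition)) T.finite_addresses).insert ⊥).subset ?_
  rintro x (rfl | ⟨a, rfl, h⟩)
  · exact Set.mem_insert _ _
  · exact Set.mem_insert_of_mem _ ⟨a, by simp [h], rfl⟩

theorem finite_closingLeaves (T : PlantedTree) : T.closingLeaves.Finite := by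
  refine (Set.Finite.image (fun a : List ℕ => (a : LeafPosition)) T.finite_addresses).subset ?_
  rintro x ⟨a, rfl, h⟩
  exact ⟨a, by simp [h], rfl⟩

instance (T : PlantedTree) : Finite T.openingLeaves := T.finite_openingLeaves

instance (T : PlantedTree) : Finite T.closingLeaves := T.finite_closingLeaves

end PlantedTree

/-! ### Forward matchings and matching-indices -/

/-- The rank in a finite chain is strictly increasing. -/
theorem Set.Finite.eq_of_ncard_le_eq {α : Type*} [LinearOrder α] {A : Set α} (hA : A.Finite)
    {x y : α} (hx : x ∈ A) (hy : y ∈ A)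
    (h : {o ∈ A | o ≤ x}.ncard = {o ∈ A | o ≤ y}.ncard) : x = y := by
  have key : ∀ {x y : α}, y ∈ A → x < y → {o ∈ A | o ≤ x}.ncard < {o ∈ A | o ≤ y}.ncard := by
    intro x y hy hxy
    refine Set.ncard_lt_ncard ?_ (hA.subset (Set.sep_subset _ _))
    refine ⟨fun o ho => ⟨ho.1, ho.2.trans hxy.le⟩, fun hs => ?_⟩
    exact absurd (hs (show y ∈ {o ∈ A | o ≤ y} from ⟨hy, le_rfl⟩)).2 (not_le.2 hxy)
  rcases lt_trichotomy x y with hxy | hxy | hxy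
  · exact absurd h (key hy hxy).ne
  · exact hxy
  · exact absurd h (key hx hxy).ne'

/-- The rank is an injection of `A` into the integers from 1 to |A|, hence onto by cardinality. -/
theorem Set.Finite.exists_ncard_le_eq {α : Type*} [LinearOrder α] {A : Set α} (hA : A.Finite)
    {k : ℕ} (hk : 1 ≤ k) (hk' : k ≤ A.ncard) : ∃ x ∈ A, {o ∈ A | o ≤ x}.ncard = k := by
  classical
  obtain ⟨x, hx, h⟩ := Finset.surj_on_of_inj_on_of_card_le (s := hA.toFinset)
    (t := Finset.Icc 1 A.ncard) (fun x _ => {o ∈ A | o ≤ x}.ncard)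
    (fun x hx => by
      rw [hA.mem_toFinset] at hx
      rw [Finset.mem_Icc]
      refine ⟨?_, Set.ncard_le_ncard (Set.sep_subset _ _) hA⟩
      rw [Nat.one_le_iff_ne_zero, Ne, Set.ncard_eq_zero (hA.subset (Set.sep_subset _ _))]
      exact Set.Nonempty.ne_empty ⟨x, hx, le_rfl⟩)
    (fun x y hx hy h => hA.eq_of_ncard_le_eq (hA.mem_toFinset.1 hx) (hA.mem_toFinset.1 hy) h)
    (by rw [Nat.card_Icc, Nat.add_sub_cancel, Set.ncard_eq_toFinset_card A hA]) k
    (Finset.mem_Icc.2 ⟨hk, hk'⟩)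
  exact ⟨x, hA.mem_toFinset.1 hx, h.symm⟩

theorem Set.ncard_sep_coe {α : Type*} (s : Set α) (p : α → Prop) :
    {x : s | p x}.ncard = {x ∈ s | p x}.ncard := by
  rw [← Set.ncard_image_of_injective _ Subtype.val_injective]
  congr 1
  ext x
  simp [and_comm]

namespace PlantedTree

theorem height_eq (T : PlantedTree) (c : LeafPosition) :
    T.height c = ({o : T.openingLeaves | (o : LeafPosition) < c}.ncard : ℤ) -
      ({c' : T.closingLeaves | (c' : LeafPosition) < c}.ncard : ℤ) := by
  rw [height, Set.ncard_sep_coe T.openingLeaves (· < c), Set.ncard_sep_coe T.closingLeaves (· < c)]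

/-- Openings before `c` that are not images of closings before `c` under an assignment `f` that sends
closings before `c` injectively to earlier openings. -/
theorem ncard_unmatched {T : PlantedTree} (f : T.closingLeaves → T.openingLeaves)
    (c : T.closingLeaves) (hlt : ∀ c' < c, (f c' : LeafPosition) < (c' : LeafPosition))
    (hinj : ∀ c' < c, ∀ c'' < c, f c' = f c'' → c' = c'') :
    ({o : T.openingLeaves | (o : LeafPosition) < c ∧ ∀ c' < c, f c' ≠ o}.ncard : ℤ) =
      T.height c := by
  -- The openings before `c` are the free ones together with the partners of the closings before
  -- `c`.
  have h1 : {o : T.openingLeaves | (o : LeafPosition) < c} =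
      {o : T.openingLeaves | (o : LeafPosition) < c ∧ ∀ c' < c, f c' ≠ o} ∪ f '' Set.Iio c := by
    ext o
    simp only [Set.mem_ofPred_eq, Set.mem_union, Set.mem_image, Set.mem_Iio]
    constructor
    · intro h
      by_cases h2 : ∃ c', c' < c ∧ f c' = o
      · exact Or.inr h2
      · push Not at h2
        exact Or.inl ⟨h, h2⟩
    · rintro (h | ⟨c', h, rfl⟩)
      · exact h.1
      · exact (hlt c' h).trans h
  have h2 : Disjoint {o : T.openingLeaves | (o : LeafPosition) < c ∧ ∀ c' < c, f c' ≠ o}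
      (f '' Set.Iio c) := by
    rw [Set.disjoint_left]
    rintro o ⟨-, h⟩ ⟨c', h', rfl⟩
    exact h c' h' rfl
  rw [height_eq, h1, Set.ncard_union_eq h2 (Set.toFinite _) (Set.toFinite _),
    Set.InjOn.ncard_image (s := Set.Iio c) (fun c' h' c'' h'' h => hinj c' h' c'' h'' h)]
  have h3 : {c' : T.closingLeaves | (c' : LeafPosition) < c} = Set.Iio c := rfl
  rw [h3]
  push_cast
  ring

end PlantedTree

namespace ForwardMatching

variable {T : BlossomingTree}

theorem ext_symm {m m' : ForwardMatching T} (h : ∀ c, m.toEquiv.symm c = m'.toEquiv.symm c) :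
    m = m' := by
  obtain ⟨e, he⟩ := m
  obtain ⟨e', he'⟩ := m'
  have : e.symm = e'.symm := Equiv.ext h
  have : e = e' := by rw [← e.symm_symm, this, e'.symm_symm]
  subst this
  rfl

theorem symm_lt (m : ForwardMatching T) (c : T.tree.closingLeaves) :
    (m.toEquiv.symm c : PlantedTree.LeafPosition) < (c : PlantedTree.LeafPosition) := by
  simpa using m.forward (m.toEquiv.symm c)

theorem available_eq (m : ForwardMatching T) (c : T.tree.closingLeaves) :
    m.available c = {o : T.tree.openingLeaves | (o : PlantedTree.LeafPosition) < c ∧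
      ∀ c' < c, m.toEquiv.symm c' ≠ o} := by
  ext o
  refine and_congr_right fun _ => ⟨?_, ?_⟩
  · rintro h c' hc rfl
    exact h (by simpa using hc)
  · intro h hc
    exact h (m.toEquiv o) hc (by simp)

theorem symm_mem_available (m : ForwardMatching T) (c : T.tree.closingLeaves) :
    m.toEquiv.symm c ∈ m.available c :=
  ⟨m.symm_lt c, by simp⟩

/-- This equality is why the matching-indices range over h values. -/
theorem ncard_available (m : ForwardMatching T) (c : T.tree.closingLeaves) :
    ((m.available c).ncard : ℤ) = T.tree.height c := by
  rw [available_eq]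
  exact PlantedTree.ncard_unmatched m.toEquiv.symm c (fun c' _ => m.symm_lt c')
    fun c' _ c'' _ h => m.toEquiv.symm.injective h

theorem rank_pos (m : ForwardMatching T) (c : T.tree.closingLeaves) :
    0 < {o ∈ m.available c | o ≤ m.toEquiv.symm c}.ncard :=
  (Set.ncard_pos (Set.toFinite _)).2 ⟨_, m.symm_mem_available c, le_rfl⟩

theorem rank_le (m : ForwardMatching T) (c : T.tree.closingLeaves) :
    ({o ∈ m.available c | o ≤ m.toEquiv.symm c}.ncard : ℤ) ≤ T.tree.height c := by
  rw [← m.ncard_available c]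
  exact_mod_cast Set.ncard_le_ncard (Set.sep_subset _ _) (Set.toFinite _)

/-- The rank of the partner is positive and at most the height. Hence family (b) need not require
balance. -/
theorem isBalanced (m : ForwardMatching T) : T.IsBalanced := by
  intro c hc
  have h1 := m.rank_le ⟨c, hc⟩
  have h2 := m.rank_pos ⟨c, hc⟩
  simp only at h1
  omega

/-- The matching-indices of a forward matching. -/
noncomputable def assignment (m : ForwardMatching T) : MatchingAssignment T where
  index c := (T.tree.height c - {o ∈ m.available c | o ≤ m.toEquiv.symm c}.ncard).toNat
  index_lt c := by
    have h1 := m.rank_le c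
    have h2 := m.rank_pos c
    omega

theorem assignment_encodes (m : ForwardMatching T) : m.assignment.Encodes m := by
  intro c
  refine ⟨m.symm_mem_available c, ?_⟩
  have h1 := m.rank_le c
  simp only [assignment]
  omega

end ForwardMatching

namespace MatchingAssignment

variable {T : BlossomingTree}

theorem Encodes.eq_assignment {a : MatchingAssignment T} {m : ForwardMatching T}
    (h : a.Encodes m) : a = m.assignment := by
  obtain ⟨ι, hι⟩ := a
  have : ι = m.assignment.index := by
    funext c
    have h1 := (h c).2
    have h2 := (m.assignment_encodes c).2
    simp only at h1
    omega
  subst this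
  rfl

/-- The free openings at `c` depend only on the partners of earlier closings, so by induction the
prescribed rank designates the same opening in both matchings. -/
theorem Encodes.unique {a : MatchingAssignment T} {m m' : ForwardMatching T}
    (h : a.Encodes m) (h' : a.Encodes m') : m = m' := by
  refine ForwardMatching.ext_symm fun c => ?_
  induction c using WellFoundedLT.induction with
  | ind c ih =>
    have hav : m.available c = m'.available c := by
      rw [m.available_eq, m'.available_eq]
      ext o
      refine and_congr_right fun _ => forall₂_congr fun c' hc => ?_
      rw [ih c' hc]
    refine (Set.toFinite (m.available c)).eq_of_ncard_le_eq (h c).1 (hav ▸ (h' c).1) ?_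
    have h1 := (h c).2
    have h2 := (h' c).2
    rw [← hav] at h2
    omega

theorem exists_encodes (a : MatchingAssignment T) : ∃ m : ForwardMatching T, a.Encodes m := by
  classical
  -- Greedy construction by recursion along the closing leaves: `Good` says that `o` is free at `c`,
  -- given the earlier choices `f`, and has rank h - ι among the free openings.
  let Good (c : T.tree.closingLeaves) (f : ∀ c' < c, T.tree.openingLeaves)
      (o : T.tree.openingLeaves) : Prop :=
    ((o : PlantedTree.LeafPosition) < c ∧ ∀ c' (h : c' < c), f c' h ≠ o) ∧
      ({o' : T.tree.openingLeaves | ((o' : PlantedTree.LeafPosition) < c ∧ ∀ c' (h : c' < c), f c' h ≠ o') ∧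
        o' ≤ o}.ncard : ℤ) = T.tree.height c - a.index c
  let F (c : T.tree.closingLeaves) (f : ∀ c' < c, T.tree.openingLeaves) : T.tree.openingLeaves :=
    -- The root leaf is a default value; `good` shows that it is never resorted to.
    if h : ∃ o, Good c f o then h.choose else ⟨⊥, Or.inl rfl⟩
  let f : T.tree.closingLeaves → T.tree.openingLeaves := wellFounded_lt.fix F
  have hf : ∀ c, f c = F c fun c' _ => f c' := fun c => WellFounded.fix_eq _ _ _
  have good : ∀ c, Good c (fun c' _ => f c') (f c) := by
    intro c
    induction c using WellFoundedLT.induction with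
    | ind c ih =>
      -- The earlier choices are good, hence forward and injective. So h openings are free at `c`,
      -- and the rank h - ι lies between 1 and h.
      have hcard := PlantedTree.ncard_unmatched f c (fun c' h => (ih c' h).1.1) (by
        intro c' h c'' h' heq
        rcases lt_trichotomy c' c'' with hlt | hlt | hlt
        · exact absurd heq ((ih c'' h').1.2 c' hlt)
        · exact hlt
        · exact absurd heq.symm ((ih c' h).1.2 c'' hlt))
      have hlt := a.index_lt c
      obtain ⟨o, ho, ho'⟩ := (Set.toFinite {o : T.tree.openingLeaves |
        (o : PlantedTree.LeafPosition) < c ∧ ∀ c' < c, f c' ≠ o}).exists_ncard_le_eq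
        (k := (T.tree.height c - a.index c).toNat) (by omega) (by omega)
      have hex : ∃ o, Good c (fun c' _ => f c') o := by
        refine ⟨o, ho, ?_⟩
        have h2 := congrArg (Nat.cast : ℕ → ℤ) ho'
        rw [Int.toNat_of_nonneg (by omega)] at h2
        exact h2
      rw [hf c]
      simp only [F]
      rw [dif_pos hex]
      exact hex.choose_spec
  have hinj : Function.Injective f := by
    intro c' c'' heq
    rcases lt_trichotomy c' c'' with hlt | hlt | hlt
    · exact absurd heq ((good c'').1.2 c' hlt)
    · exact hlt
    · exact absurd heq.symm ((good c').1.2 c'' hlt)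
  -- There are as many opening as closing leaves, so every opening is used.
  have hbij : Function.Bijective f := by
    have := Fintype.ofFinite T.tree.openingLeaves
    have := Fintype.ofFinite T.tree.closingLeaves
    rw [Fintype.bijective_iff_injective_and_card]
    refine ⟨hinj, ?_⟩
    rw [← Nat.card_eq_fintype_card, ← Nat.card_eq_fintype_card]
    exact T.card_eq.symm
  let m : ForwardMatching T :=
    { toEquiv := (Equiv.ofBijective f hbij).symm
      forward := fun o => by
        obtain ⟨c, rfl⟩ := hbij.2 o
        have : (Equiv.ofBijective f hbij).symm (f c) = c :=
          (Equiv.ofBijective f hbij).symm_apply_apply c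
        rw [this]
        exact (good c).1.1 }
  have hm : ∀ c, m.toEquiv.symm c = f c := fun c => rfl
  refine ⟨m, fun c => ⟨m.symm_mem_available c, ?_⟩⟩
  rw [m.available_eq]
  exact (good c).2

end MatchingAssignment

/-- The forward matching encoded by the matching-indices. -/
noncomputable def MatchingAssignment.matching {T : BlossomingTree} (a : MatchingAssignment T) :
    ForwardMatching T := a.exists_encodes.choose

theorem MatchingAssignment.encodes_matching {T : BlossomingTree} (a : MatchingAssignment T) :
    a.Encodes a.matching := a.exists_encodes.choose_spec

/-- Enriched Eulerian trees correspond to Eulerian trees endowed with a forward matching. -/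
noncomputable def enrichedEquivMatched : EnrichedEulerianTree ≃ MatchedEulerianTree where
  toFun S := ⟨S.tree, S.eulerian, S.assignment.matching⟩
  invFun S := ⟨S.tree, S.eulerian, S.matching.isBalanced, S.matching.assignment⟩
  left_inv := by
    rintro ⟨T, hE, hB, a⟩
    simp only [EnrichedEulerianTree.mk.injEq, true_and, heq_eq_eq]
    exact a.encodes_matching.eq_assignment.symm
  right_inv := by
    rintro ⟨T, hE, m⟩
    simp only [MatchedEulerianTree.mk.injEq, true_and, heq_eq_eq]
    exact m.assignment.encodes_matching.unique m.assignment_encodes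

/-! ### Closing a tree -/

namespace PlantedTree

theorem finite_halfEdges (T : PlantedTree) : T.halfEdges.Finite := by
  classical
  have h : T.halfEdges ⊆ ⋃ x ∈ T.positions.toFinset, (fun j => (x.1, j)) ''
      {j : ℕ | ∃ n child, x.2 = node n child ∧ j ≤ n} := by
    rintro ⟨a, j⟩ ⟨n, child, h, hj⟩
    simp only [Set.mem_iUnion]
    exact ⟨(a, node n child), by simpa using mem_positions.2 h, j, ⟨n, child, rfl, hj⟩, rfl⟩
  refine Set.Finite.subset (Set.Finite.biUnion (Finset.finite_toSet _) fun x _ => ?_) h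
  refine Set.Finite.image _ ?_
  cases x.2 with
  | opening => simp
  | closing => simp
  | node n child =>
    refine (Set.finite_Iic n).subset ?_
    rintro j ⟨n', child', h, hj⟩
    cases h
    exact hj

instance (T : PlantedTree) : Finite T.halfEdges := T.finite_halfEdges

@[simp] theorem stem_bot : stem ⊥ = ([], 0) := rfl

@[simp] theorem stem_concat (a : List ℕ) (j : ℕ) :
    stem ((a ++ [j] : List ℕ) : LeafPosition) = (a, j + 1) := by
  simp [stem]

/-- The position reached from a node by following a half-edge away from the root; for the half-edge
that leads from a node towards the root, the position of this node, or the root leaf. -/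
def slotPos : List ℕ × ℕ → LeafPosition
  | ([], 0) => ⊥
  | (j :: a, 0) => ((j :: a : List ℕ) : LeafPosition)
  | (a, j + 1) => ((a ++ [j] : List ℕ) : LeafPosition)

@[simp] theorem slotPos_root : slotPos ([], 0) = ⊥ := rfl

@[simp] theorem slotPos_up (a : List ℕ) (j : ℕ) :
    slotPos (a ++ [j], 0) = ((a ++ [j] : List ℕ) : LeafPosition) := by
  cases a <;> rfl

@[simp] theorem slotPos_down (a : List ℕ) (j : ℕ) :
    slotPos (a, j + 1) = ((a ++ [j] : List ℕ) : LeafPosition) := by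
  cases a <;> rfl

@[simp] theorem bot_mem_openingLeaves (T : PlantedTree) : (⊥ : LeafPosition) ∈ T.openingLeaves :=
  Or.inl rfl

@[simp] theorem coe_mem_openingLeaves {T : PlantedTree} {a : List ℕ} :
    (a : LeafPosition) ∈ T.openingLeaves ↔ T.subtreeAt a = some opening := by
  simp [openingLeaves]

@[simp] theorem bot_notMem_closingLeaves (T : PlantedTree) :
    (⊥ : LeafPosition) ∉ T.closingLeaves := by
  simp [closingLeaves]

@[simp] theorem coe_mem_closingLeaves {T : PlantedTree} {a : List ℕ} :
    (a : LeafPosition) ∈ T.closingLeaves ↔ T.subtreeAt a = some closing := by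
  simp [closingLeaves]

theorem disjoint_openingLeaves_closingLeaves (T : PlantedTree) :
    Disjoint T.openingLeaves T.closingLeaves := by
  rw [Set.disjoint_left]
  rintro p (rfl | ⟨a, rfl, h⟩) hp
  · simp at hp
  · rw [coe_mem_closingLeaves, h] at hp
    simp at hp

theorem mem_halfEdges {T : PlantedTree} {a : List ℕ} {j : ℕ} :
    (a, j) ∈ T.halfEdges ↔ ∃ n child, T.subtreeAt a = some (node n child) ∧ j ≤ n := Iff.rfl

theorem mem_halfEdges_succ {T : PlantedTree} {a : List ℕ} {j : ℕ} :
    (a, j + 1) ∈ T.halfEdges ↔ ∃ S, T.subtreeAt (a ++ [j]) = some S := by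
  rw [mem_halfEdges]
  constructor
  · rintro ⟨n, child, h, hj⟩
    exact ⟨child ⟨j, hj⟩, subtreeAt_concat_eq_some.2 ⟨n, child, h, ⟨j, hj⟩, rfl, rfl⟩⟩
  · rintro ⟨S, h⟩
    obtain ⟨n, child, h', i, rfl, -⟩ := subtreeAt_concat_eq_some.1 h
    exact ⟨n, child, h', i.2⟩

theorem mem_halfEdges_zero {T : PlantedTree} {a : List ℕ} :
    (a, 0) ∈ T.halfEdges ↔ ∃ n child, T.subtreeAt a = some (node n child) := by
  simp [mem_halfEdges]

/-- A tree with at least one node. -/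
def IsNode (T : PlantedTree) : Prop := ∃ n child, T = node n child

theorem IsNode.root_mem {T : PlantedTree} (hT : T.IsNode) : ([], 0) ∈ T.halfEdges := by
  obtain ⟨n, child, rfl⟩ := hT
  exact mem_halfEdges_zero.2 ⟨n, child, by simp⟩

theorem isNode_of_mem_halfEdges {T : PlantedTree} {x : List ℕ × ℕ} (hx : x ∈ T.halfEdges) :
    T.IsNode := by
  obtain ⟨n, child, h, -⟩ := hx
  cases T with
  | opening => cases hx : x.1 <;> simp [hx] at h
  | closing => cases hx : x.1 <;> simp [hx] at h
  | node n child => exact ⟨n, child, rfl⟩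

theorem IsNode.eq_concat_of_leaf {T : PlantedTree} (hT : T.IsNode) {a : List ℕ} {S : PlantedTree}
    (h : T.subtreeAt a = some S) (hS : ¬ S.IsNode) : ∃ b j, a = b ++ [j] := by
  rcases List.eq_nil_or_concat a with rfl | ⟨b, j, rfl⟩
  · simp only [subtreeAt_nil, Option.some.injEq] at h
    exact absurd (h ▸ hT) hS
  · exact ⟨b, j, by simp⟩

theorem not_isNode_opening : ¬ opening.IsNode := by rintro ⟨n, child, h⟩; cases h

theorem not_isNode_closing : ¬ closing.IsNode := by rintro ⟨n, child, h⟩; cases h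

theorem IsNode.stem_opening {T : PlantedTree} (hT : T.IsNode) {p : LeafPosition}
    (hp : p ∈ T.openingLeaves) : stem p ∈ T.halfEdges ∧ slotPos (stem p) = p := by
  obtain rfl | ⟨a, rfl, h⟩ := hp
  · exact ⟨hT.root_mem, rfl⟩
  · obtain ⟨b, j, rfl⟩ := hT.eq_concat_of_leaf h not_isNode_opening
    rw [stem_concat, slotPos_down]
    exact ⟨mem_halfEdges_succ.2 ⟨_, h⟩, rfl⟩

theorem IsNode.stem_closing {T : PlantedTree} (hT : T.IsNode) {p : LeafPosition}
    (hp : p ∈ T.closingLeaves) : stem p ∈ T.halfEdges ∧ slotPos (stem p) = p := by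
  obtain ⟨a, rfl, h⟩ := hp
  obtain ⟨b, j, rfl⟩ := hT.eq_concat_of_leaf h not_isNode_closing
  rw [stem_concat, slotPos_down]
  exact ⟨mem_halfEdges_succ.2 ⟨_, h⟩, rfl⟩

/-- The half-edges of a tree are at the end of a leaf, or they belong to an edge between two nodes. -/
theorem halfEdges_cases {T : PlantedTree} {x : List ℕ × ℕ} (hx : x ∈ T.halfEdges) :
    (stem (slotPos x) = x ∧ (slotPos x ∈ T.openingLeaves ∨ slotPos x ∈ T.closingLeaves)) ∨
    ∃ a j n child, T.subtreeAt (a ++ [j]) = some (node n child) ∧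
      (x = (a ++ [j], 0) ∨ x = (a, j + 1)) := by
  obtain ⟨a, j⟩ := x
  cases j with
  | zero =>
    rcases List.eq_nil_or_concat a with rfl | ⟨b, j, rfl⟩
    · simp
    · obtain ⟨n, child, h⟩ := mem_halfEdges_zero.1 hx
      right
      exact ⟨b, j, n, child, by simpa using h, by simp⟩
  | succ j =>
    obtain ⟨S, h⟩ := mem_halfEdges_succ.1 hx
    cases S with
    | opening => left; simp [h]
    | closing => left; simp [h]
    | node n child => right; exact ⟨a, j, n, child, h, Or.inr rfl⟩

open Classical in
/-- The next half-edge in clockwise order around a node. -/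
noncomputable def next (T : PlantedTree) (x : List ℕ × ℕ) : List ℕ × ℕ :=
  if ∃ child, T.subtreeAt x.1 = some (node x.2 child) then (x.1, 0) else (x.1, x.2 + 1)

theorem next_of_lt {T : PlantedTree} {a : List ℕ} {n j : ℕ} {child : Fin n → PlantedTree}
    (h : T.subtreeAt a = some (node n child)) (hj : j < n) : T.next (a, j) = (a, j + 1) := by
  rw [next, if_neg]
  rintro ⟨child', h'⟩
  rw [h] at h'
  simp only [Option.some.injEq, node.injEq] at h'
  omega

theorem next_last {T : PlantedTree} {a : List ℕ} {n : ℕ} {child : Fin n → PlantedTree}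
    (h : T.subtreeAt a = some (node n child)) : T.next (a, n) = (a, 0) := by
  rw [next, if_pos ⟨child, h⟩]

theorem next_mem {T : PlantedTree} {x : List ℕ × ℕ} (hx : x ∈ T.halfEdges) :
    T.next x ∈ T.halfEdges := by
  obtain ⟨a, j⟩ := x
  obtain ⟨n, child, h, hj⟩ := hx
  rcases lt_or_eq_of_le hj with hj | hj
  · rw [next_of_lt h hj]
    exact ⟨n, child, h, hj⟩
  · simp only at hj h
    subst hj
    rw [next_last h]
    exact ⟨_, child, h, Nat.zero_le _⟩

theorem next_injOn (T : PlantedTree) : Set.InjOn T.next T.halfEdges := by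
  rintro ⟨a, j⟩ ⟨n, child, h, hj⟩ ⟨a', j'⟩ ⟨n', child', h', hj'⟩ heq
  simp only at h h' hj hj'
  have ha : a = a' := by
    have := congrArg Prod.fst heq
    unfold next at this
    split_ifs at this <;> simpa using this
  subst ha
  rw [h] at h'
  simp only [Option.some.injEq, node.injEq] at h'
  obtain ⟨rfl, -⟩ := h'
  rcases lt_or_eq_of_le hj with hj | rfl <;> rcases lt_or_eq_of_le hj' with hj' | rfl
  · rw [next_of_lt h hj, next_of_lt h hj'] at heq
    simpa using heq
  · rw [next_of_lt h hj, next_last h] at heq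
    simp at heq
  · rw [next_of_lt h hj', next_last h] at heq
    simp at heq
  · rfl

end PlantedTree

open PlantedTree

namespace ForwardMatching

variable {T : BlossomingTree}

open Classical in
/-- The other half of the edge of a half-edge, once matched leaves are merged. -/
noncomputable def mate (m : ForwardMatching T) (x : List ℕ × ℕ) : List ℕ × ℕ :=
  if h : slotPos x ∈ T.tree.openingLeaves then stem (m.toEquiv ⟨_, h⟩)
  else if h : slotPos x ∈ T.tree.closingLeaves then stem (m.toEquiv.symm ⟨_, h⟩)
  -- Edge between two nodes: on the address of a node, `stem` still computes the parent's half-edge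
  -- towards it. The `- 1` undoes the shift by which index 0 denotes the upward half-edge.
  else if x.2 = 0 then stem x.1 else (x.1 ++ [x.2 - 1], 0)

theorem mate_opening (m : ForwardMatching T) {x : List ℕ × ℕ}
    (h : slotPos x ∈ T.tree.openingLeaves) : m.mate x = stem (m.toEquiv ⟨_, h⟩) := by
  rw [mate, dif_pos h]

theorem mate_closing (m : ForwardMatching T) {x : List ℕ × ℕ}
    (h : slotPos x ∈ T.tree.closingLeaves) : m.mate x = stem (m.toEquiv.symm ⟨_, h⟩) := by
  rw [mate, dif_neg, dif_pos h]
  exact fun h' => Set.disjoint_left.1 T.tree.disjoint_openingLeaves_closingLeaves h' h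

theorem mate_up (m : ForwardMatching T) {a : List ℕ} {j n : ℕ} {child : Fin n → PlantedTree}
    (h : T.tree.subtreeAt (a ++ [j]) = some (node n child)) :
    m.mate (a ++ [j], 0) = (a, j + 1) := by
  rw [mate, dif_neg, dif_neg, if_pos rfl, stem_concat] <;> simp [h]

theorem mate_down (m : ForwardMatching T) {a : List ℕ} {j n : ℕ} {child : Fin n → PlantedTree}
    (h : T.tree.subtreeAt (a ++ [j]) = some (node n child)) :
    m.mate (a, j + 1) = (a ++ [j], 0) := by
  rw [mate, dif_neg, dif_neg, if_neg] <;> simp [h]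

theorem mate_mem (m : ForwardMatching T) {x : List ℕ × ℕ} (hx : x ∈ T.tree.halfEdges) :
    m.mate x ∈ T.tree.halfEdges := by
  have hT := isNode_of_mem_halfEdges hx
  rcases halfEdges_cases hx with ⟨-, h | h⟩ | ⟨a, j, n, child, h, rfl | rfl⟩
  · rw [m.mate_opening h]
    exact (hT.stem_closing (Subtype.prop _)).1
  · rw [m.mate_closing h]
    exact (hT.stem_opening (Subtype.prop _)).1
  · rw [m.mate_up h]
    exact mem_halfEdges_succ.2 ⟨_, h⟩
  · rw [m.mate_down h]
    exact mem_halfEdges_zero.2 ⟨_, _, h⟩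

theorem mate_stem_opening (m : ForwardMatching T) (hT : T.tree.IsNode) (o : T.tree.openingLeaves) :
    m.mate (stem o) = stem (m.toEquiv o) := by
  have h := (hT.stem_opening o.2).2
  rw [m.mate_opening (by rw [h]; exact o.2)]
  congr 3
  exact Subtype.ext h

theorem mate_stem_closing (m : ForwardMatching T) (hT : T.tree.IsNode) (c : T.tree.closingLeaves) :
    m.mate (stem c) = stem (m.toEquiv.symm c) := by
  have h := (hT.stem_closing c.2).2
  rw [m.mate_closing (by rw [h]; exact c.2)]
  congr 3
  exact Subtype.ext h

theorem mate_mate (m : ForwardMatching T) {x : List ℕ × ℕ} (hx : x ∈ T.tree.halfEdges) :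
    m.mate (m.mate x) = x := by
  have hT := isNode_of_mem_halfEdges hx
  rcases halfEdges_cases hx with ⟨h', h | h⟩ | ⟨a, j, n, child, h, rfl | rfl⟩
  · rw [m.mate_opening h, m.mate_stem_closing hT, Equiv.symm_apply_apply, h']
  · rw [m.mate_closing h, m.mate_stem_opening hT, Equiv.apply_symm_apply, h']
  · rw [m.mate_up h, m.mate_down h]
  · rw [m.mate_down h, m.mate_up h]

theorem mate_ne (m : ForwardMatching T) {x : List ℕ × ℕ} (hx : x ∈ T.tree.halfEdges) :
    m.mate x ≠ x := by
  have hT := isNode_of_mem_halfEdges hx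
  have hd := Set.disjoint_left.1 T.tree.disjoint_openingLeaves_closingLeaves
  rcases halfEdges_cases hx with ⟨h', h | h⟩ | ⟨a, j, n, child, h, rfl | rfl⟩
  · rw [m.mate_opening h]
    intro heq
    have h2 := (hT.stem_closing (m.toEquiv ⟨_, h⟩).2)
    rw [heq] at h2
    exact hd h (h2.2 ▸ (m.toEquiv ⟨_, h⟩).2)
  · rw [m.mate_closing h]
    intro heq
    have h2 := (hT.stem_opening (m.toEquiv.symm ⟨_, h⟩).2)
    rw [heq] at h2
    exact hd (h2.2 ▸ (m.toEquiv.symm ⟨_, h⟩).2) h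
  · rw [m.mate_up h]
    simp
  · rw [m.mate_down h]
    simp

end ForwardMatching

namespace HalfEdgeMap

variable {T : BlossomingTree}

/-- Uniform form of the closure conditions: `f` transports `next` to `rot` and `mate` to `opp`. The
conditions on openings and on parent-to-child half-edges suffice because `opp` is an involution. -/
theorem isClosure_iff {m : ForwardMatching T} {M : HalfEdgeMap} :
    M.IsClosure m ↔ ∃ f : List ℕ × ℕ → Fin M.numHalfEdges,
      Set.BijOn f T.tree.halfEdges Set.univ ∧ M.root = f ([], 0) ∧
      (∀ x ∈ T.tree.halfEdges, M.rot (f x) = f (T.tree.next x)) ∧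
      ∀ x ∈ T.tree.halfEdges, M.opp (f x) = f (m.mate x) := by
  constructor
  · rintro ⟨f, hf, h0, hrot, hnode, hleaf⟩
    refine ⟨f, hf, h0, ?_, ?_⟩
    · rintro ⟨a, j⟩ ⟨n, child, h, hj⟩
      obtain ⟨h1, h2⟩ := hrot a n child h
      rcases lt_or_eq_of_le hj with hj | hj
      · rw [next_of_lt h hj]
        exact h1 j hj
      · simp only at hj h
        subst hj
        rw [next_last h]
        exact h2
    · intro x hx
      rcases halfEdges_cases hx with ⟨h', h | h⟩ | ⟨a, j, n, child, h, rfl | rfl⟩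
      · rw [m.mate_opening h, ← hleaf, h']
      · rw [m.mate_closing h, ← M.opp.apply_eq_iff_eq, M.opp_opp, hleaf, Equiv.apply_symm_apply, h']
      · rw [m.mate_up h, ← hnode a j n child h, M.opp_opp]
      · rw [m.mate_down h, hnode a j n child h]
  · rintro ⟨f, hf, h0, hrot, hopp⟩
    have hT : T.tree.IsNode := by
      obtain ⟨x, hx, -⟩ := hf.surjOn (Set.mem_univ M.root)
      exact isNode_of_mem_halfEdges hx
    refine ⟨f, hf, h0, ?_, ?_, ?_⟩
    · intro a n child h
      refine ⟨fun j hj => ?_, ?_⟩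
      · rw [hrot _ ⟨n, child, h, hj.le⟩, next_of_lt h hj]
      · rw [hrot _ ⟨n, child, h, le_rfl⟩, next_last h]
    · intro a j n child h
      rw [hopp _ (mem_halfEdges_succ.2 ⟨_, h⟩), m.mate_down h]
    · intro o
      rw [hopp _ (hT.stem_opening o.2).1, m.mate_stem_opening hT]

theorem IsClosure.isNode {m : ForwardMatching T} {M : HalfEdgeMap} (h : M.IsClosure m) :
    T.tree.IsNode := by
  obtain ⟨f, hf, -⟩ := h
  obtain ⟨x, hx, -⟩ := hf.surjOn (Set.mem_univ M.root)
  exact isNode_of_mem_halfEdges hx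

/-- The isomorphism is f' ∘ f⁻¹, since both identifications transport the same `next` and `mate`. -/
theorem IsClosure.iso {m : ForwardMatching T} {M N : HalfEdgeMap} (hM : M.IsClosure m)
    (hN : N.IsClosure m) : Iso M N := by
  have hT := hM.isNode
  obtain ⟨f, hf, h0, hrot, hopp⟩ := isClosure_iff.1 hM
  obtain ⟨f', hf', h0', hrot', hopp'⟩ := isClosure_iff.1 hN
  have hs : ∀ d, ∃ x ∈ T.tree.halfEdges, f x = d := fun d => hf.surjOn (Set.mem_univ d)
  choose inv hinv hfinv using hs
  have hinvf : ∀ x ∈ T.tree.halfEdges, inv (f x) = x := fun x hx =>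
    hf.injOn (hinv _) hx (hfinv _)
  have hb : Function.Bijective fun d => f' (inv d) := by
    constructor
    · intro d d' h
      have := hf'.injOn (hinv _) (hinv _) h
      rw [← hfinv d, this, hfinv]
    · intro d
      obtain ⟨x, hx, rfl⟩ := hf'.surjOn (Set.mem_univ d)
      exact ⟨f x, by simp only [hinvf x hx]⟩
  have hmem : ∀ d, ∃ x ∈ T.tree.halfEdges, d = f x := fun d => ⟨inv d, hinv d, (hfinv d).symm⟩
  refine ⟨Equiv.ofBijective _ hb, ?_, fun d => ?_, fun d => ?_⟩
  · rw [Equiv.ofBijective_apply, h0, hinvf _ hT.root_mem, h0']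
  · obtain ⟨x, hx, rfl⟩ := hmem d
    simp only [Equiv.ofBijective_apply]
    rw [hrot x hx, hinvf x hx, hinvf _ (next_mem hx), hrot' x hx]
  · obtain ⟨x, hx, rfl⟩ := hmem d
    simp only [Equiv.ofBijective_apply]
    rw [hopp x hx, hinvf x hx, hinvf _ (m.mate_mem hx), hopp' x hx]

theorem IsClosure.of_iso {m : ForwardMatching T} {M N : HalfEdgeMap} (hM : M.IsClosure m)
    (h : Iso M N) : N.IsClosure m := by
  obtain ⟨f, hf, h0, hrot, hopp⟩ := isClosure_iff.1 hM
  obtain ⟨e, k0, krot, kopp⟩ := h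
  refine isClosure_iff.2 ⟨fun x => e (f x), ?_, by rw [← k0, h0], fun x hx => ?_, fun x hx => ?_⟩
  · exact (Set.bijOn_univ.2 e.bijective).comp hf
  · rw [← krot, hrot x hx]
  · rw [← kopp, hopp x hx]

/-- The half-edges of the tree are numbered and `next`, `mate` become the two permutations. The only
condition with content is connectedness, which already holds along the edges of the tree. -/
theorem exists_isClosure (m : ForwardMatching T) (hT : T.tree.IsNode) :
    ∃ M : HalfEdgeMap, M.IsClosure m := by
  let H := T.tree.halfEdges
  let nx : H → H := fun x => ⟨T.tree.next x, next_mem x.2⟩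
  have hnx : Function.Injective nx := fun x y h =>
    Subtype.ext (T.tree.next_injOn x.2 y.2 (congrArg Subtype.val h))
  let rot : Equiv.Perm H := Equiv.ofBijective nx (Finite.injective_iff_bijective.1 hnx)
  let mt : H → H := fun x => ⟨m.mate x, m.mate_mem x.2⟩
  have hmt : Function.Involutive mt := fun x => Subtype.ext (m.mate_mate x.2)
  let opp : Equiv.Perm H := hmt.toPerm
  let e : H ≃ Fin (Nat.card H) := Finite.equivFin H
  let root : H := ⟨([], 0), hT.root_mem⟩
  let G := Subgroup.closure {e.permCongr rot, e.permCongr opp}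
  have hrotG : e.permCongr rot ∈ G := Subgroup.subset_closure (Or.inl rfl)
  have hoppG : e.permCongr opp ∈ G := Subgroup.subset_closure (Or.inr rfl)
  have step : ∀ {p : Equiv.Perm H} (_ : e.permCongr p ∈ G) (x : H),
      (∃ q ∈ G, q (e root) = e x) → ∃ q ∈ G, q (e root) = e (p x) := by
    rintro p hp x ⟨q, hq, h⟩
    refine ⟨e.permCongr p * q, G.mul_mem hp hq, ?_⟩
    rw [Equiv.Perm.mul_apply, h, Equiv.permCongr_apply, Equiv.symm_apply_apply]
  -- Induction on the address: `opp` leads from the parent to the upward half-edge of a node, and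
  -- `rot` then runs through the other half-edges of this node.
  have reach : ∀ (a : List ℕ) (j : ℕ) (h : (a, j) ∈ H), ∃ q ∈ G, q (e root) = e ⟨(a, j), h⟩ := by
    intro a
    induction a using List.reverseRecOn with
    | nil =>
      intro j
      induction j with
      | zero => exact fun _ => ⟨1, G.one_mem, rfl⟩
      | succ j ih =>
        rintro ⟨n, child, h, hj⟩
        convert step hrotG _ (ih ⟨n, child, h, (Nat.lt_of_succ_le hj).le⟩) using 5
        exact Subtype.ext (next_of_lt h (Nat.lt_of_succ_le hj)).symm
    | append_singleton a i iha =>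
      intro j
      induction j with
      | zero =>
        intro h
        obtain ⟨n, child, h'⟩ := mem_halfEdges_zero.1 h
        convert step hoppG _ (iha (i + 1) (mem_halfEdges_succ.2 ⟨_, h'⟩)) using 5
        exact Subtype.ext (m.mate_down h').symm
      | succ j ih =>
        rintro ⟨n, child, h, hj⟩
        convert step hrotG _ (ih ⟨n, child, h, (Nat.lt_of_succ_le hj).le⟩) using 5
        exact Subtype.ext (next_of_lt h (Nat.lt_of_succ_le hj)).symm
  have reach' : ∀ d, ∃ q ∈ G, q (e root) = d := by
    intro d
    obtain ⟨q, hq, h⟩ := reach (e.symm d).1.1 (e.symm d).1.2 (e.symm d).2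
    exact ⟨q, hq, h.trans (e.apply_symm_apply d)⟩
  let M : HalfEdgeMap :=
    { numHalfEdges := Nat.card H
      rot := e.permCongr rot
      opp := e.permCongr opp
      opp_opp := fun d => by
        rw [Equiv.permCongr_apply, Equiv.permCongr_apply, Equiv.symm_apply_apply]
        rw [show opp (opp (e.symm d)) = e.symm d from hmt _, Equiv.apply_symm_apply]
      opp_ne := fun d h => by
        rw [Equiv.permCongr_apply, ← Equiv.eq_symm_apply] at h
        exact m.mate_ne (e.symm d).2 (congrArg Subtype.val h)
      connected := fun d d' => by
        obtain ⟨q, hq, h⟩ := reach' d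
        obtain ⟨q', hq', h'⟩ := reach' d'
        refine ⟨q' * q⁻¹, G.mul_mem hq' (G.inv_mem hq), ?_⟩
        rw [Equiv.Perm.mul_apply, ← h, Equiv.Perm.inv_def, Equiv.symm_apply_apply, h']
      root := e root }
  classical
  let f : List ℕ × ℕ → Fin M.numHalfEdges := fun x => if h : x ∈ H then e ⟨x, h⟩ else e root
  have hf : ∀ x : H, f x = e x := fun x => by simp only [f]; rw [dif_pos x.2]
  refine ⟨M, isClosure_iff.2 ⟨f, ⟨fun _ _ => Set.mem_univ _, ?_, ?_⟩, ?_, ?_, ?_⟩⟩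
  · intro x hx y hy h
    rw [hf ⟨x, hx⟩, hf ⟨y, hy⟩] at h
    exact congrArg Subtype.val (e.injective h)
  · intro d _
    exact ⟨(e.symm d).1, (e.symm d).2, by rw [hf, Equiv.apply_symm_apply]⟩
  · exact (hf root).symm
  · intro x hx
    rw [hf ⟨x, hx⟩, hf ⟨_, next_mem hx⟩]
    change e.permCongr rot (e ⟨x, hx⟩) = _
    rw [Equiv.permCongr_apply, Equiv.symm_apply_apply]
    rfl
  · intro x hx
    rw [hf ⟨x, hx⟩, hf ⟨_, m.mate_mem hx⟩]
    change e.permCongr opp (e ⟨x, hx⟩) = _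
    rw [Equiv.permCongr_apply, Equiv.symm_apply_apply]
    rfl

end HalfEdgeMap

/-! ### Degrees of the closure of a tree -/

theorem Multiset.sum_map_ite_singleton {α β : Type*} (s : Multiset α) (p : α → Prop)
    [DecidablePred p] (d : α → β) :
    (s.map fun x => if p x then ({d x} : Multiset β) else 0).sum = (s.filter p).map d := by
  induction s using Multiset.induction with
  | empty => simp
  | cons x s ih =>
    rw [Multiset.map_cons, Multiset.sum_cons, ih]
    by_cases h : p x <;> simp [h]

theorem Equiv.Perm.SameCycle.apply_eq_of_invariant {α β : Type*} [Finite α] {p : Equiv.Perm α}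
    {g : α → β} (hg : ∀ x, g (p x) = g x) {x y : α} (h : p.SameCycle x y) : g x = g y := by
  obtain ⟨n, rfl⟩ := h.exists_nat_pow_eq
  clear h
  induction n with
  | zero => simp
  | succ n ih => rw [pow_succ', Equiv.Perm.mul_apply, hg, ih]

namespace PlantedTree

theorem sum_map_positions_node {A : Type*} [AddCommMonoid A] {n : ℕ} (child : Fin n → PlantedTree)
    (φ : List ℕ × PlantedTree → A) :
    ((node n child).positions.map φ).sum = φ ([], node n child) +
      ∑ j, ((child j).positions.map fun x => φ ((j : ℕ) :: x.1, x.2)).sum := by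
  rw [positions, Multiset.map_cons, Multiset.sum_cons]
  congr 1
  rw [← Multiset.coe_mapAddMonoidHom, map_sum, ← Multiset.coe_sumAddMonoidHom, map_sum]
  simp [Multiset.map_map]

/-- The number of edges that lead away from the root. -/
def arity : PlantedTree → ℕ
  | opening => 0
  | closing => 0
  | node n _ => n

open Classical in
theorem nodeDegrees_eq_sum (T : PlantedTree) :
    T.nodeDegrees = (T.positions.map fun x => if x.2.IsNode then {x.2.arity + 1} else 0).sum := by
  induction T with
  | opening => simp [nodeDegrees, positions, not_isNode_opening]
  | closing => simp [nodeDegrees, positions, not_isNode_closing]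
  | node n child ih =>
    rw [sum_map_positions_node, nodeDegrees, if_pos ⟨n, child, rfl⟩]
    simp [ih, arity]

open Classical in
theorem nodeDegrees_eq_map (T : PlantedTree) :
    T.nodeDegrees = (T.positions.filter fun x => x.2.IsNode).map fun x => x.2.arity + 1 := by
  rw [nodeDegrees_eq_sum, Multiset.sum_map_ite_singleton]

theorem IsEulerian.even_nodeDegrees {T : PlantedTree} (hT : T.IsEulerian) :
    ∀ d ∈ T.nodeDegrees, Even d ∧ 0 < d := by
  induction T with
  | opening => simp [nodeDegrees]
  | closing => simp [nodeDegrees]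
  | node n child ih =>
    obtain ⟨⟨k, hk, -⟩, h⟩ := hT
    intro d hd
    rw [nodeDegrees, Multiset.mem_cons, Multiset.mem_sum] at hd
    rcases hd with rfl | ⟨j, -, hd⟩
    · exact ⟨⟨k, by omega⟩, by omega⟩
    · exact ih j (h j) d hd

theorem IsEulerian.subtreeAt {T : PlantedTree} (hT : T.IsEulerian) {a : List ℕ} {S : PlantedTree}
    (h : T.subtreeAt a = some S) : S.IsEulerian := by
  induction a generalizing T with
  | nil =>
    simp only [subtreeAt_nil, Option.some.injEq] at h
    exact h ▸ hT
  | cons j a ih =>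
    cases T with
    | opening => simp at h
    | closing => simp at h
    | node n child =>
      obtain ⟨i, -, h⟩ := subtreeAt_node_cons_eq_some.1 h
      exact ih (hT.2 i) h

end PlantedTree

namespace HalfEdgeMap

theorem vertexOf_eq_iff {M : HalfEdgeMap} {d d' : Fin M.numHalfEdges} :
    M.vertexOf d = M.vertexOf d' ↔ M.rot.SameCycle d d' := Quotient.eq

@[simp] theorem vertexOf_rot (M : HalfEdgeMap) (d : Fin M.numHalfEdges) :
    M.vertexOf (M.rot d) = M.vertexOf d :=
  vertexOf_eq_iff.2 (Equiv.Perm.sameCycle_apply_left.2 (Equiv.Perm.SameCycle.refl _ _))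

theorem sum_degrees (M : HalfEdgeMap) : M.degrees.sum = M.numHalfEdges := by
  have h := Nat.card_congr (Equiv.sigmaFiberEquiv M.vertexOf)
  rw [Nat.card_sigma, Nat.card_fin] at h
  rw [← h]
  rfl

section

variable {T : BlossomingTree} {m : ForwardMatching T} {M : HalfEdgeMap}
  {f : List ℕ × ℕ → Fin M.numHalfEdges}

theorem vertexOf_eq_vertexOf_zero (hrot : ∀ x ∈ T.tree.halfEdges, M.rot (f x) = f (T.tree.next x))
    {a : List ℕ} {j : ℕ} (h : (a, j) ∈ T.tree.halfEdges) :
    M.vertexOf (f (a, j)) = M.vertexOf (f (a, 0)) := by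
  induction j with
  | zero => rfl
  | succ j ih =>
    obtain ⟨n, child, h', hj⟩ := h
    have hj' : j < n := hj
    have h2 : (a, j) ∈ T.tree.halfEdges := ⟨n, child, h', hj'.le⟩
    rw [← ih h2, ← next_of_lt h' hj', ← hrot _ h2, vertexOf_rot]

/-- The address of the node is invariant under `next`, hence constant on each cycle of `rot`. -/
theorem fst_eq_of_vertexOf_eq (hf : Set.BijOn f T.tree.halfEdges Set.univ)
    (hrot : ∀ x ∈ T.tree.halfEdges, M.rot (f x) = f (T.tree.next x))
    {x y : List ℕ × ℕ} (hx : x ∈ T.tree.halfEdges) (hy : y ∈ T.tree.halfEdges)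
    (h : M.vertexOf (f x) = M.vertexOf (f y)) : x.1 = y.1 := by
  have hs : ∀ d, ∃ x ∈ T.tree.halfEdges, f x = d := fun d => hf.surjOn (Set.mem_univ d)
  choose inv hinv hfinv using hs
  have hinvf : ∀ x ∈ T.tree.halfEdges, inv (f x) = x := fun x hx =>
    hf.injOn (hinv _) hx (hfinv _)
  have key := (vertexOf_eq_iff.1 h).apply_eq_of_invariant (g := fun d => (inv d).1) (fun d => by
    rw [← hfinv d, hrot _ (hinv d), hinvf _ (next_mem (hinv d)), hinvf _ (hinv d)]
    unfold next
    split_ifs <;> rfl)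
  simpa only [hinvf x hx, hinvf y hy] using key

theorem degree_vertexOf (hf : Set.BijOn f T.tree.halfEdges Set.univ)
    (hrot : ∀ x ∈ T.tree.halfEdges, M.rot (f x) = f (T.tree.next x))
    {a : List ℕ} {n : ℕ} {child : Fin n → PlantedTree}
    (h : T.tree.subtreeAt a = some (node n child)) : M.degree (M.vertexOf (f (a, 0))) = n + 1 := by
  have hmem : ∀ j : Fin (n + 1), (a, (j : ℕ)) ∈ T.tree.halfEdges := fun j =>
    ⟨n, child, h, Nat.le_of_lt_succ j.2⟩
  let F : Fin (n + 1) → {d // M.vertexOf d = M.vertexOf (f (a, 0))} := fun j =>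
    ⟨f (a, j), vertexOf_eq_vertexOf_zero hrot (hmem j)⟩
  have hF : Function.Bijective F := by
    constructor
    · intro i j hij
      have := hf.injOn (hmem i) (hmem j) (congrArg Subtype.val hij)
      simp only [Prod.mk.injEq, true_and] at this
      exact Fin.ext this
    · rintro ⟨d, hd⟩
      obtain ⟨⟨b, j⟩, hx, rfl⟩ := hf.surjOn (Set.mem_univ d)
      have hb : b = a := fst_eq_of_vertexOf_eq hf hrot hx (hmem 0) hd
      subst hb
      obtain ⟨n', child', h', hj⟩ := hx
      rw [h] at h'
      simp only [Option.some.injEq, node.injEq] at h'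
      obtain ⟨rfl, -⟩ := h'
      exact ⟨⟨j, Nat.lt_succ_of_le hj⟩, rfl⟩
  rw [degree, ← Nat.card_congr (Equiv.ofBijective F hF), Nat.card_fin]

theorem IsClosure.degrees_eq (hM : M.IsClosure m) : M.degrees = T.tree.nodeDegrees := by
  classical
  obtain ⟨f, hf, h0, hrot, -⟩ := isClosure_iff.1 hM
  rw [nodeDegrees_eq_map, degrees]
  symm
  refine Multiset.map_eq_map_of_bij_of_nodup _ _ (T.tree.nodup_positions.filter _)
    Finset.univ.nodup (fun x _ => M.vertexOf (f (x.1, 0))) (fun _ _ => Finset.mem_univ _) ?_ ?_ ?_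
  · rintro ⟨a, S⟩ ha ⟨b, U⟩ hb h
    rw [Multiset.mem_filter, mem_positions] at ha hb
    obtain ⟨ha, n, child, rfl⟩ := ha
    obtain ⟨hb, n', child', rfl⟩ := hb
    have hab := fst_eq_of_vertexOf_eq hf hrot (mem_halfEdges_zero.2 ⟨_, _, ha⟩)
      (mem_halfEdges_zero.2 ⟨_, _, hb⟩) h
    simp only at hab
    subst hab
    rw [ha] at hb
    simpa using hb
  · intro v _
    obtain ⟨d, rfl⟩ := Quotient.exists_rep v
    obtain ⟨⟨a, j⟩, hx, rfl⟩ := hf.surjOn (Set.mem_univ d)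
    obtain ⟨n, child, h, hj⟩ := id hx
    refine ⟨(a, node n child), ?_, (vertexOf_eq_vertexOf_zero hrot hx).symm⟩
    rw [Multiset.mem_filter, mem_positions]
    exact ⟨h, n, child, rfl⟩
  · rintro ⟨a, S⟩ ha
    rw [Multiset.mem_filter, mem_positions] at ha
    obtain ⟨ha, n, child, rfl⟩ := ha
    exact (degree_vertexOf hf hrot ha).symm

end

end HalfEdgeMap

/-! ### Eulerian orientations -/

namespace HalfEdgeMap

/-- The sign of an oriented half-edge: `1` if it is outgoing, `-1` if it is incoming. -/
def orientationSign (b : Bool) : ℤ := if b then 1 else -1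

theorem orientationSign_not (b : Bool) : orientationSign (!b) = -orientationSign b := by
  cases b <;> rfl

open Classical in
/-- The number of outgoing half-edges minus the number of incoming half-edges at a vertex. -/
noncomputable def excess (M : HalfEdgeMap) (ω : Fin M.numHalfEdges → Bool) (v : M.Vertex) : ℤ :=
  ∑ d, if M.vertexOf d = v then orientationSign (ω d) else 0

/-- An orientation of the edges, given by the set of outgoing half-edges. -/
def IsOrientation (M : HalfEdgeMap) (ω : Fin M.numHalfEdges → Bool) : Prop :=
  ∀ d, ω (M.opp d) = !ω d

/-- There are as many outgoing as incoming half-edges at each vertex. -/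
structure IsEulerianOrientation (M : HalfEdgeMap) (ω : Fin M.numHalfEdges → Bool) : Prop where
  orientation : M.IsOrientation ω
  balanced : ∀ v, M.excess ω v = 0

open Classical in
theorem IsEulerianOrientation.sum_eq_zero {M : HalfEdgeMap} {ω : Fin M.numHalfEdges → Bool}
    (h : M.IsEulerianOrientation ω) (S : Set M.Vertex) :
    ∑ d, (if M.vertexOf d ∈ S then orientationSign (ω d) else 0) = 0 := by
  have h1 : ∑ d, (if M.vertexOf d ∈ S then orientationSign (ω d) else 0) =
      ∑ v, if v ∈ S then M.excess ω v else 0 := by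
    have h2 : ∀ v : M.Vertex, (if v ∈ S then M.excess ω v else 0) =
        ∑ d, if M.vertexOf d = v then (if M.vertexOf d ∈ S then orientationSign (ω d) else 0)
          else 0 := by
      intro v
      split_ifs with hv
      · refine Finset.sum_congr rfl fun d _ => ?_
        split_ifs with h3 h4
        · rfl
        · exact absurd (h3 ▸ hv) h4
        · rfl
      · refine (Finset.sum_eq_zero fun d _ => ?_).symm
        split_ifs with h3 h4
        · exact absurd (h3 ▸ h4) hv
        · rfl
        · rfl
    simp only [h2]
    rw [Finset.sum_comm]
    simp
  rw [h1]
  refine Finset.sum_eq_zero fun v _ => ?_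
  rw [h.balanced v, ite_self]

/-- Two Eulerian orientations cannot differ in such a way that an edge that leaves a set of vertices
is reversed, while each half-edge of this set that becomes outgoing belongs to an inner edge. -/
theorem IsEulerianOrientation.eq_of_boundary {M : HalfEdgeMap} {ω ω' : Fin M.numHalfEdges → Bool}
    (h : M.IsEulerianOrientation ω) (h' : M.IsEulerianOrientation ω') (S : Set M.Vertex)
    (hS : ∀ d, M.vertexOf d ∈ S → ω d = true → ω' d = false → M.vertexOf (M.opp d) ∈ S)
    {d : Fin M.numHalfEdges} (hd : M.vertexOf d ∈ S) (hd' : M.vertexOf (M.opp d) ∉ S) :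
    ω d = ω' d := by
  classical
  let δ : Fin M.numHalfEdges → ℤ := fun d => orientationSign (ω d) - orientationSign (ω' d)
  have hδ : ∀ d, δ (M.opp d) = -δ d := by
    intro d
    simp only [δ, h.orientation d, h'.orientation d, orientationSign_not]
    ring
  let In : Fin M.numHalfEdges → Prop := fun d => M.vertexOf d ∈ S
  have h1 : ∑ d, (if In d then δ d else 0) = 0 := by
    have := congrArg₂ (· - ·) (h.sum_eq_zero S) (h'.sum_eq_zero S)
    simp only [sub_zero] at this
    refine Eq.trans ?_ this
    rw [← Finset.sum_sub_distrib]
    refine Finset.sum_congr rfl fun d _ => ?_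
    by_cases hd : M.vertexOf d ∈ S <;> simp [In, δ, hd]
  -- The two halves of an inner edge cancel, so the total over the half-edges that leave `S` also
  -- vanishes.
  have h2 : ∑ d, (if In d ∧ In (M.opp d) then δ d else 0) = 0 := by
    have h3 : ∑ d, (if In d ∧ In (M.opp d) then δ d else 0) =
        -∑ d, (if In d ∧ In (M.opp d) then δ d else 0) := by
      conv_lhs => rw [← Equiv.sum_comp M.opp]
      rw [← Finset.sum_neg_distrib]
      refine Finset.sum_congr rfl fun d _ => ?_
      rw [M.opp_opp, hδ]
      by_cases hd : In d <;> by_cases hd' : In (M.opp d) <;> simp [hd, hd']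
    omega
  have h3 : ∑ d, (if In d ∧ ¬ In (M.opp d) then δ d else 0) = 0 := by
    have h4 : ∑ d, (if In d ∧ ¬ In (M.opp d) then δ d else 0) +
        ∑ d, (if In d ∧ In (M.opp d) then δ d else 0) = 0 := by
      refine Eq.trans ?_ h1
      rw [← Finset.sum_add_distrib]
      refine Finset.sum_congr rfl fun d _ => ?_
      by_cases hd : In d <;> by_cases hd' : In (M.opp d) <;> simp [hd, hd']
    rwa [h2, add_zero] at h4
  -- By `hS` no half-edge that leaves `S` contributes positively. A zero sum of nonpositive terms
  -- has all its terms zero.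
  have hneg : ∀ d ∈ Finset.univ, (if In d ∧ ¬ In (M.opp d) then δ d else 0) ≤ 0 := by
    intro d _
    split_ifs with hd
    · have := hS d hd.1
      simp only [δ]
      cases h4 : ω d <;> cases h5 : ω' d <;> simp [orientationSign]
      exact hd.2 (this h4 h5)
    · exact le_rfl
  have h4 := (Finset.sum_eq_zero_iff_of_nonpos hneg).1 h3 d (Finset.mem_univ d)
  rw [if_pos ⟨hd, hd'⟩] at h4
  simp only [δ] at h4
  cases h5 : ω d <;> cases h6 : ω' d <;> simp [orientationSign, h5, h6] at h4 ⊢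

end HalfEdgeMap

/-! ### The canonical Eulerian orientation of a closure -/

namespace ForwardMatching

variable {T : BlossomingTree}

/-- `f` identifies the half-edges of the closure of a tree with those of the map `M`. -/
structure ClosesTo (m : ForwardMatching T) (M : HalfEdgeMap)
    (f : List ℕ × ℕ → Fin M.numHalfEdges) : Prop where
  bijOn : Set.BijOn f T.tree.halfEdges Set.univ
  root : M.root = f ([], 0)
  rot : ∀ x ∈ T.tree.halfEdges, M.rot (f x) = f (T.tree.next x)
  opp : ∀ x ∈ T.tree.halfEdges, M.opp (f x) = f (m.mate x)

namespace ClosesTo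

variable {m : ForwardMatching T} {M : HalfEdgeMap} {f : List ℕ × ℕ → Fin M.numHalfEdges}

theorem isNode (h : m.ClosesTo M f) : T.tree.IsNode :=
  (HalfEdgeMap.isClosure_iff.2 ⟨f, h.bijOn, h.root, h.rot, h.opp⟩ : M.IsClosure m).isNode

theorem rot_of_lt (h : m.ClosesTo M f) {a : List ℕ} {n : ℕ} {child : Fin n → PlantedTree}
    (ha : T.tree.subtreeAt a = some (node n child)) {j : ℕ} (hj : j < n) :
    M.rot (f (a, j)) = f (a, j + 1) := by
  rw [h.rot _ ⟨n, child, ha, hj.le⟩, next_of_lt ha hj]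

theorem opp_up (h : m.ClosesTo M f) {a : List ℕ} {n j : ℕ} {child : Fin n → PlantedTree}
    (ha : T.tree.subtreeAt (a ++ [j]) = some (node n child)) :
    M.opp (f (a ++ [j], 0)) = f (a, j + 1) := by
  rw [h.opp _ (mem_halfEdges_zero.2 ⟨_, _, ha⟩), m.mate_up ha]

theorem opp_stem (h : m.ClosesTo M f) (o : T.tree.openingLeaves) :
    M.opp (f (stem o)) = f (stem (m.toEquiv o)) := by
  rw [h.opp _ (h.isNode.stem_opening o.2).1, m.mate_stem_opening h.isNode]

theorem opp_stem_closing (h : m.ClosesTo M f) (c : T.tree.closingLeaves) :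
    M.opp (f (stem c)) = f (stem (m.toEquiv.symm c)) := by
  rw [h.opp _ (h.isNode.stem_closing c.2).1, m.mate_stem_closing h.isNode]

/-- The identification is determined by the map. -/
theorem apply_eq {T' : BlossomingTree} {m' : ForwardMatching T'}
    {f' : List ℕ × ℕ → Fin M.numHalfEdges} (h : m.ClosesTo M f) (h' : m'.ClosesTo M f')
    {x : List ℕ × ℕ} (hx : x ∈ T.tree.halfEdges) (hx' : x ∈ T'.tree.halfEdges) : f x = f' x := by
  obtain ⟨a, j⟩ := x
  -- A half-edge is reached from the root by the same word in `rot` and `opp` in both trees, as long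
  -- as its address exists in both.
  induction a using List.reverseRecOn generalizing j with
  | nil =>
    induction j with
    | zero => rw [← h.root, ← h'.root]
    | succ j ih =>
      obtain ⟨n, child, ha, hj⟩ := hx
      obtain ⟨n', child', ha', hj'⟩ := hx'
      have hj : j < n := hj
      have hj' : j < n' := hj'
      rw [← h.rot_of_lt ha hj, ← h'.rot_of_lt ha' hj',
        ih ⟨n, child, ha, hj.le⟩ ⟨n', child', ha', hj'.le⟩]
  | append_singleton a i iha =>
    induction j with
    | zero =>
      obtain ⟨n, child, ha⟩ := mem_halfEdges_zero.1 hx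
      obtain ⟨n', child', ha'⟩ := mem_halfEdges_zero.1 hx'
      rw [← M.opp.apply_eq_iff_eq, h.opp_up ha, h'.opp_up ha']
      exact iha _ (mem_halfEdges_succ.2 ⟨_, ha⟩) (mem_halfEdges_succ.2 ⟨_, ha'⟩)
    | succ j ih =>
      obtain ⟨n, child, ha, hj⟩ := hx
      obtain ⟨n', child', ha', hj'⟩ := hx'
      have hj : j < n := hj
      have hj' : j < n' := hj'
      rw [← h.rot_of_lt ha hj, ← h'.rot_of_lt ha' hj',
        ih ⟨n, child, ha, hj.le⟩ ⟨n', child', ha', hj'.le⟩]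

theorem degree_eq (h : m.ClosesTo M f) {a : List ℕ} {n : ℕ} {child : Fin n → PlantedTree}
    (ha : T.tree.subtreeAt a = some (node n child)) : M.degree (M.vertexOf (f (a, 0))) = n + 1 :=
  HalfEdgeMap.degree_vertexOf h.bijOn h.rot ha

theorem vertexOf_eq_zero (h : m.ClosesTo M f) {a : List ℕ} {j : ℕ}
    (ha : (a, j) ∈ T.tree.halfEdges) : M.vertexOf (f (a, j)) = M.vertexOf (f (a, 0)) :=
  HalfEdgeMap.vertexOf_eq_vertexOf_zero h.rot ha

theorem fst_eq (h : m.ClosesTo M f) {x y : List ℕ × ℕ} (hx : x ∈ T.tree.halfEdges)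
    (hy : y ∈ T.tree.halfEdges) (hxy : M.vertexOf (f x) = M.vertexOf (f y)) : x.1 = y.1 :=
  HalfEdgeMap.fst_eq_of_vertexOf_eq h.bijOn h.rot hx hy hxy

open Classical in
theorem sum_vertex (h : m.ClosesTo M f) {a : List ℕ} {n : ℕ} {child : Fin n → PlantedTree}
    (ha : T.tree.subtreeAt a = some (node n child)) (φ : Fin M.numHalfEdges → ℤ) :
    ∑ d, (if M.vertexOf d = M.vertexOf (f (a, 0)) then φ d else 0) =
      φ (f (a, 0)) + ∑ j : Fin n, φ (f (a, j + 1)) := by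
  have hmem : ∀ j : Fin (n + 1), (a, (j : ℕ)) ∈ T.tree.halfEdges := fun j =>
    ⟨n, child, ha, Nat.le_of_lt_succ j.2⟩
  rw [← Finset.sum_filter]
  trans ∑ j : Fin (n + 1), φ (f (a, j))
  · symm
    refine Finset.sum_bij (fun j _ => f (a, j)) ?_ ?_ ?_ (fun _ _ => rfl)
    · intro j _
      exact Finset.mem_filter.2 ⟨Finset.mem_univ _, h.vertexOf_eq_zero (hmem j)⟩
    · intro i _ j _ hij
      have := h.bijOn.injOn (hmem i) (hmem j) hij
      simp only [Prod.mk.injEq, true_and] at this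
      exact Fin.ext this
    · intro d hd
      obtain ⟨⟨b, j⟩, hx, rfl⟩ := h.bijOn.surjOn (Set.mem_univ d)
      have hb : b = a := h.fst_eq hx (hmem 0) (Finset.mem_filter.1 hd).2
      subst hb
      obtain ⟨n', child', h', hj⟩ := hx
      rw [ha] at h'
      simp only [Option.some.injEq, node.injEq] at h'
      obtain ⟨rfl, -⟩ := h'
      exact ⟨⟨j, Nat.lt_succ_of_le hj⟩, Finset.mem_univ _, rfl⟩
  · rw [Fin.sum_univ_succ]
    simp

/-- The edges of the closure of an Eulerian tree, oriented from opening to closing leaves and from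
children to parents, form an Eulerian orientation. -/
theorem exists_orientation (h : m.ClosesTo M f) (hE : T.tree.IsEulerian) :
    ∃ ω, M.IsEulerianOrientation ω ∧
      ∀ x ∈ T.tree.halfEdges, ω (f x) = true ↔ x.2 = 0 ∨ slotPos x ∈ T.tree.openingLeaves := by
  classical
  have hs : ∀ d, ∃ x ∈ T.tree.halfEdges, f x = d := fun d => h.bijOn.surjOn (Set.mem_univ d)
  choose inv hinv hfinv using hs
  have hinvf : ∀ x ∈ T.tree.halfEdges, inv (f x) = x := fun x hx =>
    h.bijOn.injOn (hinv _) hx (hfinv _)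
  let ω : Fin M.numHalfEdges → Bool := fun d =>
    decide ((inv d).2 = 0 ∨ slotPos (inv d) ∈ T.tree.openingLeaves)
  have hω : ∀ x ∈ T.tree.halfEdges,
      ω (f x) = decide (x.2 = 0 ∨ slotPos x ∈ T.tree.openingLeaves) := by
    intro x hx
    simp only [ω, hinvf x hx]
  have hT := h.isNode
  have hopen : ∀ o ∈ T.tree.openingLeaves, ω (f (stem o)) = true := by
    intro o ho
    obtain ⟨h1, h2⟩ := hT.stem_opening ho
    rw [hω _ h1, decide_eq_true_iff, h2]
    exact Or.inr ho
  have hclose : ∀ c ∈ T.tree.closingLeaves, ω (f (stem c)) = false := by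
    intro c hc
    obtain ⟨h1, h2⟩ := hT.stem_closing hc
    rw [hω _ h1, decide_eq_false_iff_not, h2]
    rintro (h3 | h3)
    · obtain ⟨a, rfl, ha⟩ := hc
      obtain ⟨b, j, rfl⟩ := hT.eq_concat_of_leaf ha not_isNode_closing
      simp at h3
    · exact Set.disjoint_left.1 T.tree.disjoint_openingLeaves_closingLeaves h3 hc
  refine ⟨ω, ⟨fun d => ?_, fun v => ?_⟩, fun x hx => by rw [hω x hx, decide_eq_true_iff]⟩
  · obtain ⟨x, hx, rfl⟩ := h.bijOn.surjOn (Set.mem_univ d)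
    rcases halfEdges_cases hx with ⟨h', h1 | h1⟩ | ⟨a, j, n, child, ha, rfl | rfl⟩
    · have h2 := h.opp_stem ⟨_, h1⟩
      rw [← h', h2, hopen _ h1, hclose _ (Subtype.prop _)]
      rfl
    · have h2 := h.opp_stem_closing ⟨_, h1⟩
      rw [← h', h2, hclose _ h1, hopen _ (Subtype.prop _)]
      rfl
    · rw [h.opp_up ha, hω _ hx, hω _ (mem_halfEdges_succ.2 ⟨_, ha⟩)]
      simp [ha]
    · rw [hω _ hx, ← h.opp_up ha, M.opp_opp, hω _ (mem_halfEdges_zero.2 ⟨_, _, ha⟩)]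
      simp [ha]
  · obtain ⟨d, rfl⟩ := Quotient.exists_rep v
    obtain ⟨⟨a, j⟩, hx, rfl⟩ := h.bijOn.surjOn (Set.mem_univ d)
    obtain ⟨n, child, ha, hj⟩ := id hx
    change M.excess ω (M.vertexOf (f (a, j))) = 0
    have ha0 : (a, 0) ∈ T.tree.halfEdges := mem_halfEdges_zero.2 ⟨_, _, ha⟩
    rw [h.vertexOf_eq_zero hx, HalfEdgeMap.excess,
      h.sum_vertex ha fun d => HalfEdgeMap.orientationSign (ω d)]
    have h1 : ω (f (a, 0)) = true := by rw [hω _ ha0]; simp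
    have hsub : ∀ j : Fin n, T.tree.subtreeAt (a ++ [(j : ℕ)]) = some (child j) := fun j =>
      subtreeAt_concat_eq_some.2 ⟨n, child, ha, j, rfl, rfl⟩
    have h2 : ∀ j : Fin n, HalfEdgeMap.orientationSign (ω (f (a, j + 1))) =
        2 * (if child j = opening then 1 else 0) - 1 := by
      intro j
      rw [hω _ (mem_halfEdges_succ.2 ⟨_, hsub j⟩)]
      by_cases hc : child j = opening <;> simp [hsub j, hc, HalfEdgeMap.orientationSign]
    -- Upward half-edge 1, openings k - 1, the k other children -1 each: the excess is 0.
    obtain ⟨⟨k, hk, hk'⟩, -⟩ := hE.subtreeAt ha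
    rw [h1, Finset.sum_congr rfl fun j _ => h2 j, Finset.sum_sub_distrib, ← Finset.mul_sum,
      Finset.sum_boole]
    rw [Nat.card_eq_fintype_card, Fintype.card_subtype] at hk'
    simp only [HalfEdgeMap.orientationSign, Finset.sum_const, Finset.card_univ, Fintype.card_fin,
      nsmul_eq_mul, mul_one, if_true]
    omega

end ClosesTo

end ForwardMatching

/-! ### A map is the closure of at most one tree -/

namespace List

theorem lt_append_singleton (a : List ℕ) (j : ℕ) : a < a ++ [j] := by
  induction a with
  | nil => exact List.nil_lt_cons _ _
  | cons i a ih => exact List.cons_lt_cons_iff.2 (Or.inr ⟨rfl, ih⟩)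

/-- The extensions of `b` form an interval, starting at `b`, of the lexicographic order. -/
theorem isPrefix_of_between {b o : List ℕ} (h : ¬ o < b) {c : List ℕ} (hc : b <+: c)
    (hoc : o < c) : b <+: o := by
  induction b generalizing o c with
  | nil => exact List.nil_prefix
  | cons i b ih =>
    obtain ⟨d, rfl⟩ := hc
    cases o with
    | nil => exact absurd (List.nil_lt_cons i b) h
    | cons j o =>
      rw [List.cons_lt_cons_iff] at h
      rw [List.cons_append, List.cons_lt_cons_iff] at hoc
      push Not at h
      have hij : i = j := by
        rcases hoc with h1 | h1
        · omega
        · exact h1.1.symm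
      subst hij
      rw [List.cons_prefix_cons]
      refine ⟨rfl, ih (fun h2 => ?_) (List.prefix_append b d) ?_⟩
      · exact absurd h2 (not_lt.2 (h.2 rfl))
      · simpa using hoc

end List

namespace PlantedTree

/-- The kind of a vertex: opening leaf, closing leaf, or node of a given degree. -/
def kind : PlantedTree → ℕ
  | opening => 0
  | closing => 1
  | node n _ => n + 2

/-- The kind of the vertex at a given address. -/
def kindAt (T : PlantedTree) (a : List ℕ) : Option ℕ := (T.subtreeAt a).map kind

theorem kind_eq_zero {T : PlantedTree} : T.kind = 0 ↔ T = opening := by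
  cases T <;> simp [kind]

theorem kind_eq_one {T : PlantedTree} : T.kind = 1 ↔ T = closing := by
  cases T <;> simp [kind]

theorem kind_eq_node {T : PlantedTree} {n : ℕ} : T.kind = n + 2 ↔ ∃ child, T = node n child := by
  cases T with
  | opening => simp [kind]
  | closing => simp [kind]
  | node m child =>
    simp only [kind, Nat.add_right_cancel_iff, node.injEq]
    constructor
    · rintro rfl
      exact ⟨child, rfl, heq_of_eq rfl⟩
    · rintro ⟨-, h, -⟩
      exact h

theorem kindAt_eq_zero {T : PlantedTree} {a : List ℕ} :
    T.kindAt a = some 0 ↔ T.subtreeAt a = some opening := by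
  simp [kindAt, kind_eq_zero]

theorem kindAt_eq_node {T : PlantedTree} {a : List ℕ} {n : ℕ} :
    T.kindAt a = some (n + 2) ↔ ∃ child, T.subtreeAt a = some (node n child) := by
  simp only [kindAt, Option.map_eq_some_iff, kind_eq_node]
  constructor
  · rintro ⟨S, h, child, rfl⟩
    exact ⟨child, h⟩
  · rintro ⟨child, h⟩
    exact ⟨_, h, child, rfl⟩

/-- A tree is determined by local data at its addresses, so two different trees can be compared at
the first address where these data differ. -/
theorem ext_kindAt {T T' : PlantedTree} (h : ∀ a, T.kindAt a = T'.kindAt a) : T = T' := by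
  induction T generalizing T' with
  | opening =>
    have := h []
    simp only [kindAt, subtreeAt_nil, Option.map_some, Option.some.injEq] at this
    exact (kind_eq_zero.1 this.symm).symm
  | closing =>
    have := h []
    simp only [kindAt, subtreeAt_nil, Option.map_some, Option.some.injEq] at this
    exact (kind_eq_one.1 this.symm).symm
  | node n child ih =>
    have h0 := h []
    simp only [kindAt, subtreeAt_nil, Option.map_some, Option.some.injEq] at h0
    obtain ⟨child', rfl⟩ := kind_eq_node.1 h0.symm
    congr 1
    funext j
    refine ih j fun a => ?_
    simpa [kindAt] using h ((j : ℕ) :: a)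

end PlantedTree

namespace ForwardMatching.ClosesTo

variable {T T' : BlossomingTree} {m : ForwardMatching T} {m' : ForwardMatching T'}
  {M : HalfEdgeMap} {f f' : List ℕ × ℕ → Fin M.numHalfEdges}

/-- The partner of the closing leaf comes before `b`, hence is an opening leaf of `T'` as well,
carried by the same half-edge of `M`. In `T'` its mate must end at a closing leaf, and this mate is
the half-edge leading to `b`. -/
theorem closing_of_agree (h : m.ClosesTo M f) (h' : m'.ClosesTo M f') {b : List ℕ}
    (hb : ∀ b' < b, T.tree.kindAt b' = T'.tree.kindAt b')
    (hT : T.tree.subtreeAt b = some closing) {S : PlantedTree}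
    (hT' : T'.tree.subtreeAt b = some S) : S = closing := by
  let c : T.tree.closingLeaves := ⟨b, coe_mem_closingLeaves.2 hT⟩
  obtain ⟨a, j, rfl⟩ := h.isNode.eq_concat_of_leaf hT not_isNode_closing
  have ho : (m.toEquiv.symm c : LeafPosition) ∈ T'.tree.openingLeaves := by
    have hlt := m.symm_lt c
    obtain ho | ⟨o, ho, ho'⟩ := (m.toEquiv.symm c).2
    · rw [ho]; simp
    · rw [ho, coe_mem_openingLeaves, ← kindAt_eq_zero, ← hb o, kindAt_eq_zero]
      · exact ho'
      · rw [ho] at hlt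
        exact WithBot.coe_lt_coe.1 hlt
  have h1 := h.opp_stem_closing c
  have h2 := h'.opp_stem ⟨_, ho⟩
  have hmem := (h'.isNode.stem_opening ho)
  have hmem' := (h'.isNode.stem_closing (m'.toEquiv ⟨_, ho⟩).2)
  rw [← h.apply_eq h' (h.isNode.stem_opening (Subtype.prop _)).1 hmem.1, ← h1, M.opp_opp] at h2
  have h3 : stem (c : LeafPosition) = (a, j + 1) := stem_concat a j
  have hx' : (a, j + 1) ∈ T'.tree.halfEdges := mem_halfEdges_succ.2 ⟨_, hT'⟩
  rw [h3, h.apply_eq h' (mem_halfEdges_succ.2 ⟨_, hT⟩) hx'] at h2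
  have h4 := h'.bijOn.injOn hx' hmem'.1 h2
  have h5 := hmem'.2
  rw [← h4, slotPos_down] at h5
  have h6 := (m'.toEquiv ⟨_, ho⟩).2
  rw [← h5, coe_mem_closingLeaves, hT'] at h6
  exact Option.some.inj h6

/-- The flow argument: the canonical orientations of the two trees are compared on the part of the
map below `b` in `T'`. -/
theorem not_node_of_agree (h : m.ClosesTo M f) (h' : m'.ClosesTo M f') (hE : T.tree.IsEulerian)
    (hE' : T'.tree.IsEulerian) {b : List ℕ}
    (hb : ∀ b' < b, T.tree.kindAt b' = T'.tree.kindAt b')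
    (hT : T.tree.subtreeAt b = some opening) {n : ℕ} {child : Fin n → PlantedTree} :
    T'.tree.subtreeAt b ≠ some (node n child) := by
  intro hT'
  obtain ⟨ω, hω, hωf⟩ := h.exists_orientation hE
  obtain ⟨ω', hω', hωf'⟩ := h'.exists_orientation hE'
  have agree : ∀ {x}, x ∈ T.tree.halfEdges → x ∈ T'.tree.halfEdges → f x = f' x :=
    fun hx hx' => h.apply_eq h' hx hx'
  -- The vertices that come from the subtree of `T'` at `b`.
  let S : Set M.Vertex := {v | ∃ c j, (c, j) ∈ T'.tree.halfEdges ∧ b <+: c ∧ v = M.vertexOf (f' (c, j))}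
  have hS : ∀ {c j}, (c, j) ∈ T'.tree.halfEdges → M.vertexOf (f' (c, j)) ∈ S → b <+: c := by
    rintro c j hx ⟨c', j', hx', hb', hv⟩
    have := h'.fst_eq hx hx' hv
    simp only at this
    exact this ▸ hb'
  obtain ⟨a, i, rfl⟩ := h.isNode.eq_concat_of_leaf hT not_isNode_opening
  have hd : (a, i + 1) ∈ T.tree.halfEdges := mem_halfEdges_succ.2 ⟨_, hT⟩
  have hd' : (a, i + 1) ∈ T'.tree.halfEdges := mem_halfEdges_succ.2 ⟨_, hT'⟩
  have he' : (a ++ [i], 0) ∈ T'.tree.halfEdges := mem_halfEdges_zero.2 ⟨_, _, hT'⟩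
  have hopp := h'.opp_up hT'
  -- The edge above `b` leaves `S`. It is oriented away from the parent in `T` (opening leaf) and
  -- towards the parent in `T'` (node), which `eq_of_boundary` forbids.
  have key := hω.eq_of_boundary hω' S ?_ (d := f' (a ++ [i], 0))
    ⟨_, _, he', List.prefix_refl _, rfl⟩ ?_
  · have h1 : ω (f' (a, i + 1)) = true := by
      rw [← agree hd hd', hωf _ hd]
      simp [hT]
    have h2 : ω' (f' (a ++ [i], 0)) = true := (hωf' _ he').2 (Or.inl rfl)
    rw [h2, ← M.opp_opp (f' _), hω.orientation, hopp, h1] at key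
    simp at key
  -- A half-edge incoming for `T'` leads down to a child node, still in `S`, or to a closing leaf
  -- `q`. In the second case its opposite is incoming for `T`, so the partner of `q` is not an
  -- opening leaf of `T`. By agreement it does not precede `b`; lying between `b` and `q`, it
  -- belongs to the subtree at `b`.
  · rintro d ⟨c, j, hx, hc, hv⟩ hd1 hd2
    obtain ⟨⟨c', j'⟩, hx', rfl⟩ := h'.bijOn.surjOn (Set.mem_univ d)
    have hcc : c' = c := h'.fst_eq hx' hx hv
    subst hcc
    have hnot : ¬ (j' = 0 ∨ slotPos (c', j') ∈ T'.tree.openingLeaves) := by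
      rw [← hωf' _ hx', hd2]
      simp
    push Not at hnot
    obtain ⟨l, rfl⟩ := Nat.exists_eq_succ_of_ne_zero hnot.1
    obtain ⟨U, hU⟩ := mem_halfEdges_succ.1 hx'
    cases U with
    | opening => exact absurd (by simpa using hU) hnot.2
    | closing =>
      let q : T'.tree.closingLeaves :=
        ⟨((c' ++ [l] : List ℕ) : LeafPosition), coe_mem_closingLeaves.2 hU⟩
      have hq : stem (q : LeafPosition) = (c', l + 1) := stem_concat c' l
      have h1 := h'.opp_stem_closing q
      rw [hq] at h1
      have hlt := m'.symm_lt q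
      have hout : ω (f' (stem (m'.toEquiv.symm q))) ≠ true := by
        rw [← h1, hω.orientation, hd1]
        simp
      have hmem' := (h'.isNode.stem_opening (m'.toEquiv.symm q).2)
      have hnT : (m'.toEquiv.symm q : LeafPosition) ∉ T.tree.openingLeaves := by
        intro hm
        have hmem := h.isNode.stem_opening hm
        rw [← agree hmem.1 hmem'.1, Ne, hωf _ hmem.1, hmem.2] at hout
        exact hout (Or.inr hm)
      rw [h1]
      obtain ho | ⟨o, ho, ho'⟩ := (m'.toEquiv.symm q).2
      · rw [ho] at hnT
        simp at hnT
      · rw [ho] at hnT hlt hmem' ⊢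
        have hlt : o < c' ++ [l] := WithBot.coe_lt_coe.1 hlt
        have hge : ¬ o < a ++ [i] := by
          intro hob
          rw [coe_mem_openingLeaves, ← kindAt_eq_zero, hb o hob, kindAt_eq_zero] at hnT
          exact hnT ho'
        have hpre := List.isPrefix_of_between hge (hc.trans (List.prefix_append c' [l])) hlt
        obtain ⟨o', k, rfl⟩ := h'.isNode.eq_concat_of_leaf ho' not_isNode_opening
        rw [List.prefix_concat_iff] at hpre
        rcases hpre with heq | hpre
        · rw [← heq, hT'] at ho'
          simp at ho'
        · rw [stem_concat] at hmem' ⊢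
          exact ⟨_, _, hmem'.1, hpre, rfl⟩
    | node n' child' =>
      rw [← h'.opp_up hU, M.opp_opp]
      exact ⟨_, _, mem_halfEdges_zero.2 ⟨_, _, hU⟩, hc.trans (List.prefix_append _ _), rfl⟩
  · rw [hopp]
    intro hmem
    have := (hS hd' hmem).length_le
    simp at this

theorem kindAt_eq_of_agree (h : m.ClosesTo M f) (h' : m'.ClosesTo M f') (hE : T.tree.IsEulerian)
    (hE' : T'.tree.IsEulerian) {b : List ℕ}
    (hb : ∀ b' < b, T.tree.kindAt b' = T'.tree.kindAt b')
    {S S' : PlantedTree} (hT : T.tree.subtreeAt b = some S) (hT' : T'.tree.subtreeAt b = some S') :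
    S.kind = S'.kind := by
  have hb' : ∀ b' < b, T'.tree.kindAt b' = T.tree.kindAt b' := fun b' hlt => (hb b' hlt).symm
  cases S with
  | opening =>
    cases S' with
    | opening => rfl
    | closing => rw [h'.closing_of_agree h hb' hT' hT]
    | node n child => exact absurd hT' (h.not_node_of_agree h' hE hE' hb hT)
  | closing => rw [h.closing_of_agree h' hb hT hT']
  | node n child =>
    cases S' with
    | opening => exact absurd hT (h'.not_node_of_agree h hE' hE hb' hT')
    | closing => rw [h'.closing_of_agree h hb' hT' hT]
    | node n' child' =>
      have h1 := h.degree_eq hT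
      have h2 := h'.degree_eq hT'
      rw [h.apply_eq h' (mem_halfEdges_zero.2 ⟨_, _, hT⟩) (mem_halfEdges_zero.2 ⟨_, _, hT'⟩), h2] at h1
      simp only [kind]
      omega

theorem tree_eq (h : m.ClosesTo M f) (h' : m'.ClosesTo M f') (hE : T.tree.IsEulerian)
    (hE' : T'.tree.IsEulerian) : T.tree = T'.tree := by
  refine ext_kindAt fun a => ?_
  by_contra hne
  let B : Set (List ℕ) := {b | T.tree.kindAt b ≠ T'.tree.kindAt b}
  have hB : B.Finite := by
    refine (T.tree.finite_addresses.union T'.tree.finite_addresses).subset fun b hb => ?_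
    by_contra hcon
    simp only [Set.mem_union, Set.mem_ofPred_eq, not_or, not_not] at hcon
    exact hb (by rw [kindAt, kindAt, hcon.1, hcon.2])
  obtain ⟨b, hbB, hmin⟩ := hB.exists_minimal ⟨a, hne⟩
  have hb : ∀ b' < b, T.tree.kindAt b' = T'.tree.kindAt b' := by
    intro b' hlt
    by_contra hcon
    exact absurd (hmin hcon hlt.le) (not_le.2 hlt)
  -- The parent of `b` is smaller than `b`, hence a node of the same degree in both trees; so `b` is
  -- an address of both or of neither.
  have hex : ∀ {T T' : BlossomingTree}, T'.tree.IsNode →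
      (∀ b' < b, T.tree.kindAt b' = T'.tree.kindAt b') → ∀ {S}, T.tree.subtreeAt b = some S →
      ∃ S', T'.tree.subtreeAt b = some S' := by
    intro T T' hN hb S hS
    rcases List.eq_nil_or_concat b with rfl | ⟨c, j, rfl⟩
    · exact ⟨_, subtreeAt_nil _⟩
    · simp only [List.concat_eq_append] at hS hb ⊢
      obtain ⟨n, child, hc, i, rfl, -⟩ := subtreeAt_concat_eq_some.1 hS
      have h1 := hb c (List.lt_append_singleton c i)
      rw [kindAt_eq_node.2 ⟨child, hc⟩, eq_comm, kindAt_eq_node] at h1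
      obtain ⟨child', hc'⟩ := h1
      exact ⟨_, subtreeAt_concat_eq_some.2 ⟨n, child', hc', i, rfl, rfl⟩⟩
  apply hbB
  cases hS : T.tree.subtreeAt b with
  | some S =>
    obtain ⟨S', hS'⟩ := hex h'.isNode hb hS
    rw [kindAt, kindAt, hS, hS', Option.map_some, Option.map_some,
      h.kindAt_eq_of_agree h' hE hE' hb hS hS']
  | none =>
    cases hS' : T'.tree.subtreeAt b with
    | none => rw [kindAt, kindAt, hS, hS']
    | some S' =>
      obtain ⟨S, hS2⟩ := hex h.isNode (fun b' hlt => (hb b' hlt).symm) hS'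
      rw [hS] at hS2
      cases hS2

/-- The partner of a closing leaf is read off from `opp`. -/
theorem matching_eq {m m' : ForwardMatching T} (h : m.ClosesTo M f) (h' : m'.ClosesTo M f') :
    m = m' := by
  refine ForwardMatching.ext_symm fun c => ?_
  have h1 := h.opp_stem_closing c
  have h2 := h'.opp_stem_closing c
  have hc := (h.isNode.stem_closing c.2).1
  have ho := h.isNode.stem_opening (m.toEquiv.symm c).2
  have ho' := h.isNode.stem_opening (m'.toEquiv.symm c).2
  rw [← h.apply_eq h' hc hc, h1, h.apply_eq h' ho.1 ho.1] at h2
  have h3 := h'.bijOn.injOn ho.1 ho'.1 h2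
  exact Subtype.ext (by rw [← ho.2, h3, ho'.2])

end ForwardMatching.ClosesTo

/-- A rooted map is the closure of at most one Eulerian tree endowed with a forward matching. -/
theorem MatchedEulerianTree.eq_of_isClosure {S S' : MatchedEulerianTree} {M : HalfEdgeMap}
    (h : M.IsClosure S.matching) (h' : M.IsClosure S'.matching) : S = S' := by
  obtain ⟨⟨T, hp, hc⟩, hE, m⟩ := S
  obtain ⟨⟨T', hp', hc'⟩, hE', m'⟩ := S'
  obtain ⟨f, hf, h0, hrot, hopp⟩ := HalfEdgeMap.isClosure_iff.1 h
  obtain ⟨f', hf', h0', hrot', hopp'⟩ := HalfEdgeMap.isClosure_iff.1 h'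
  have h1 : m.ClosesTo M f := ⟨hf, h0, hrot, hopp⟩
  have h2 : m'.ClosesTo M f' := ⟨hf', h0', hrot', hopp'⟩
  obtain rfl : T = T' := h1.tree_eq h2 hE hE'
  rw [h1.matching_eq h2]

/-! ### Existence of Eulerian orientations -/

/-- Each fibre has even size 2k and is identified with k pairs, which are then swapped. -/
theorem exists_involutive_fiberwise {α β : Type*} [Finite α] (v : α → β)
    (h : ∀ b, Even (Nat.card {a // v a = b})) :
    ∃ τ : α → α, Function.Involutive τ ∧ (∀ a, τ a ≠ a) ∧ ∀ a, v (τ a) = v a := by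
  have he : ∀ b, ∃ k, Nonempty ({a // v a = b} ≃ Fin k × Bool) := by
    intro b
    obtain ⟨k, hk⟩ := h b
    refine ⟨k, Finite.card_eq.1 ?_⟩
    rw [hk, Nat.card_prod, Nat.card_fin, Nat.card_eq_fintype_card, Fintype.card_bool]
    omega
  choose k he using he
  let e := fun b => (he b).some
  let τ : ∀ a, {a' // v a' = v a} := fun a =>
    (e (v a)).symm ((e (v a) ⟨a, rfl⟩).1, !(e (v a) ⟨a, rfl⟩).2)
  have hτ : ∀ b a (ha : v a = b),
      (τ a : α) = (e b).symm ((e b ⟨a, ha⟩).1, !(e b ⟨a, ha⟩).2) := by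
    rintro b a rfl
    rfl
  refine ⟨fun a => τ a, fun a => ?_, fun a ha => ?_, fun a => (τ a).2⟩
  · simp only
    rw [hτ (v a) (τ a) (τ a).2]
    simp [τ]
  · have h1 : τ a = ⟨a, rfl⟩ := Subtype.ext ha
    simp only [τ] at h1
    rw [Equiv.symm_apply_eq] at h1
    have := congrArg Prod.snd h1
    simp at this

/-- Two involutions without fixed points are compatible with a common two-colouring. -/
theorem exists_coloring_of_involutive {α : Type*} [Finite α] {σ τ : α → α}
    (hσ : Function.Involutive σ) (hτ : Function.Involutive τ) (hσ' : ∀ a, σ a ≠ a)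
    (hτ' : ∀ a, τ a ≠ a) : ∃ ω : α → Bool, (∀ a, ω (σ a) = !ω a) ∧ ∀ a, ω (τ a) = !ω a := by
  classical
  let p : Equiv.Perm α := hσ.toPerm.trans hτ.toPerm
  have hp : ∀ a, p a = τ (σ a) := fun _ => rfl
  -- `σ a` never lies on the cycle of `a` under p = τσ: from p^(n+2) a = σ a follows p^n (p a) = σ
  -- (p a), and the descent ends at a fixed point of `σ` or of `τ`.
  have key : ∀ (n : ℕ) (a : α), (p ^ n) a ≠ σ a := by
    intro n
    induction n using Nat.strong_induction_on with
    | h n ih =>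
      intro a h
      match n with
      | 0 => exact hσ' a (by simpa using h.symm)
      | 1 => exact hτ' (σ a) (by simpa [hp] using h)
      | n + 2 =>
        refine ih n (by omega) (p a) ?_
        rw [pow_succ, Equiv.Perm.mul_apply, pow_succ', Equiv.Perm.mul_apply, hp] at h
        have h2 := congrArg τ h
        rw [hτ, ← hp] at h2
        rw [← h2, hσ, h2]
  obtain ⟨N, ⟨e⟩⟩ := Finite.exists_equiv_fin α
  -- A number for each cycle of `p`. Both `σ` and `τ` exchange the cycle of `a` with that of `σ a`,
  -- so comparing the two numbers gives the colour.
  let rep : α → Fin N := fun a => e (Quotient.out (Quotient.mk (Equiv.Perm.SameCycle.setoid p) a))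
  have hrep : ∀ a, rep (p a) = rep a := by
    intro a
    have : Quotient.mk (Equiv.Perm.SameCycle.setoid p) (p a) =
        Quotient.mk (Equiv.Perm.SameCycle.setoid p) a :=
      Quotient.sound (Equiv.Perm.sameCycle_apply_left.2 (Equiv.Perm.SameCycle.refl _ _))
    simp only [rep, this]
  have hne : ∀ a, rep a ≠ rep (σ a) := by
    intro a h
    have h1 := e.injective h
    have h2 : p.SameCycle a (σ a) := by
      have h3 := congrArg (Quotient.mk (Equiv.Perm.SameCycle.setoid p)) h1
      rw [Quotient.out_eq, Quotient.out_eq] at h3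
      exact Quotient.exact h3
    obtain ⟨n, hn⟩ := h2.exists_nat_pow_eq
    exact key n a hn
  refine ⟨fun a => decide (rep a < rep (σ a)), fun a => ?_, fun a => ?_⟩
  · simp only [hσ a]
    rcases lt_or_gt_of_ne (hne a) with h | h <;> simp [h, h.le]
  · have h1 : rep (τ a) = rep (σ a) := by rw [← hrep (σ a), hp, hσ]
    have h2 : rep (σ (τ a)) = rep a := by rw [← hrep (σ (τ a)), hp, hσ, hτ]
    simp only [h1, h2]
    rcases lt_or_gt_of_ne (hne a) with h | h <;> simp [h, h.le]

namespace HalfEdgeMap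

theorem IsEulerianOrientation.not {M : HalfEdgeMap} {ω : Fin M.numHalfEdges → Bool}
    (h : M.IsEulerianOrientation ω) : M.IsEulerianOrientation fun d => !ω d := by
  refine ⟨fun d => by rw [h.orientation], fun v => ?_⟩
  have := h.balanced v
  rw [excess] at this ⊢
  refine Eq.trans ?_ (neg_eq_zero.2 this)
  rw [← Finset.sum_neg_distrib]
  refine Finset.sum_congr rfl fun d _ => ?_
  rw [orientationSign_not]
  split_ifs <;> simp

/-- Pair the half-edges at each vertex and two-colour so that both these pairs and the edges are
bichromatic. Reversing everything adjusts the direction of `d₀`. -/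
theorem exists_isEulerianOrientation (M : HalfEdgeMap) (h : ∀ d ∈ M.degrees, Even d)
    (d₀ : Fin M.numHalfEdges) : ∃ ω, M.IsEulerianOrientation ω ∧ ω d₀ = true := by
  obtain ⟨τ, hτ, hτ', hv⟩ := exists_involutive_fiberwise M.vertexOf fun v =>
    h _ (Multiset.mem_map_of_mem M.degree (Finset.mem_univ v))
  obtain ⟨ω, h1, h2⟩ := exists_coloring_of_involutive M.opp_opp hτ M.opp_ne hτ'
  have hω : M.IsEulerianOrientation ω := by
    refine ⟨h1, fun v => ?_⟩
    have h3 : M.excess ω v = -M.excess ω v := by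
      conv_lhs => rw [excess, ← Equiv.sum_comp hτ.toPerm]
      rw [excess, ← Finset.sum_neg_distrib]
      refine Finset.sum_congr rfl fun d _ => ?_
      rw [Function.Involutive.coe_toPerm, hv, h2, orientationSign_not]
      split_ifs <;> simp
    omega
  cases h3 : ω d₀ with
  | true => exact ⟨ω, hω, h3⟩
  | false => exact ⟨_, hω.not, by simp [h3]⟩

end HalfEdgeMap

/-! ### Opening a map by a depth-first exploration -/

namespace HalfEdgeMap

variable (M : HalfEdgeMap)

/-- An orientation with one unit too much at `v` and one unit too little at `w`, up to a factor two
(an Eulerian orientation if `v = w`). -/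
def IsShifted (ω : Fin M.numHalfEdges → Bool) (v w : M.Vertex) : Prop := by
  classical exact M.IsOrientation ω ∧
    ∀ x, M.excess ω x = (if x = v then 2 else 0) - (if x = w then 2 else 0)

variable {M}

theorem isShifted_self {ω : Fin M.numHalfEdges → Bool} {v : M.Vertex} :
    M.IsShifted ω v v ↔ M.IsEulerianOrientation ω := by
  constructor
  · rintro ⟨h, h'⟩
    exact ⟨h, fun x => by rw [h', sub_self]⟩
  · rintro ⟨h, h'⟩
    exact ⟨h, fun x => by rw [h', sub_self]⟩

/-- Reversing an incoming half-edge. -/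
theorem IsShifted.exists_reverse {ω : Fin M.numHalfEdges → Bool} {v w : M.Vertex}
    (h : M.IsShifted ω v w) {d : Fin M.numHalfEdges} (hd : ω d = false)
    (hv : M.vertexOf (M.opp d) = v) :
    ∃ ω', M.IsShifted ω' (M.vertexOf d) w ∧ ω' d = true ∧
      ∀ e, e ≠ d → e ≠ M.opp d → ω' e = ω e := by
  classical
  subst hv
  let ω' : Fin M.numHalfEdges → Bool := fun e =>
    if e = d then true else if e = M.opp d then false else ω e
  have hne := M.opp_ne d
  have hopp : ω (M.opp d) = true := by rw [h.1, hd]; rfl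
  refine ⟨ω', ⟨fun e => ?_, fun x => ?_⟩, by simp [ω'], fun e h1 h2 => by simp [ω', h1, h2]⟩
  · by_cases h1 : e = d
    · subst h1; simp [ω', hne]
    · by_cases h2 : e = M.opp d
      · subst h2; simp [ω', M.opp_opp, hne]
      · have h3 : M.opp e ≠ M.opp d := fun h => h1 (M.opp.injective h)
        have h4 : M.opp e ≠ d := fun h => h2 (by rw [← h, M.opp_opp])
        simp only [ω', h1, h2, h3, h4, if_false]
        exact h.1 e
  · have hs : ∀ e, (if M.vertexOf e = x then orientationSign (ω' e) else 0) =
        (if M.vertexOf e = x then orientationSign (ω e) else 0) +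
          ((if e = d then (if x = M.vertexOf e then 2 else 0) else 0) -
            (if e = M.opp d then (if x = M.vertexOf e then 2 else 0) else 0)) := by
      intro e
      by_cases hx : M.vertexOf e = x
      · by_cases h1 : e = d
        · subst h1; simp [ω', hx, hne.symm, hd, orientationSign]
        · by_cases h2 : e = M.opp d
          · subst h2; simp [ω', hx, hne, hopp, orientationSign]
          · simp [ω', h1, h2]
      · simp [hx, Ne.symm hx]
    have h2 := h.2 x
    rw [excess] at h2 ⊢
    rw [Finset.sum_congr rfl fun e _ => hs e, Finset.sum_add_distrib, Finset.sum_sub_distrib, h2]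
    simp only [Finset.sum_ite_eq', Finset.mem_univ, if_true]
    ring

/-! ### The greedy exploration and its invariants -/

variable (M)

/-- The half-edges `d` of a map at which a given planted tree is found by the depth-first exploration
that follows incoming edges, where `V` and `V'` are the sets of half-edges visited before and after
the exploration. -/
def Explores (ω : Fin M.numHalfEdges → Bool) :
    PlantedTree → Fin M.numHalfEdges → Set (Fin M.numHalfEdges) → Set (Fin M.numHalfEdges) → Prop
  | opening, d, V, V' => V' = insert d V ∧ d ∉ V ∧ ω d = true
  | closing, d, V, V' => V' = insert d V ∧ d ∉ V ∧ ω d = false ∧ M.opp d ∈ V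
  | node n child, d, V, V' => d ∉ V ∧ ω d = false ∧ M.opp d ∉ insert d V ∧
      n + 1 = Function.minimalPeriod M.rot (M.opp d) ∧
      ∃ W : ℕ → Set (Fin M.numHalfEdges), W 0 = insert (M.opp d) (insert d V) ∧ V' = W n ∧
        ∀ j : Fin n, Explores ω (child j) (M.rot^[j + 1] (M.opp d)) (W j) (W (j + 1))

variable {M} {ω : Fin M.numHalfEdges → Bool}

theorem minimalPeriod_rot_pos (u : Fin M.numHalfEdges) :
    0 < Function.minimalPeriod M.rot u :=
  Function.minimalPeriod_pos_of_mem_periodicPts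
    (Function.Injective.mem_periodicPts M.rot.injective u)

theorem vertexOf_iterate (u : Fin M.numHalfEdges) (j : ℕ) :
    M.vertexOf (M.rot^[j] u) = M.vertexOf u := by
  induction j with
  | zero => rfl
  | succ j ih => rw [Function.iterate_succ_apply', vertexOf_rot, ih]

theorem exists_iterate_of_vertexOf_eq {u z : Fin M.numHalfEdges} {n : ℕ}
    (hn : n + 1 = Function.minimalPeriod M.rot u) (h : M.vertexOf z = M.vertexOf u) :
    ∃ j ≤ n, z = M.rot^[j] u := by
  obtain ⟨k, hk⟩ := (vertexOf_eq_iff.1 h.symm).exists_nat_pow_eq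
  refine ⟨k % Function.minimalPeriod M.rot u, ?_, ?_⟩
  · have := Nat.mod_lt k (minimalPeriod_rot_pos u)
    omega
  · rw [Function.iterate_mod_minimalPeriod_eq, ← hk, Equiv.Perm.iterate_eq_pow]

theorem iterate_inj {u : Fin M.numHalfEdges} {n i j : ℕ}
    (hn : n + 1 = Function.minimalPeriod M.rot u) (hi : i ≤ n) (hj : j ≤ n)
    (h : M.rot^[i] u = M.rot^[j] u) : i = j := by
  refine Function.iterate_injOn_Iio_minimalPeriod (f := M.rot) (x := u) ?_ ?_ h
  · simp only [Set.mem_Iio]; omega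
  · simp only [Set.mem_Iio]; omega

theorem Explores.notMem {S : PlantedTree} {d : Fin M.numHalfEdges}
    {V V' : Set (Fin M.numHalfEdges)} (h : M.Explores ω S d V V') : d ∉ V := by
  cases S with
  | opening => exact h.2.1
  | closing => exact h.2.1
  | node n child => exact h.1

theorem Explores.out_iff {S : PlantedTree} {d : Fin M.numHalfEdges}
    {V V' : Set (Fin M.numHalfEdges)} (h : M.Explores ω S d V V') : ω d = true ↔ S = opening := by
  cases S with
  | opening => simp [h.2.2]
  | closing => simp [h.2.2.1]
  | node n child => simp [h.2.1]

theorem subset_of_chain {α : Type*} {n : ℕ} {W : ℕ → Set α} (h : ∀ j < n, W j ⊆ W (j + 1))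
    {i j : ℕ} (hij : i ≤ j) (hj : j ≤ n) : W i ⊆ W j := by
  induction j, hij using Nat.le_induction with
  | base => exact subset_rfl
  | succ j _ ih => exact (ih (by omega)).trans (h j (by omega))

theorem Explores.insert_subset {S : PlantedTree} {d : Fin M.numHalfEdges}
    {V V' : Set (Fin M.numHalfEdges)} (h : M.Explores ω S d V V') : insert d V ⊆ V' := by
  induction S generalizing d V V' with
  | opening => exact h.1.ge
  | closing => exact h.1.ge
  | node n child ih =>
    obtain ⟨-, -, -, -, W, h0, rfl, hW⟩ := h
    have hsub : ∀ j < n, W j ⊆ W (j + 1) := fun j hj =>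
      (Set.subset_insert _ _).trans (ih ⟨j, hj⟩ (hW ⟨j, hj⟩))
    have := subset_of_chain hsub (Nat.zero_le n) le_rfl
    rw [h0] at this
    exact (Set.subset_insert _ _).trans this

/-- The exploration reads the orientation only at visited half-edges. Later reorientations of the
unvisited part therefore leave the subtrees already found intact. -/
theorem Explores.congr {S : PlantedTree} {d : Fin M.numHalfEdges}
    {V V' : Set (Fin M.numHalfEdges)} (h : M.Explores ω S d V V')
    {ω' : Fin M.numHalfEdges → Bool} (hω : ∀ y ∈ V', ω' y = ω y) : M.Explores ω' S d V V' := by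
  have hd : ω' d = ω d := hω d (h.insert_subset (Set.mem_insert _ _))
  induction S generalizing d V V' with
  | opening => exact ⟨h.1, h.2.1, hd.trans h.2.2⟩
  | closing => exact ⟨h.1, h.2.1, hd.trans h.2.2.1, h.2.2.2⟩
  | node n child ih =>
    obtain ⟨h1, h2, h3, h4, W, h0, rfl, hW⟩ := h
    have hsub : ∀ j < n, W j ⊆ W (j + 1) := fun j hj =>
      (Set.subset_insert _ _).trans (hW ⟨j, hj⟩).insert_subset
    refine ⟨h1, hd.trans h2, h3, h4, W, h0, rfl, fun j => ?_⟩
    have h5 : ∀ y ∈ W (j + 1), ω' y = ω y := fun y hy =>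
      hω y (subset_of_chain hsub (Nat.succ_le_of_lt j.2) le_rfl hy)
    exact ih j (hW j) h5 (h5 _ ((hW j).insert_subset (Set.mem_insert _ _)))

variable (M)

/-- Visited half-edges whose edge is not completely visited are outgoing. -/
def PendingOut (V : Set (Fin M.numHalfEdges)) (ω : Fin M.numHalfEdges → Bool) : Prop :=
  ∀ y ∈ V, M.opp y ∉ V → ω y = true

/-- No orientation that extends the one of the visited half-edges has its excess shifted from another
vertex that is incompletely visited to `v`. -/
def Blocked (V : Set (Fin M.numHalfEdges)) (ω : Fin M.numHalfEdges → Bool) (v : M.Vertex) : Prop :=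
  ∀ z ∉ V, (∃ y ∈ V, M.vertexOf y = M.vertexOf z) → M.vertexOf z ≠ v →
    ∀ ω', (∀ y ∈ V, ω' y = ω y) → ¬ M.IsShifted ω' v (M.vertexOf z)

/-- The half-edge `d` can be explored when `V` has been visited. -/
def Explorable (V : Set (Fin M.numHalfEdges)) (ω : Fin M.numHalfEdges → Bool)
    (d : Fin M.numHalfEdges) : Prop :=
  d ∉ V → M.IsEulerianOrientation ω → M.PendingOut V ω →
    M.Blocked V ω (M.vertexOf d) →
    ∃ S V' ω', M.IsEulerianOrientation ω' ∧ (∀ y ∈ V, ω' y = ω y) ∧ M.Explores ω' S d V V' ∧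
      M.PendingOut V' ω' ∧
      -- The vertices discovered during the exploration are new and completely visited at its end,
      -- so they never count in `Blocked` afterwards.
      ∀ y ∈ V', y ∈ insert d V ∨ ∀ z, M.vertexOf z = M.vertexOf y → z ∈ V' ∧ z ∉ insert d V

variable {M}

/-- Processes the half-edges around a vertex entered through `u`, updating the orientation on the
way. It serves both for the root, where only `u` has been visited, and for the inner nodes. -/
theorem explore_children {V : Set (Fin M.numHalfEdges)} {u : Fin M.numHalfEdges} (hu : u ∈ V)
    (huV : ∀ y ∈ V, M.vertexOf y = M.vertexOf u → y = u) (hω : M.IsEulerianOrientation ω)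
    (hpend : M.PendingOut V ω) (hblock : M.Blocked V ω (M.vertexOf u))
    (ih : ∀ W ω d, V ⊆ W → M.Explorable W ω d) {n : ℕ}
    (hn : n + 1 = Function.minimalPeriod M.rot u) :
    ∃ (child : Fin n → PlantedTree) (W : ℕ → Set (Fin M.numHalfEdges))
      (ω' : Fin M.numHalfEdges → Bool), W 0 = V ∧ M.IsEulerianOrientation ω' ∧
      (∀ y ∈ V, ω' y = ω y) ∧
      (∀ j : Fin n, M.Explores ω' (child j) (M.rot^[j + 1] u) (W j) (W (j + 1))) ∧
      M.PendingOut (W n) ω' ∧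
      ∀ y ∈ W n, (y ∈ V ∧ M.vertexOf y ≠ M.vertexOf u) ∨
        ∀ z, M.vertexOf z = M.vertexOf y → z ∈ W n ∧ (z ∈ V → z = u) := by
  have main : ∀ k ≤ n, ∃ (child : ℕ → PlantedTree) (W : ℕ → Set (Fin M.numHalfEdges))
      (ω' : Fin M.numHalfEdges → Bool), W 0 = V ∧ M.IsEulerianOrientation ω' ∧
      (∀ y ∈ V, ω' y = ω y) ∧
      (∀ j < k, M.Explores ω' (child j) (M.rot^[j + 1] u) (W j) (W (j + 1))) ∧
      M.PendingOut (W k) ω' ∧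
      -- A visited half-edge was there at the start, is one of the first children slots of `u`, or
      -- belongs to a new vertex that is already complete.
      ∀ y ∈ W k, y ∈ V ∨ (∃ j < k, y = M.rot^[j + 1] u) ∨
        ∀ z, M.vertexOf z = M.vertexOf y → z ∈ W k ∧ z ∉ V ∧ M.vertexOf z ≠ M.vertexOf u := by
    intro k
    induction k with
    | zero =>
      intro _
      exact ⟨fun _ => opening, fun _ => V, ω, rfl, hω, fun _ _ => rfl, by simp, hpend,
        fun y hy => Or.inl hy⟩
    | succ k ihk =>
      intro hk
      obtain ⟨child, W, ω₁, h0, hω₁, hag, hexp, hpend₁, hC⟩ := ihk (by omega)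
      have hsub : ∀ j < k, W j ⊆ W (j + 1) := fun j hj =>
        (Set.subset_insert _ _).trans (hexp j hj).insert_subset
      have hVW : V ⊆ W k := by
        have := subset_of_chain hsub (Nat.zero_le k) le_rfl
        rwa [h0] at this
      have hvd : M.vertexOf (M.rot^[k + 1] u) = M.vertexOf u := vertexOf_iterate u _
      have hdW : M.rot^[k + 1] u ∉ W k := by
        intro hmem
        rcases hC _ hmem with h | ⟨j, hj, h⟩ | h
        · exact absurd (iterate_inj hn hk (Nat.zero_le n) (huV _ h hvd)) (by omega)
        · exact absurd (iterate_inj hn hk (by omega) h) (by omega)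
        · exact (h _ rfl).2.2 hvd
      -- Apart from the vertex of `u`, the incomplete vertices touched by `W k` were already touched
      -- by `V`, and more half-edges are now frozen.
      have hblock₁ : M.Blocked (W k) ω₁ (M.vertexOf (M.rot^[k + 1] u)) := by
        rw [hvd]
        rintro z hz ⟨y, hy, hyz⟩ hzu ω' hω'
        refine hblock z (fun h => hz (hVW h)) ⟨y, ?_, hyz⟩ hzu ω' fun x hx => ?_
        · rcases hC y hy with h | ⟨j, hj, rfl⟩ | h
          · exact h
          · exact absurd (hyz.symm.trans (vertexOf_iterate u _)) hzu
          · exact absurd (h z hyz.symm).1 hz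
        · rw [hω' x (hVW hx), hag x hx]
      obtain ⟨S, V', ω₂, hω₂, hag₂, hexp₂, hpend₂, hC₂⟩ :=
        ih (W k) ω₁ _ hVW hdW hω₁ hpend₁ hblock₁
      have hWV' : W k ⊆ V' := (Set.subset_insert _ _).trans hexp₂.insert_subset
      refine ⟨Function.update child k S, Function.update W (k + 1) V', ω₂, ?_, hω₂, ?_, ?_, ?_, ?_⟩
      · rw [Function.update_of_ne (by omega), h0]
      · intro y hy
        rw [hag₂ y (hVW hy), hag y hy]
      · intro j hj
        rcases Nat.lt_succ_iff_lt_or_eq.1 hj with hj | rfl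
        · rw [Function.update_of_ne (by omega), Function.update_of_ne (by omega),
            Function.update_of_ne (by omega)]
          exact (hexp j hj).congr fun y hy =>
            hag₂ y (subset_of_chain hsub (Nat.succ_le_of_lt hj) le_rfl hy)
        · rw [Function.update_self, Function.update_self, Function.update_of_ne (by omega)]
          exact hexp₂
      · rwa [Function.update_self]
      · rw [Function.update_self]
        intro y hy
        rcases hC₂ y hy with h | h
        · rcases Set.mem_insert_iff.1 h with rfl | h
          · exact Or.inr (Or.inl ⟨k, by omega, rfl⟩)
          · rcases hC y h with h | ⟨j, hj, h⟩ | h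
            · exact Or.inl h
            · exact Or.inr (Or.inl ⟨j, by omega, h⟩)
            · exact Or.inr (Or.inr fun z hz => ⟨hWV' (h z hz).1, (h z hz).2⟩)
        · refine Or.inr (Or.inr fun z hz => ⟨(h z hz).1, fun hzV => ?_, fun hzu => ?_⟩)
          · exact (h z hz).2 (Set.mem_insert_of_mem _ (hVW hzV))
          · exact (h u (hzu.symm.trans hz)).2 (Set.mem_insert_of_mem _ (hVW hu))
  obtain ⟨child, W, ω', h0, hω', hag, hexp, hpend', hC⟩ := main n le_rfl
  have hsub : ∀ j < n, W j ⊆ W (j + 1) := fun j hj =>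
    (Set.subset_insert _ _).trans (hexp j hj).insert_subset
  have hVW : V ⊆ W n := by
    have := subset_of_chain hsub (Nat.zero_le n) le_rfl
    rwa [h0] at this
  have hvert : ∀ z, M.vertexOf z = M.vertexOf u → z ∈ W n ∧ (z ∈ V → z = u) := by
    intro z hz
    refine ⟨?_, fun h => huV z h hz⟩
    obtain ⟨j, hj, rfl⟩ := exists_iterate_of_vertexOf_eq hn hz
    cases j with
    | zero => exact hVW hu
    | succ j =>
      exact subset_of_chain hsub hj le_rfl ((hexp j hj).insert_subset (Set.mem_insert _ _))
  refine ⟨fun j => child j, W, ω', h0, hω', hag, fun j => hexp j j.2, hpend', fun y hy => ?_⟩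
  by_cases hyu : M.vertexOf y = M.vertexOf u
  · exact Or.inr fun z hz => hvert z (hz.trans hyu)
  · rcases hC y hy with h | ⟨j, hj, rfl⟩ | h
    · exact Or.inl ⟨h, hyu⟩
    · exact absurd (vertexOf_iterate u _) hyu
    · exact Or.inr fun z hz => ⟨(h z hz).1, fun h' => absurd h' (h z hz).2.1⟩

/-- Induction on the number of unvisited half-edges, with the three-way choice closing, opening,
node. -/
theorem explorable (M : HalfEdgeMap) (V : Set (Fin M.numHalfEdges))
    (ω : Fin M.numHalfEdges → Bool) (d : Fin M.numHalfEdges) : M.Explorable V ω d := by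
  induction hN : Vᶜ.ncard using Nat.strong_induction_on generalizing V ω d with
  | h N ih =>
    subst hN
    intro hd hω hpend hblock
    by_cases hopp : M.opp d ∈ V
    -- The opposite half-edge was pending, hence outgoing.
    · have hωd : ω d = false := by
        have := hpend (M.opp d) hopp (by rwa [M.opp_opp])
        rw [hω.orientation] at this
        simpa using this
      refine ⟨closing, insert d V, ω, hω, fun _ _ => rfl, ⟨rfl, hd, hωd, hopp⟩, ?_,
        fun y hy => Or.inl hy⟩
      rintro y (rfl | hy) hy'
      · exact absurd (Set.mem_insert_of_mem _ hopp) hy'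
      · exact hpend y hy fun h => hy' (Set.mem_insert_of_mem _ h)
    -- Opening leaves have priority: reorient the unvisited part if this makes `d` outgoing.
    by_cases hout : ∃ ω', M.IsEulerianOrientation ω' ∧ (∀ y ∈ V, ω' y = ω y) ∧ ω' d = true
    · obtain ⟨ω', hω', hag, hωd⟩ := hout
      refine ⟨opening, insert d V, ω', hω', hag, ⟨rfl, hd, hωd⟩, ?_, fun y hy => Or.inl hy⟩
      rintro y (rfl | hy) hy'
      · exact hωd
      · rw [hag y hy]
        exact hpend y hy fun h => hy' (Set.mem_insert_of_mem _ h)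
    have hout' : ∀ ω', M.IsEulerianOrientation ω' → (∀ y ∈ V, ω' y = ω y) → ω' d ≠ true :=
      fun ω' h1 h2 h3 => hout ⟨ω', h1, h2, h3⟩
    have hωd : ω d = false := by simpa using hout' ω hω fun _ _ => rfl
    have hfresh : ∀ {ω₁ ω₂ : Fin M.numHalfEdges → Bool}, (∀ y ∈ V, ω₁ y = ω y) →
        (∀ e, e ≠ d → e ≠ M.opp d → ω₂ e = ω₁ e) → ∀ y ∈ V, ω₂ y = ω y := by
      intro ω₁ ω₂ h1 h2 y hy
      rw [h2 y (fun h => hd (h ▸ hy)) (fun h => hopp (h ▸ hy)), h1 y hy]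
    -- Reversing the forced half-edge `d` moves excess from the vertex of `M.opp d` to that of `d`.
    -- If the two vertices coincide, the result is Eulerian with `d` outgoing; if the former has
    -- been touched before, `Blocked` is violated. So `d` leads to a new vertex.
    have huntouched : ∀ y ∈ insert d V, M.vertexOf y ≠ M.vertexOf (M.opp d) := by
      obtain ⟨ω', hsh, hd', hag⟩ := (isShifted_self.2 hω).exists_reverse hωd rfl
      have hag' := hfresh (fun _ _ => rfl) hag
      have hne : M.vertexOf (M.opp d) ≠ M.vertexOf d := by
        intro h
        rw [h, isShifted_self] at hsh
        exact hout' ω' hsh hag' hd'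
      rintro y (rfl | hy) h
      · exact hne h.symm
      · exact hblock (M.opp d) hopp ⟨y, hy, h⟩ hne ω' hag' hsh
    have hu : M.opp d ∉ insert d V := fun h => huntouched _ h rfl
    obtain ⟨n, hn⟩ := Nat.exists_eq_succ_of_ne_zero (minimalPeriod_rot_pos (M.opp d)).ne'
    obtain ⟨child, W, ω', h0, hω', hag, hexp, hpend', hC⟩ := explore_children
      (V := insert (M.opp d) (insert d V)) (u := M.opp d) (ω := ω) (Set.mem_insert _ _)
      (fun y hy hv => by
        rcases hy with hy | hy
        · exact hy
        · exact absurd hv (huntouched y hy)) hω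
      (by
        rintro y (rfl | rfl | hy) hy'
        · exact absurd (by simp [M.opp_opp]) hy'
        · exact absurd (by simp) hy'
        · exact hpend y hy fun h =>
            hy' (Set.mem_insert_of_mem _ (Set.mem_insert_of_mem _ h)))
      (by
        -- A shift towards the new vertex, followed by the reversal of `d`, becomes a shift towards
        -- the vertex of `d`: either it contradicts the old `Blocked`, or it is an Eulerian
        -- orientation with `d` outgoing.
        rintro z hz ⟨y, hy, hyz⟩ hzu ω₁ hω₁ hsh
        have hω₁d : ω₁ d = false := by rw [hω₁ d (by simp), hωd]
        obtain ⟨ω₂, hsh₂, hd₂, hag₂⟩ := hsh.exists_reverse hω₁d rfl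
        have hag₂' : ∀ y ∈ V, ω₂ y = ω y := hfresh
          (fun y hy => hω₁ y (Set.mem_insert_of_mem _ (Set.mem_insert_of_mem _ hy))) hag₂
        by_cases hzd : M.vertexOf z = M.vertexOf d
        · rw [hzd, isShifted_self] at hsh₂
          exact hout' ω₂ hsh₂ hag₂' hd₂
        · rcases hy with rfl | rfl | hy
          · exact hzu hyz.symm
          · exact hzd hyz.symm
          · exact hblock z (fun h => hz (Set.mem_insert_of_mem _ (Set.mem_insert_of_mem _ h)))
              ⟨y, hy, hyz⟩ hzd ω₂ hag₂' hsh₂)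
      (by
        intro W' ω₁ d₁ hW'
        refine ih _ ?_ W' ω₁ d₁ rfl
        refine Set.ncard_lt_ncard ⟨?_, fun h => ?_⟩ (Set.toFinite _)
        · exact Set.compl_subset_compl.2 (((Set.subset_insert _ _).trans
            (Set.subset_insert _ _)).trans hW')
        · exact h hd (hW' (by simp)))
      hn.symm
    refine ⟨node n child, W n, ω', hω', fun y hy => hag y (by simp [hy]), ⟨hd, ?_, hu, hn.symm, W,
      h0, rfl, hexp⟩, hpend', fun y hy => ?_⟩
    · rw [hag d (by simp), hωd]
    · rcases hC y hy with ⟨h | h, h'⟩ | h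
      · exact absurd (congrArg M.vertexOf h) h'
      · exact Or.inl h
      · refine Or.inr fun z hz => ⟨(h z hz).1, fun h' => ?_⟩
        have := (h z hz).2 (Set.mem_insert_of_mem _ h')
        exact hu (this ▸ h')

end HalfEdgeMap

/-! ### Numbers of leaves and heights -/

namespace PlantedTree

/-- The contribution of a vertex to the leaf-path: `1` for an opening leaf, `-1` for a closing leaf
and `0` for a node. -/
def leafSign : PlantedTree → ℤ
  | opening => 1
  | closing => -1
  | node _ _ => 0

/-- The number of opening leaves minus the number of closing leaves, the root leaf not counted. -/
noncomputable def increment (T : PlantedTree) : ℤ := (T.positions.map fun x => x.2.leafSign).sum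

/-- The increment of the leaf-path, restricted to the leaves before a given address. -/
noncomputable def incrementBefore (T : PlantedTree) (a : List ℕ) : ℤ :=
  (T.positions.map fun x => if x.1 < a then x.2.leafSign else 0).sum

@[simp] theorem increment_opening : opening.increment = 1 := by
  simp [increment, positions, leafSign]

@[simp] theorem increment_closing : closing.increment = -1 := by
  simp [increment, positions, leafSign]

theorem increment_node {n : ℕ} (child : Fin n → PlantedTree) :
    (node n child).increment = ∑ j, (child j).increment := by
  simp [increment, sum_map_positions_node, leafSign]

theorem IsEulerian.isProper {T : PlantedTree} (h : T.IsEulerian) : T.IsProper := by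
  induction T with
  | opening => trivial
  | closing => trivial
  | node n child ih =>
    obtain ⟨⟨k, hk, hk'⟩, h⟩ := h
    exact ⟨by omega, fun j => ih j (h j)⟩

/-- Among the 2k - 1 children of a node, k - 1 are openings and the k others each contribute -1 by
induction: the total is -1. -/
theorem IsEulerian.increment_eq {T : PlantedTree} (h : T.IsEulerian) :
    T = opening ∨ T.increment = -1 := by
  classical
  induction T with
  | opening => exact Or.inl rfl
  | closing => exact Or.inr increment_closing
  | node n child ih =>
    right
    obtain ⟨⟨k, hk, hk'⟩, h⟩ := h
    have h1 : ∀ j, (child j).increment = 2 * (if child j = opening then 1 else 0) - 1 := by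
      intro j
      split_ifs with hj
      · rw [hj, increment_opening]; norm_num
      · rw [(ih j (h j)).resolve_left hj]; norm_num
    rw [increment_node, Finset.sum_congr rfl fun j _ => h1 j, Finset.sum_sub_distrib,
      ← Finset.mul_sum, Finset.sum_boole]
    rw [Nat.card_eq_fintype_card, Fintype.card_subtype] at hk'
    simp only [Finset.sum_const, Finset.card_univ, Fintype.card_fin, nsmul_eq_mul, mul_one]
    omega

open Classical in
theorem ncard_addresses (T S : PlantedTree) (p : List ℕ → Prop) :
    {x : LeafPosition | ∃ a : List ℕ, x = a ∧ T.subtreeAt a = some S ∧ p a}.ncard =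
      (T.positions.filter fun x => x.2 = S ∧ p x.1).card := by
  have h1 : {x : LeafPosition | ∃ a : List ℕ, x = a ∧ T.subtreeAt a = some S ∧ p a} =
      ((T.positions.filter fun x => x.2 = S ∧ p x.1).toFinset.image
        fun x => (x.1 : LeafPosition) : Finset LeafPosition) := by
    ext x
    simp only [Set.mem_ofPred_eq, Finset.coe_image, Finset.mem_coe, Multiset.mem_toFinset, Set.mem_image,
      Multiset.mem_filter, Prod.exists, mem_positions]
    constructor
    · rintro ⟨a, rfl, h, ha⟩
      exact ⟨a, S, ⟨h, rfl, ha⟩, rfl⟩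
    · rintro ⟨a, U, ⟨h, rfl, ha⟩, rfl⟩
      exact ⟨a, rfl, h, ha⟩
  rw [h1, Set.ncard_coe_finset, Finset.card_image_of_injOn, Multiset.toFinset_card_of_nodup]
  · exact T.nodup_positions.filter _
  · rintro ⟨a, U⟩ hU ⟨b, U'⟩ hU' hab
    simp only [Finset.mem_coe, Multiset.mem_toFinset, Multiset.mem_filter] at hU hU'
    have : a = b := WithBot.coe_injective hab
    rw [this, hU.2.1, hU'.2.1]

open Classical in
theorem sum_leafSign (s : Multiset (List ℕ × PlantedTree)) (p : List ℕ → Prop) :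
    (s.map fun x => if p x.1 then x.2.leafSign else 0).sum =
      ((s.filter fun x => x.2 = opening ∧ p x.1).card : ℤ) -
        ((s.filter fun x => x.2 = closing ∧ p x.1).card : ℤ) := by
  induction s using Multiset.induction with
  | empty => simp
  | cons x s ih =>
    obtain ⟨a, S⟩ := x
    rw [Multiset.map_cons, Multiset.sum_cons, ih]
    by_cases h : p a
    · cases S <;> simp [h, leafSign] <;> ring
    · simp [h]

theorem openingLeaves_eq (T : PlantedTree) : T.openingLeaves =
    insert ⊥ {x : LeafPosition | ∃ a : List ℕ, x = a ∧ T.subtreeAt a = some opening ∧ True} := by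
  ext x
  simp [openingLeaves]

theorem closingLeaves_eq (T : PlantedTree) : T.closingLeaves =
    {x : LeafPosition | ∃ a : List ℕ, x = a ∧ T.subtreeAt a = some closing ∧ True} := by
  ext x
  simp [closingLeaves]

theorem finite_sep_addresses (T S : PlantedTree) (p : List ℕ → Prop) :
    {x : LeafPosition | ∃ a : List ℕ, x = a ∧ T.subtreeAt a = some S ∧ p a}.Finite := by
  refine (Set.Finite.image (fun a : List ℕ => (a : LeafPosition)) T.finite_addresses).subset ?_
  rintro x ⟨a, rfl, h, -⟩
  exact ⟨a, by simp [h], rfl⟩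

/-- The root leaf, absent from `increment`, is the extra opening. With `IsEulerian.increment_eq`,
the equality of the numbers of leaves is automatic for Eulerian trees other than `opening`. -/
theorem ncard_openingLeaves_eq_iff (T : PlantedTree) :
    T.openingLeaves.ncard = T.closingLeaves.ncard ↔ T.increment = -1 := by
  classical
  have h := sum_leafSign T.positions fun _ => True
  simp only [if_true] at h
  rw [increment, h, openingLeaves_eq, closingLeaves_eq,
    Set.ncard_insert_of_notMem (by simp) (T.finite_sep_addresses opening fun _ => True),
    T.ncard_addresses opening fun _ => True, T.ncard_addresses closing fun _ => True]
  omega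

theorem height_eq_incrementBefore (T : PlantedTree) (b : List ℕ) :
    T.height b = 1 + T.incrementBefore b := by
  classical
  have h1 : {o ∈ T.openingLeaves | o < (b : LeafPosition)} = insert ⊥
      {x : LeafPosition | ∃ a : List ℕ, x = a ∧ T.subtreeAt a = some opening ∧ a < b} := by
    ext x
    constructor
    · rintro ⟨rfl | ⟨a, rfl, h⟩, hx⟩
      · exact Set.mem_insert _ _
      · exact Set.mem_insert_of_mem _ ⟨a, rfl, h, WithBot.coe_lt_coe.1 hx⟩
    · rintro (rfl | ⟨a, rfl, h, hx⟩)
      · exact ⟨Or.inl rfl, WithBot.bot_lt_coe _⟩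
      · exact ⟨Or.inr ⟨a, rfl, h⟩, WithBot.coe_lt_coe.2 hx⟩
  have h2 : {c ∈ T.closingLeaves | c < (b : LeafPosition)} =
      {x : LeafPosition | ∃ a : List ℕ, x = a ∧ T.subtreeAt a = some closing ∧ a < b} := by
    ext x
    constructor
    · rintro ⟨⟨a, rfl, h⟩, hx⟩
      exact ⟨a, rfl, h, WithBot.coe_lt_coe.1 hx⟩
    · rintro ⟨a, rfl, h, hx⟩
      exact ⟨⟨a, rfl, h⟩, WithBot.coe_lt_coe.2 hx⟩
  have h := sum_leafSign T.positions fun a => a < b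
  rw [height, h1, h2,
    Set.ncard_insert_of_notMem (by simp) (T.finite_sep_addresses opening fun a => a < b),
    T.ncard_addresses opening fun a => a < b, T.ncard_addresses closing fun a => a < b,
    incrementBefore]
  convert (congrArg (1 + ·) h.symm) using 1
  · push_cast; ring
  · congr!

theorem incrementBefore_node_cons {n : ℕ} (child : Fin n → PlantedTree) (j : Fin n)
    (b : List ℕ) : (node n child).incrementBefore ((j : ℕ) :: b) =
      ∑ l, (if l < j then (child l).increment else 0) + (child j).incrementBefore b := by
  rw [incrementBefore, sum_map_positions_node]
  have h1 : ∀ l : Fin n, ((child l).positions.map fun x =>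
      if ((l : ℕ) :: x.1, x.2).1 < (j : ℕ) :: b then ((l : ℕ) :: x.1, x.2).2.leafSign else 0).sum =
      (if l < j then (child l).increment else 0) +
        if l = j then (child j).incrementBefore b else 0 := by
    intro l
    rcases lt_trichotomy l j with h | rfl | h
    · have h2 : ∀ x : List ℕ, (l : ℕ) :: x < (j : ℕ) :: b := fun x =>
        List.cons_lt_cons_iff.2 (Or.inl h)
      simp only [h2, if_true, h, h.ne, if_false, add_zero]
      rfl
    · have h2 : ∀ x : List ℕ, (l : ℕ) :: x < (l : ℕ) :: b ↔ x < b := fun x => by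
        rw [List.cons_lt_cons_iff]; simp
      simp only [h2, lt_irrefl, if_false, if_true, zero_add]
      rfl
    · have h2 : ∀ x : List ℕ, ¬ (l : ℕ) :: x < (j : ℕ) :: b := fun x hx => by
        rw [List.cons_lt_cons_iff] at hx
        have : (j : ℕ) < l := h
        omega
      simp [h2, h.not_gt, h.ne']
  rw [Finset.sum_congr rfl fun l _ => h1 l, Finset.sum_add_distrib]
  simp [leafSign]

end PlantedTree

/-! ### Every rooted Eulerian map is the closure of a tree -/

namespace HalfEdgeMap

variable (M : HalfEdgeMap)

/-- The half-edge that leads from the node at a given address towards the root, if the tree is planted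
at the half-edge `u`. -/
def descend (u : Fin M.numHalfEdges) (a : List ℕ) : Fin M.numHalfEdges :=
  a.foldl (fun e j => M.opp (M.rot^[j + 1] e)) u

/-- The place in the map of a half-edge of a tree planted at the half-edge `u`. -/
def place (u : Fin M.numHalfEdges) (x : List ℕ × ℕ) : Fin M.numHalfEdges :=
  M.rot^[x.2] (M.descend u x.1)

/-- The half-edge that leads from the parent to the vertex at a given address, if `d` is the half-edge
that leads to the root vertex of the tree. -/
def slot (d : Fin M.numHalfEdges) : List ℕ → Fin M.numHalfEdges
  | [] => d
  | j :: b => slot (M.rot^[j + 1] (M.opp d)) b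

/-- The exploration of the children of a node whose half-edge towards the root is `u`. -/
structure ExploresChildren (ω : Fin M.numHalfEdges → Bool) {n : ℕ} (child : Fin n → PlantedTree)
    (u : Fin M.numHalfEdges) (W : ℕ → Set (Fin M.numHalfEdges)) : Prop where
  period : n + 1 = Function.minimalPeriod M.rot u
  out : ω u = true
  mem : u ∈ W 0
  explores : ∀ j : Fin n, M.Explores ω (child j) (M.rot^[j + 1] u) (W j) (W (j + 1))

variable {M} {ω : Fin M.numHalfEdges → Bool}

@[simp] theorem place_root (u : Fin M.numHalfEdges) : M.place u ([], 0) = u := rfl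

theorem place_nil (u : Fin M.numHalfEdges) (j : ℕ) : M.place u ([], j) = M.rot^[j] u := rfl

theorem place_cons (u : Fin M.numHalfEdges) (i : ℕ) (a : List ℕ) (j : ℕ) :
    M.place u (i :: a, j) = M.place (M.opp (M.rot^[i + 1] u)) (a, j) := rfl

theorem place_succ (u : Fin M.numHalfEdges) (a : List ℕ) (j : ℕ) :
    M.place u (a, j + 1) = M.rot (M.place u (a, j)) := by
  simp only [place, Function.iterate_succ_apply']

theorem place_concat (u : Fin M.numHalfEdges) (a : List ℕ) (j : ℕ) :
    M.place u (a ++ [j], 0) = M.opp (M.place u (a, j + 1)) := by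
  simp [place, descend]

theorem slot_concat (d : Fin M.numHalfEdges) (a : List ℕ) (j : ℕ) :
    M.slot d (a ++ [j]) = M.place (M.opp d) (a, j + 1) := by
  induction a generalizing d with
  | nil => rfl
  | cons i a ih => exact ih _

section Children

variable {n : ℕ} {child : Fin n → PlantedTree} {u : Fin M.numHalfEdges}
  {W : ℕ → Set (Fin M.numHalfEdges)}

theorem ExploresChildren.subset (h : M.ExploresChildren ω child u W) {i j : ℕ} (hij : i ≤ j)
    (hj : j ≤ n) : W i ⊆ W j :=
  subset_of_chain (fun j hj => (Set.subset_insert _ _).trans (h.explores ⟨j, hj⟩).insert_subset)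
    hij hj

theorem exists_step_of_mem {α : Type*} {W : ℕ → Set α} {y : α} {k : ℕ} (hy : y ∈ W k)
    (h0 : y ∉ W 0) : ∃ j < k, y ∈ W (j + 1) ∧ y ∉ W j := by
  induction k with
  | zero => exact absurd hy h0
  | succ k ih =>
    by_cases h : y ∈ W k
    · obtain ⟨j, hj, h'⟩ := ih h
      exact ⟨j, by omega, h'⟩
    · exact ⟨k, by omega, hy, h⟩

/-- The children subtree to which a half-edge belongs, or leads. -/
def branch : List ℕ × ℕ → ℕ
  | ([], j) => j - 1
  | (i :: _, _) => i

theorem ExploresChildren.place_mem (h : M.ExploresChildren ω child u W)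
    (hbij : ∀ j : Fin n, Set.BijOn (M.place (M.opp (M.rot^[j + 1] u))) (child j).halfEdges
      (W (j + 1) \ insert (M.rot^[j + 1] u) (W j)))
    {x : List ℕ × ℕ} (hx : x ∈ (node n child).halfEdges \ {([], 0)}) :
    branch x < n ∧ M.place u x ∈ W (branch x + 1) ∧ M.place u x ∉ W (branch x) := by
  obtain ⟨⟨m, ch, hm, hj⟩, hne⟩ := hx
  obtain ⟨a, j⟩ := x
  cases a with
  | nil =>
    simp only [subtreeAt_nil, Option.some.injEq, node.injEq] at hm hj
    obtain ⟨rfl, -⟩ := hm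
    cases j with
    | zero => exact absurd rfl hne
    | succ j =>
      have hj : j < n := hj
      have := h.explores ⟨j, hj⟩
      exact ⟨hj, this.insert_subset (Set.mem_insert _ _), this.notMem⟩
  | cons i a =>
    obtain ⟨i, rfl, hi⟩ := subtreeAt_node_cons_eq_some.1 hm
    have := (hbij i).mapsTo (show (a, j) ∈ (child i).halfEdges from ⟨m, ch, hi, hj⟩)
    exact ⟨i.2, this.1, fun h' => this.2 (Set.mem_insert_of_mem _ h')⟩

/-- The growing sets `W j` cut the visited half-edges into layers. Layer j consists of the slot of
child j and of the half-edges of its subtree, and `branch` records the layer. -/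
theorem ExploresChildren.bijOn (h : M.ExploresChildren ω child u W)
    (hbij : ∀ j : Fin n, Set.BijOn (M.place (M.opp (M.rot^[j + 1] u))) (child j).halfEdges
      (W (j + 1) \ insert (M.rot^[j + 1] u) (W j))) :
    Set.BijOn (M.place u) ((node n child).halfEdges \ {([], 0)}) (W n \ W 0) := by
  refine ⟨fun x hx => ?_, fun x hx y hy hxy => ?_, fun y hy => ?_⟩
  · obtain ⟨h1, h2, h3⟩ := h.place_mem hbij hx
    exact ⟨h.subset h1 le_rfl h2, fun h4 => h3 (h.subset (Nat.zero_le _) h1.le h4)⟩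
  · have hx' := h.place_mem hbij hx
    have hy' := h.place_mem hbij hy
    have hb : branch x = branch y := by
      rcases lt_trichotomy (branch x) (branch y) with hlt | heq | hlt
      · exact absurd (h.subset hlt hy'.1.le hx'.2.1) (hxy ▸ hy'.2.2)
      · exact heq
      · exact absurd (h.subset hlt hx'.1.le hy'.2.1) (hxy ▸ hx'.2.2)
    obtain ⟨⟨m, ch, hm, hj⟩, hne⟩ := hx
    obtain ⟨⟨m', ch', hm', hj'⟩, hne'⟩ := hy
    obtain ⟨a, j⟩ := x
    obtain ⟨a', j'⟩ := y
    have hpos : ∀ j : ℕ, (([] : List ℕ), j) ∉ ({([], 0)} : Set (List ℕ × ℕ)) → 0 < j := by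
      intro j hj
      by_contra h0
      obtain rfl : j = 0 := by omega
      exact hj rfl
    have hslot : ∀ (i : ℕ) (b : List ℕ) (j' : ℕ) (hi : i < n),
        (b, j') ∈ (child ⟨i, hi⟩).halfEdges →
        M.rot^[i + 1] u ≠ M.place u (i :: b, j') := by
      intro i b j' hi hb heq
      rw [place_cons] at heq
      exact ((hbij ⟨i, hi⟩).mapsTo hb).2 (by simp only [← heq]; exact Set.mem_insert _ _)
    cases a with
    | nil =>
      have hj0 := hpos j hne
      cases a' with
      | nil =>
        have hj0' := hpos j' hne'
        simp only [branch] at hb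
        obtain rfl : j = j' := by omega
        rfl
      | cons i b =>
        obtain ⟨i, rfl, hi⟩ := subtreeAt_node_cons_eq_some.1 hm'
        simp only [branch] at hb
        refine absurd ?_ (hslot i b j' i.2 ⟨m', ch', hi, hj'⟩)
        rw [← hxy, place_nil]
        congr 1
        omega
    | cons i b =>
      obtain ⟨i, rfl, hi⟩ := subtreeAt_node_cons_eq_some.1 hm
      cases a' with
      | nil =>
        have hj0' := hpos j' hne'
        simp only [branch] at hb
        refine absurd ?_ (hslot i b j i.2 ⟨m, ch, hi, hj⟩)
        rw [hxy, place_nil]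
        congr 1
        omega
      | cons i' b' =>
        obtain ⟨i', rfl, hi'⟩ := subtreeAt_node_cons_eq_some.1 hm'
        simp only [branch] at hb
        obtain rfl : i = i' := Fin.ext hb
        rw [place_cons, place_cons] at hxy
        have := (hbij i).injOn (show (b, j) ∈ (child i).halfEdges from ⟨m, ch, hi, hj⟩)
          (show (b', j') ∈ (child i).halfEdges from ⟨m', ch', hi', hj'⟩) hxy
        simp only [Prod.mk.injEq] at this
        rw [this.1, this.2]
  · obtain ⟨j, hj, h1, h2⟩ := exists_step_of_mem hy.1 hy.2
    by_cases hs : y = M.rot^[j + 1] u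
    · exact ⟨([], j + 1), ⟨⟨n, child, subtreeAt_nil _, hj⟩, by simp⟩, hs.symm⟩
    · have hy' : y ∈ W (j + 1) \ insert (M.rot^[j + 1] u) (W j) :=
        ⟨h1, fun h3 => h3.elim hs h2⟩
      obtain ⟨⟨a, i⟩, ⟨m, ch, hm, hi⟩, rfl⟩ := (hbij ⟨j, hj⟩).surjOn hy'
      exact ⟨(j :: a, i), ⟨⟨m, ch, subtreeAt_node_cons_eq_some.2 ⟨⟨j, hj⟩, rfl, hm⟩, hi⟩, by simp⟩, rfl⟩

end Children

theorem Explores.children {n : ℕ} {child : Fin n → PlantedTree} {d : Fin M.numHalfEdges}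
    {V V' : Set (Fin M.numHalfEdges)} (hω : M.IsOrientation ω)
    (h : M.Explores ω (node n child) d V V') :
    d ∉ V ∧ M.opp d ∉ insert d V ∧ ∃ W, W 0 = insert (M.opp d) (insert d V) ∧ V' = W n ∧
      M.ExploresChildren ω child (M.opp d) W := by
  obtain ⟨h1, h2, h3, h4, W, h0, h5, h6⟩ := h
  exact ⟨h1, h3, W, h0, h5, h4, by rw [hω, h2]; rfl, by rw [h0]; exact Set.mem_insert _ _, h6⟩

/-- The half-edges of the found subtree are exactly those visited after `d`, each visited once. -/
theorem Explores.bijOn {S : PlantedTree} {d : Fin M.numHalfEdges}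
    {V V' : Set (Fin M.numHalfEdges)} (hω : M.IsOrientation ω) (h : M.Explores ω S d V V') :
    Set.BijOn (M.place (M.opp d)) S.halfEdges (V' \ insert d V) := by
  have hleaf : ∀ {S : PlantedTree}, ¬ S.IsNode → S.halfEdges = ∅ := by
    intro S hS
    by_contra hne
    obtain ⟨x, hx⟩ := Set.nonempty_iff_ne_empty.2 hne
    exact hS (isNode_of_mem_halfEdges hx)
  induction S generalizing d V V' with
  | opening =>
    rw [hleaf not_isNode_opening, h.1, Set.sdiff_self]
    exact Set.bijOn_empty _
  | closing =>
    rw [hleaf not_isNode_closing, h.1, Set.sdiff_self]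
    exact Set.bijOn_empty _
  | node n child ih =>
    obtain ⟨h1, h2, W, h0, rfl, hW⟩ := h.children hω
    have key := hW.bijOn fun j => ih j (hW.explores j)
    have hroot : ([], 0) ∈ (node n child).halfEdges := IsNode.root_mem ⟨n, child, rfl⟩
    have := key.insert (a := ([], 0)) (by rw [place_root, h0]; simp)
    rw [Set.insert_sdiff_singleton, Set.insert_eq_of_mem hroot, place_root, h0] at this
    convert this using 1
    ext y
    have hmem : M.opp d ∈ W n := hW.subset (Nat.zero_le n) le_rfl hW.mem
    by_cases hy : y = M.opp d
    · subst hy; simp [hmem, h2]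
    · simp [hy]

theorem ExploresChildren.minimalPeriod_eq {n : ℕ} {child : Fin n → PlantedTree}
    {u : Fin M.numHalfEdges} {W : ℕ → Set (Fin M.numHalfEdges)} (hω : M.IsOrientation ω)
    (h : M.ExploresChildren ω child u W) {a : List ℕ} {k : ℕ} {ch : Fin k → PlantedTree}
    (ha : (node n child).subtreeAt a = some (node k ch)) :
    k + 1 = Function.minimalPeriod M.rot (M.descend u a) := by
  induction a generalizing n child u W with
  | nil =>
    simp only [subtreeAt_nil, Option.some.injEq, node.injEq] at ha
    obtain ⟨rfl, -⟩ := ha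
    exact h.period
  | cons i a ih =>
    obtain ⟨i, rfl, hi⟩ := subtreeAt_node_cons_eq_some.1 ha
    have hex := h.explores i
    cases hc : child i with
    | opening => rw [hc] at hi; cases a <;> simp at hi
    | closing => rw [hc] at hi; cases a <;> simp at hi
    | node k' ch' =>
      rw [hc] at hi hex
      obtain ⟨-, -, W', -, -, hW'⟩ := hex.children hω
      exact ih hW' hi

theorem Explores.slot_out_iff {S : PlantedTree} {d : Fin M.numHalfEdges}
    {V V' : Set (Fin M.numHalfEdges)} (h : M.Explores ω S d V V') {b : List ℕ} {U : PlantedTree}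
    (hb : S.subtreeAt b = some U) : ω (M.slot d b) = true ↔ U = opening := by
  induction b generalizing S d V V' with
  | nil =>
    simp only [subtreeAt_nil, Option.some.injEq] at hb
    subst hb
    exact h.out_iff
  | cons j b ih =>
    cases S with
    | opening => simp at hb
    | closing => simp at hb
    | node n child =>
      obtain ⟨-, -, -, -, W, -, -, hW⟩ := h
      obtain ⟨j, rfl, hj⟩ := subtreeAt_node_cons_eq_some.1 hb
      exact ih (hW j) hj

/-- Besides the slots themselves, the exploration visits the upward half-edges of nodes, which are
opposite to their slots. -/
theorem Explores.eq_slot {S : PlantedTree} {d : Fin M.numHalfEdges}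
    {V V' : Set (Fin M.numHalfEdges)} (h : M.Explores ω S d V V') {y : Fin M.numHalfEdges}
    (hy : y ∈ V') (hyV : y ∉ V) :
    ∃ b, S.subtreeAt b ≠ none ∧ (y = M.slot d b ∨ y = M.opp (M.slot d b)) := by
  induction S generalizing d V V' with
  | opening =>
    rw [h.1] at hy
    exact ⟨[], by simp, Or.inl (hy.resolve_right hyV)⟩
  | closing =>
    rw [h.1] at hy
    exact ⟨[], by simp, Or.inl (hy.resolve_right hyV)⟩
  | node n child ih =>
    obtain ⟨-, -, -, -, W, h0, rfl, hW⟩ := h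
    by_cases hy0 : y ∈ W 0
    · rw [h0] at hy0
      rcases hy0 with rfl | rfl | hy0
      · exact ⟨[], by simp, Or.inr rfl⟩
      · exact ⟨[], by simp, Or.inl rfl⟩
      · exact absurd hy0 hyV
    · obtain ⟨j, hj, h1, h2⟩ := exists_step_of_mem hy hy0
      obtain ⟨b, hb, hb'⟩ := ih ⟨j, hj⟩ (hW ⟨j, hj⟩) h1 h2
      exact ⟨j :: b, by rwa [← subtreeAt_node_cons_fin n child ⟨j, hj⟩] at hb, hb'⟩

/-- The half-edge matched with a closing leaf was visited before. -/
theorem ExploresChildren.opp_slot {n : ℕ} {child : Fin n → PlantedTree}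
    {u : Fin M.numHalfEdges} {W : ℕ → Set (Fin M.numHalfEdges)}
    (h : M.ExploresChildren ω child u W)
    (ih : ∀ (j : Fin n) (b : List ℕ), (child j).subtreeAt b = some closing →
      M.opp (M.slot (M.rot^[j + 1] u) b) ∈ W j ∨ ∃ b' < b, (child j).subtreeAt b' ≠ none ∧
        (M.opp (M.slot (M.rot^[j + 1] u) b) = M.slot (M.rot^[j + 1] u) b' ∨
          M.slot (M.rot^[j + 1] u) b = M.slot (M.rot^[j + 1] u) b'))
    {b : List ℕ} (hb : (node n child).subtreeAt b = some closing) :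
    M.opp (M.slot (M.opp u) b) ∈ W 0 ∨ ∃ b' < b, b' ≠ [] ∧ (node n child).subtreeAt b' ≠ none ∧
      (M.opp (M.slot (M.opp u) b) = M.slot (M.opp u) b' ∨
        M.slot (M.opp u) b = M.slot (M.opp u) b') := by
  have hslot : ∀ (j : ℕ) b, M.slot (M.opp u) (j :: b) = M.slot (M.rot^[j + 1] u) b := by
    intro j b
    rw [slot, M.opp_opp]
  cases b with
  | nil => simp at hb
  | cons j b =>
    obtain ⟨j, rfl, hj⟩ := subtreeAt_node_cons_eq_some.1 hb
    rw [hslot]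
    rcases ih j b hj with h1 | ⟨b', hb', h1, h2⟩
    -- If it was not visited before all the children, it was visited with an earlier sibling, all of
    -- whose addresses are smaller.
    · by_cases h0 : M.opp (M.slot (M.rot^[j + 1] u) b) ∈ W 0
      · exact Or.inl h0
      · obtain ⟨i, hi, h2, h3⟩ := exists_step_of_mem h1 h0
        obtain ⟨b', hb', h4⟩ := (h.explores ⟨i, by omega⟩).eq_slot h2 h3
        refine Or.inr ⟨i :: b', List.cons_lt_cons_iff.2 (Or.inl hi), by simp, ?_, ?_⟩
        · rwa [← subtreeAt_node_cons_fin n child ⟨i, by omega⟩] at hb'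
        · rw [hslot]
          exact h4.imp id fun h5 => M.opp.injective h5
    · refine Or.inr ⟨j :: b', List.cons_lt_cons_iff.2 (Or.inr ⟨rfl, hb'⟩), by simp, by simpa using h1, ?_⟩
      rwa [hslot]

/-- The equality of two slots stands for the opposite being the upward half-edge of a node;
injectivity of `place` excludes it later. -/
theorem Explores.opp_slot {S : PlantedTree} {d : Fin M.numHalfEdges}
    {V V' : Set (Fin M.numHalfEdges)} (hω : M.IsOrientation ω) (h : M.Explores ω S d V V')
    {b : List ℕ} (hb : S.subtreeAt b = some closing) :
    M.opp (M.slot d b) ∈ V ∨ ∃ b' < b, S.subtreeAt b' ≠ none ∧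
      (M.opp (M.slot d b) = M.slot d b' ∨ M.slot d b = M.slot d b') := by
  induction S generalizing d V V' b with
  | opening => cases b <;> simp at hb
  | closing =>
    cases b with
    | nil => exact Or.inl h.2.2.2
    | cons j b => simp at hb
  | node n child ih =>
    obtain ⟨h1, h2, W, h0, rfl, hW⟩ := h.children hω
    have key := hW.opp_slot (fun j b hb => ih j (hW.explores j) hb) hb
    rw [M.opp_opp, h0] at key
    have hnil : [] < b := by
      cases b with
      | nil => simp at hb
      | cons j b => exact List.nil_lt_cons _ _
    rcases key with (h3 | h3 | h3) | ⟨b', hb', -, h3⟩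
    · exact Or.inr ⟨[], hnil, by simp, Or.inr (M.opp.injective h3)⟩
    · exact Or.inr ⟨[], hnil, by simp, Or.inl h3⟩
    · exact Or.inl h3
    · exact Or.inr ⟨b', hb', h3⟩

open Classical in
theorem sum_vertex_iterate {u : Fin M.numHalfEdges} {n : ℕ}
    (hn : n + 1 = Function.minimalPeriod M.rot u) (φ : Fin M.numHalfEdges → ℤ) :
    ∑ d, (if M.vertexOf d = M.vertexOf u then φ d else 0) =
      φ u + ∑ j : Fin n, φ (M.rot^[j + 1] u) := by
  rw [← Finset.sum_filter]
  trans ∑ j : Fin (n + 1), φ (M.rot^[j] u)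
  · symm
    refine Finset.sum_bij (fun j _ => M.rot^[j] u) ?_ ?_ ?_ (fun _ _ => rfl)
    · intro j _
      exact Finset.mem_filter.2 ⟨Finset.mem_univ _, vertexOf_iterate u j⟩
    · intro i _ j _ hij
      exact Fin.ext (iterate_inj hn (Nat.le_of_lt_succ i.2) (Nat.le_of_lt_succ j.2) hij)
    · intro d hd
      obtain ⟨j, hj, rfl⟩ := exists_iterate_of_vertexOf_eq hn (Finset.mem_filter.1 hd).2
      exact ⟨⟨j, Nat.lt_succ_of_le hj⟩, Finset.mem_univ _, rfl⟩
  · rw [Fin.sum_univ_succ]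
    simp

/-- Balance of the orientation at the vertex: the upward half-edge and the openings are outgoing,
all the other half-edges incoming. -/
theorem ExploresChildren.isEulerian {n : ℕ} {child : Fin n → PlantedTree}
    {u : Fin M.numHalfEdges} {W : ℕ → Set (Fin M.numHalfEdges)} (hω : M.IsEulerianOrientation ω)
    (h : M.ExploresChildren ω child u W) (ih : ∀ j, (child j).IsEulerian) :
    (node n child).IsEulerian := by
  classical
  refine ⟨⟨Nat.card {j // child j = opening} + 1, ?_, rfl⟩, ih⟩
  have h1 := hω.balanced (M.vertexOf u)
  rw [excess, sum_vertex_iterate h.period fun d => orientationSign (ω d), h.out] at h1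
  have h2 : ∀ j : Fin n, orientationSign (ω (M.rot^[j + 1] u)) =
      2 * (if child j = opening then 1 else 0) - 1 := by
    intro j
    have := (h.explores j).out_iff
    by_cases hc : child j = opening
    · rw [this.2 hc, if_pos hc]; rfl
    · rw [if_neg hc, show ω (M.rot^[j + 1] u) = false by simpa using fun h => hc (this.1 h)]; rfl
  rw [Finset.sum_congr rfl fun j _ => h2 j, Finset.sum_sub_distrib, ← Finset.mul_sum,
    Finset.sum_boole] at h1
  rw [Nat.card_eq_fintype_card, Fintype.card_subtype]
  simp only [orientationSign, Finset.sum_const, Finset.card_univ, Fintype.card_fin,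
    nsmul_eq_mul, mul_one, if_true] at h1
  omega

theorem Explores.isEulerian {S : PlantedTree} {d : Fin M.numHalfEdges}
    {V V' : Set (Fin M.numHalfEdges)} (hω : M.IsEulerianOrientation ω)
    (h : M.Explores ω S d V V') : S.IsEulerian := by
  induction S generalizing d V V' with
  | opening => trivial
  | closing => trivial
  | node n child ih =>
    obtain ⟨-, -, W, -, -, hW⟩ := h.children hω.orientation
    exact hW.isEulerian hω fun j => ih j (hW.explores j)

theorem eq_univ_of_closed (M : HalfEdgeMap) {V : Set (Fin M.numHalfEdges)} (hroot : M.root ∈ V)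
    (hrot : ∀ y, M.rot y ∈ V ↔ y ∈ V) (hopp : ∀ y ∈ V, M.opp y ∈ V) : V = Set.univ := by
  refine Set.eq_univ_of_forall fun d => ?_
  obtain ⟨p, hp, rfl⟩ := M.connected M.root d
  have key : ∀ y, p y ∈ V ↔ y ∈ V := by
    induction hp using Subgroup.closure_induction with
    | mem x hx =>
      rcases hx with rfl | rfl
      · exact hrot
      · exact fun y => ⟨fun h => by simpa [M.opp_opp] using hopp _ h, hopp y⟩
    | one => exact fun y => Iff.rfl
    | mul x y _ _ hx hy => exact fun z => by rw [Equiv.Perm.mul_apply, hx, hy]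
    | inv x _ hx =>
      intro y
      rw [← hx, Equiv.Perm.inv_def, Equiv.apply_symm_apply]
  exact (key _).2 hroot

/-- A rooted Eulerian map is the closure of an Eulerian tree endowed with a forward matching. -/
theorem exists_matchedEulerianTree (M : HalfEdgeMap) (hM : ∀ d ∈ M.degrees, Even d) :
    ∃ S : MatchedEulerianTree, M.IsClosure S.matching := by
  obtain ⟨ω₀, hω₀, hroot₀⟩ := M.exists_isEulerianOrientation hM M.root
  obtain ⟨n, hn⟩ := Nat.exists_eq_succ_of_ne_zero (minimalPeriod_rot_pos M.root).ne'
  -- The root half-edge plays the part of the visited opening leaf: it is outgoing, and `Blocked` is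
  -- vacuous since no other vertex has been touched.
  obtain ⟨child, W, ω, h0, hω, hag, hexp, -, hC⟩ := explore_children (V := {M.root})
    (u := M.root) (ω := ω₀) rfl (fun y hy _ => hy) hω₀
    (by rintro y rfl _; exact hroot₀)
    (by rintro z hz ⟨y, rfl, hyz⟩ hzu; exact absurd hyz.symm hzu)
    (fun W ω d _ => M.explorable W ω d) hn.symm
  have hW : M.ExploresChildren ω child M.root W :=
    ⟨hn.symm, by rw [hag _ rfl, hroot₀], by rw [h0]; rfl, hexp⟩
  have hor := hω.orientation
  let t := node n child
  have ht : t.IsNode := ⟨n, child, rfl⟩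
  have htE : t.IsEulerian := hW.isEulerian hω fun j => (hexp j).isEulerian hω
  let T : BlossomingTree := ⟨t, htE.isProper, t.ncard_openingLeaves_eq_iff.2
    (htE.increment_eq.resolve_left (by simp [t]))⟩
  let f := M.place M.root
  have hbij : Set.BijOn f t.halfEdges (W n) := by
    have := (hW.bijOn fun j => (hexp j).bijOn hor).insert (a := ([], 0)) (by rw [place_root, h0]; simp)
    rw [Set.insert_sdiff_singleton, Set.insert_eq_of_mem ht.root_mem, place_root, h0,
      Set.insert_sdiff_singleton, Set.insert_eq_of_mem (hW.subset (Nat.zero_le n) le_rfl hW.mem)] at this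
    exact this
  have hslot : ∀ a j, M.slot (M.opp M.root) (a ++ [j]) = f (a, j + 1) := by
    intro a j
    rw [slot_concat, M.opp_opp]
  have hout : ∀ (b : List ℕ) (U : PlantedTree), b ≠ [] → t.subtreeAt b = some U →
      (ω (M.slot (M.opp M.root) b) = true ↔ U = opening) := by
    intro b U hb hU
    cases b with
    | nil => exact absurd rfl hb
    | cons j b =>
      obtain ⟨j, rfl, hj⟩ := subtreeAt_node_cons_eq_some.1 hU
      rw [slot, M.opp_opp]
      exact (hexp j).slot_out_iff hj
  -- The opposite of a closing slot was visited before and is outgoing, so it carries an earlier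
  -- opening leaf or the root leaf.
  have hclose : ∀ c : t.closingLeaves, ∃ o : t.openingLeaves,
      (o : LeafPosition) < (c : LeafPosition) ∧ M.opp (f (stem c)) = f (stem o) := by
    rintro ⟨_, b, rfl, hb⟩
    have hbne : b ≠ [] := by rintro rfl; simp [t] at hb
    obtain ⟨a, i, hai⟩ := ht.eq_concat_of_leaf hb not_isNode_closing
    have hsb : M.slot (M.opp M.root) b = f (stem b) := by rw [hai, hslot, stem_concat]
    rw [← hsb]
    rcases hW.opp_slot (fun j b hb => (hexp j).opp_slot hor hb) hb with h1 | ⟨b', hb', hne, hv, h1⟩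
    · rw [h0] at h1
      exact ⟨⟨⊥, bot_mem_openingLeaves _⟩, WithBot.bot_lt_coe _, h1⟩
    · obtain ⟨U, hU⟩ := Option.ne_none_iff_exists'.1 hv
      obtain ⟨a', i', rfl⟩ := (List.eq_nil_or_concat b').resolve_left hne
      simp only [List.concat_eq_append] at *
      rcases h1 with h1 | h1
      · have h2 : ω (M.slot (M.opp M.root) b) ≠ true := by
          rw [Ne, hout b _ hbne hb]
          simp
        have h3 : ω (M.slot (M.opp M.root) (a' ++ [i'])) = true := by
          rw [← h1, hor]
          simpa using h2
        rw [hout _ _ hne hU] at h3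
        subst h3
        refine ⟨⟨_, coe_mem_openingLeaves.2 hU⟩, WithBot.coe_lt_coe.2 hb', ?_⟩
        rw [h1, hslot, stem_concat]
      -- Different addresses have different slots, so this case is impossible.
      · rw [hai, hslot, hslot] at h1
        have h2 := hbij.injOn (mem_halfEdges_succ.2 ⟨_, hai ▸ hb⟩) (mem_halfEdges_succ.2 ⟨_, hU⟩) h1
        simp only [Prod.mk.injEq, Nat.add_right_cancel_iff] at h2
        rw [hai, h2.1, h2.2] at hb'
        exact absurd hb' (lt_irrefl _)
  choose μ hμlt hμ using hclose
  have hμinj : Function.Injective μ := by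
    intro c c' h
    have h1 := (hμ c).trans (h ▸ (hμ c').symm)
    have hc := ht.stem_closing c.2
    have hc' := ht.stem_closing c'.2
    have h2 := hbij.injOn hc.1 hc'.1 (M.opp.injective h1)
    exact Subtype.ext (by rw [← hc.2, h2, hc'.2])
  have hμbij : Function.Bijective μ := (Nat.bijective_iff_injective_and_card μ).2 ⟨hμinj, T.card_eq.symm⟩
  let m : ForwardMatching T :=
    { toEquiv := (Equiv.ofBijective μ hμbij).symm
      forward := fun o => by
        obtain ⟨c, rfl⟩ := hμbij.2 o
        have : (Equiv.ofBijective μ hμbij).symm (μ c) = c :=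
          (Equiv.ofBijective μ hμbij).symm_apply_apply c
        rw [this]
        exact hμlt c }
  have hm : ∀ c, m.toEquiv.symm c = μ c := fun c => rfl
  have hopp : ∀ x ∈ t.halfEdges, M.opp (f x) = f (m.mate x) := by
    intro x hx
    rcases halfEdges_cases hx with ⟨h', h | h⟩ | ⟨a, j, k, ch, h, rfl | rfl⟩
    · have h2 := hμ (m.toEquiv ⟨_, h⟩)
      rw [← hm, Equiv.symm_apply_apply, h'] at h2
      rw [m.mate_opening h, ← h2, M.opp_opp]
    · have h2 := hμ ⟨_, h⟩
      rw [h', ← hm] at h2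
      rw [m.mate_closing h, h2]
    · rw [m.mate_up h, show f (a ++ [j], 0) = _ from place_concat _ _ _, M.opp_opp]
    · rw [m.mate_down h, show f (a ++ [j], 0) = _ from place_concat _ _ _]
  -- Visited vertices are complete, and `opp` is `mate` on the visited half-edges; connectedness
  -- does the rest.
  have huniv : W n = Set.univ := by
    refine M.eq_univ_of_closed (hW.subset (Nat.zero_le n) le_rfl hW.mem) (fun y => ?_) fun y hy => ?_
    · have key : ∀ y ∈ W n, ∀ z, M.vertexOf z = M.vertexOf y → z ∈ W n := by
        intro y hy z hz
        rcases hC y hy with ⟨rfl, h⟩ | h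
        · exact absurd rfl h
        · exact (h z hz).1
      exact ⟨fun h => key _ h _ (M.vertexOf_rot y).symm, fun h => key _ h _ (M.vertexOf_rot y)⟩
    · obtain ⟨x, hx, rfl⟩ := hbij.surjOn hy
      rw [hopp x hx]
      exact hbij.mapsTo (m.mate_mem hx)
  refine ⟨⟨T, htE, m⟩, isClosure_iff.2 ⟨f, huniv ▸ hbij, rfl, ?_, hopp⟩⟩
  rintro ⟨a, j⟩ ⟨k, ch, ha, hj⟩
  rcases lt_or_eq_of_le hj with hj | hj
  · rw [next_of_lt ha hj]
    exact (place_succ _ _ _).symm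
  · simp only at hj ha
    subst hj
    rw [next_last ha]
    have hper := hW.minimalPeriod_eq hor ha
    rw [← place_succ]
    change M.rot^[_] _ = M.descend M.root a
    rw [hper, Function.iterate_minimalPeriod]

end HalfEdgeMap

/-! ### Weights of Eulerian trees -/

namespace PlantedTree

theorem prod_map_positions_node {A : Type*} [CommMonoid A] {n : ℕ} (child : Fin n → PlantedTree)
    (φ : List ℕ × PlantedTree → A) :
    ((node n child).positions.map φ).prod = φ ([], node n child) *
      ∏ j, ((child j).positions.map fun x => φ ((j : ℕ) :: x.1, x.2)).prod := by
  rw [positions, Multiset.map_cons, Multiset.prod_cons]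
  congr 1
  rw [← Multiset.coe_mapAddMonoidHom, map_sum, Multiset.prod_sum]
  simp [Multiset.map_map]

open Classical in
/-- The product of the heights of the closing leaves, if the leaf-path starts at level `i`. -/
noncomputable def levelWeight (i : ℤ) (T : PlantedTree) : ℕ :=
  (T.positions.map fun x => if x.2 = closing then (i + T.incrementBefore x.1).toNat else 1).prod

@[simp] theorem levelWeight_opening (i : ℤ) : opening.levelWeight i = 1 := by
  simp [levelWeight, positions]

@[simp] theorem levelWeight_closing (i : ℤ) : closing.levelWeight i = i.toNat := by
  simp [levelWeight, positions, incrementBefore]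

/-- Child j starts at the level reached after the children before it. -/
theorem levelWeight_node (i : ℤ) {n : ℕ} (child : Fin n → PlantedTree) :
    (node n child).levelWeight i =
      ∏ j, (child j).levelWeight (i + ∑ l, if l < j then (child l).increment else 0) := by
  rw [levelWeight, prod_map_positions_node, if_neg (by simp), one_mul]
  refine Finset.prod_congr rfl fun j _ => ?_
  simp only [incrementBefore_node_cons, levelWeight, add_assoc]

open Classical in
-- At i = 1 this is the product of the heights. Through `toNat` it vanishes as soon as some height
-- is not positive.
theorem levelWeight_eq_prod (i : ℤ) (T : PlantedTree) [Fintype T.closingLeaves] :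
    T.levelWeight i = ∏ c : T.closingLeaves, (i + (T.height c - 1)).toNat := by
  let s : Finset (List ℕ × PlantedTree) := ⟨T.positions, T.nodup_positions⟩
  have h1 : T.levelWeight i =
      ∏ x ∈ s, if x.2 = closing then (i + T.incrementBefore x.1).toNat else 1 := rfl
  rw [h1, ← Finset.prod_filter]
  have hmem : ∀ x, x ∈ s.filter (fun x => x.2 = closing) ↔
      x.2 = closing ∧ T.subtreeAt x.1 = some closing := by
    rintro ⟨a, S⟩
    rw [Finset.mem_filter]
    constructor
    · rintro ⟨h, rfl⟩
      exact ⟨rfl, mem_positions.1 h⟩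
    · rintro ⟨rfl, h⟩
      exact ⟨mem_positions.2 h, rfl⟩
  refine Finset.prod_bij (fun x hx => ⟨(x.1 : LeafPosition),
    coe_mem_closingLeaves.2 ((hmem x).1 hx).2⟩) (fun _ _ => Finset.mem_univ _) ?_ ?_ ?_
  · rintro ⟨a, S⟩ ha ⟨b, U⟩ hb hab
    have h2 : a = b := WithBot.coe_injective (congrArg Subtype.val hab)
    exact Prod.ext h2 (((hmem _).1 ha).1.trans ((hmem _).1 hb).1.symm)
  · rintro ⟨_, a, rfl, ha⟩ _
    exact ⟨(a, closing), (hmem _).2 ⟨rfl, ha⟩, rfl⟩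
  · rintro ⟨a, S⟩ ha
    simp only
    rw [height_eq_incrementBefore]
    congr 1
    ring

end PlantedTree

@[simp] theorem halfDegree_zero : halfDegree 0 = 0 := by simp [halfDegree]

theorem halfDegree_cons (d : ℕ) (s : Multiset ℕ) :
    halfDegree (d ::ₘ s) = d / 2 + halfDegree s := by simp [halfDegree]

theorem halfDegree_sum {n : ℕ} (s : Fin n → Multiset ℕ) :
    halfDegree (∑ j, s j) = ∑ j, halfDegree (s j) := by
  simp only [halfDegree]
  rw [← Multiset.coe_mapAddMonoidHom, map_sum, ← Multiset.coe_sumAddMonoidHom, map_sum]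

section

variable {R : Type*} [CommRing R] (g : ℕ → R)

@[simp] theorem degreeWeight_zero : degreeWeight g 0 = 1 := by simp [degreeWeight]

theorem degreeWeight_cons {d : ℕ} (hd : 0 < d) (s : Multiset ℕ) :
    degreeWeight g (d ::ₘ s) = g (d / 2) * degreeWeight g s := by simp [degreeWeight, hd]

theorem degreeWeight_add (s t : Multiset ℕ) :
    degreeWeight g (s + t) = degreeWeight g s * degreeWeight g t := by simp [degreeWeight]

theorem degreeWeight_sum {n : ℕ} (s : Fin n → Multiset ℕ) :
    degreeWeight g (∑ j, s j) = ∏ j, degreeWeight g (s j) := by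
  have key : ∀ t : Finset (Fin n),
      degreeWeight g (∑ j ∈ t, s j) = ∏ j ∈ t, degreeWeight g (s j) := by
    intro t
    induction t using Finset.cons_induction with
    | empty => simp
    | cons a t ha ih => rw [Finset.sum_cons, Finset.prod_cons, degreeWeight_add, ih]
  exact key _

end

/-! ### Finiteness of the sets of Eulerian trees -/

namespace PlantedTree

/-- A node uses at least one unit of half-degree, so its subtrees have smaller size and its number
of children is bounded. -/
theorem IsEulerian.finite_halfDegree_le (E : ℕ) :
    {t : PlantedTree | t.IsEulerian ∧ halfDegree t.nodeDegrees ≤ E}.Finite := by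
  induction E with
  | zero =>
    refine (Set.toFinite {opening, closing}).subset ?_
    rintro t ⟨ht, hE⟩
    cases t with
    | opening => simp
    | closing => simp
    | node n child =>
      obtain ⟨⟨k, hk, hk'⟩, -⟩ := ht
      rw [nodeDegrees, halfDegree_cons] at hE
      omega
  | succ E ih =>
    refine ((Set.toFinite {opening, closing}).union ((Set.finite_Iic (2 * E + 2)).biUnion
      fun n _ => (Set.Finite.pi' fun _ : Fin n => ih).image (node n))).subset ?_
    rintro t ⟨ht, hE⟩
    cases t with
    | opening => exact Or.inl (by simp)
    | closing => exact Or.inl (by simp)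
    | node n child =>
      right
      obtain ⟨⟨k, hk, hk'⟩, h⟩ := ht
      rw [nodeDegrees, halfDegree_cons, halfDegree_sum] at hE
      simp only [Set.mem_iUnion, Set.mem_Iic]
      refine ⟨n, by omega, child, fun j => ⟨h j, ?_⟩, rfl⟩
      have := Finset.single_le_sum (f := fun j => halfDegree (child j).nodeDegrees)
        (fun _ _ => Nat.zero_le _) (Finset.mem_univ j)
      omega

/-- The Eulerian trees, other than a single opening leaf, that have a given total half-degree. -/
noncomputable def eulerianTrees (E : ℕ) : Finset PlantedTree :=
  (show {t : PlantedTree | t.IsEulerian ∧ t ≠ opening ∧ halfDegree t.nodeDegrees = E}.Finite from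
    (IsEulerian.finite_halfDegree_le E).subset fun _ h => ⟨h.1, h.2.2.le⟩).toFinset

theorem mem_eulerianTrees {E : ℕ} {t : PlantedTree} :
    t ∈ eulerianTrees E ↔ t.IsEulerian ∧ t ≠ opening ∧ halfDegree t.nodeDegrees = E := by
  simp [eulerianTrees]

/-- The Eulerian trees, other than a single opening leaf, of bounded total half-degree. -/
noncomputable def eulerianTreesLE (E : ℕ) : Finset PlantedTree :=
  (show {t : PlantedTree | t.IsEulerian ∧ t ≠ opening ∧ halfDegree t.nodeDegrees ≤ E}.Finite from
    (IsEulerian.finite_halfDegree_le E).subset fun _ h => ⟨h.1, h.2.2⟩).toFinset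

theorem mem_eulerianTreesLE {E : ℕ} {t : PlantedTree} :
    t ∈ eulerianTreesLE E ↔ t.IsEulerian ∧ t ≠ opening ∧ halfDegree t.nodeDegrees ≤ E := by
  simp [eulerianTreesLE]

end PlantedTree

/-! ### Leaf-paths -/

theorem pathHeight_zero {n : ℕ} (i : ℕ) (p : Fin n → Bool) : pathHeight i p 0 = i := by
  simp [pathHeight]

theorem pathHeight_succ {n : ℕ} (i : ℕ) (p : Fin n → Bool) (j : Fin n) :
    pathHeight i p (j + 1) = pathHeight i p j + if p j then 1 else -1 := by
  have h : ∀ l : Fin n, (if (l : ℕ) < j + 1 then (if p l then (1 : ℤ) else -1) else 0) =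
      (if (l : ℕ) < j then (if p l then 1 else -1) else 0) +
        if l = j then (if p l then 1 else -1) else 0 := by
    intro l
    rcases lt_trichotomy l j with h | rfl | h
    · have h1 : (l : ℕ) < j := h
      simp [h1, h1.trans (Nat.lt_succ_self _), h.ne]
    · simp
    · have h1 : (j : ℕ) < l := h
      simp [h1.not_gt, show ¬ (l : ℕ) < j + 1 by omega, h.ne']
  rw [pathHeight, Finset.sum_congr rfl fun l _ => h l, Finset.sum_add_distrib, pathHeight]
  simp [add_assoc]

/-- A path that reaches a negative level has a descending step that starts at level `0`. -/
theorem exists_pathHeight_eq_zero {n : ℕ} {i : ℕ} {p : Fin n → Bool} {j : ℕ} (hj : j ≤ n)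
    (h : pathHeight i p j < 0) : ∃ l : Fin n, p l = false ∧ pathHeight i p l = 0 := by
  induction j with
  | zero =>
    rw [pathHeight_zero] at h
    omega
  | succ j ih =>
    by_cases h1 : pathHeight i p j < 0
    · exact ih (by omega) h1
    · have h2 := pathHeight_succ i p ⟨j, hj⟩
      simp only at h2
      refine ⟨⟨j, hj⟩, ?_, ?_⟩
      · by_contra h3
        simp only [Bool.not_eq_false] at h3
        rw [h3] at h2
        simp only [if_true] at h2
        omega
      · split_ifs at h2 <;> simp only <;> omega

theorem pathHeight_last {n : ℕ} (i : ℕ) (p : Fin n → Bool) :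
    pathHeight i p n = i + (2 * Nat.card {j // p j = true} - n : ℤ) := by
  have h : ∀ l : Fin n, (if (l : ℕ) < n then (if p l then (1 : ℤ) else -1) else 0) =
      2 * (if p l = true then 1 else 0) - 1 := by
    intro l
    rw [if_pos l.2]
    split_ifs <;> norm_num
  rw [pathHeight, Finset.sum_congr rfl fun l _ => h l, Finset.sum_sub_distrib, ← Finset.mul_sum,
    Finset.sum_boole, Nat.card_eq_fintype_card, Fintype.card_subtype]
  simp

namespace PlantedTree

open Classical in
/-- The path followed by the levels when the children of a node are visited. -/
noncomputable def childPath {n : ℕ} (child : Fin n → PlantedTree) : Fin n → Bool :=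
  fun j => decide (child j = opening)

theorem childPath_eq_true {n : ℕ} {child : Fin n → PlantedTree} {j : Fin n} :
    childPath child j = true ↔ child j = opening := by simp [childPath]

theorem childPath_eq_false {n : ℕ} {child : Fin n → PlantedTree} {j : Fin n} :
    childPath child j = false ↔ child j ≠ opening := by simp [childPath]

theorem add_sum_increment {n : ℕ} {child : Fin n → PlantedTree} (h : ∀ j, (child j).IsEulerian)
    (i : ℕ) (j : Fin n) : ((i : ℤ) + ∑ l, if l < j then (child l).increment else 0) =
      pathHeight i (childPath child) j := by
  rw [pathHeight]
  congr 1
  refine Finset.sum_congr rfl fun l _ => ?_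
  suffices h1 : (child l).increment = if childPath child l = true then 1 else -1 by
    simp only [Fin.lt_def, h1]
  rcases (h l).increment_eq with h1 | h1
  · rw [if_pos (childPath_eq_true.2 h1), h1, increment_opening]
  · rw [if_neg, h1]
    rw [childPath_eq_true]
    rintro h2
    rw [h2, increment_opening] at h1
    norm_num at h1

theorem levelWeight_node_eq {n : ℕ} {child : Fin n → PlantedTree} (h : ∀ j, (child j).IsEulerian)
    (i : ℕ) : (node n child).levelWeight i =
      ∏ j : Fin n, (child j).levelWeight (pathHeight i (childPath child) j) := by
  rw [levelWeight_node]
  refine Finset.prod_congr rfl fun j _ => ?_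
  rw [add_sum_increment h]

/-- Having k - 1 openings among 2k - 1 children means that the path ends one level lower. -/
theorem isEulerian_node_iff {n k : ℕ} (hn : n + 1 = 2 * k) {child : Fin n → PlantedTree}
    (h : ∀ j, (child j).IsEulerian) (i : ℕ) :
    (node n child).IsEulerian ↔ pathHeight i (childPath child) n = (i : ℤ) - 1 := by
  have h1 : Nat.card {j // childPath child j = true} = Nat.card {j // child j = opening} :=
    Nat.card_congr (Equiv.subtypeEquivRight fun j => childPath_eq_true)
  rw [pathHeight_last, h1]
  constructor
  · rintro ⟨⟨k', hk, hk'⟩, -⟩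
    omega
  · intro h2
    exact ⟨⟨k, hn, by omega⟩, h⟩

/-- The path of the children goes from 0 to -1, hence descends from level 0 at some non-opening
child, whose weight vanishes by induction. This is what removes the paths that become negative, and
it agrees with r 0 = 0. -/
theorem IsEulerian.levelWeight_zero {t : PlantedTree} (ht : t.IsEulerian) (hne : t ≠ opening) :
    t.levelWeight 0 = 0 := by
  induction t with
  | opening => exact absurd rfl hne
  | closing => simp
  | node n child ih =>
    obtain ⟨⟨k, hk, hk'⟩, h⟩ := id ht
    have h1 := (isEulerian_node_iff hk h 0).1 ht
    obtain ⟨l, hl, hl'⟩ := exists_pathHeight_eq_zero (p := childPath child) (i := 0) le_rfl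
      (by rw [h1]; norm_num)
    have h2 := levelWeight_node_eq h 0
    rw [Nat.cast_zero] at h2
    rw [h2]
    refine Finset.prod_eq_zero (Finset.mem_univ l) ?_
    rw [hl']
    exact ih l (h l) (childPath_eq_false.1 hl)

end PlantedTree

/-! ### The recursive system -/

section

variable {R : Type*} [CommRing R] (g : ℕ → R)

/-- The weight of a tree, when the leaf-path starts at level `i`. -/
noncomputable def treeWeight (i : ℤ) (t : PlantedTree) : R :=
  degreeWeight g t.nodeDegrees * (t.levelWeight i : R)

/-- The counting series of Eulerian trees with matching-indices, when the leaf-path starts at level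
`i`. -/
noncomputable def levelSeries (i : ℕ) : R⟦X⟧ :=
  PowerSeries.mk fun E => ∑ t ∈ eulerianTrees E, treeWeight g i t

open Classical in
/-- A polynomial that agrees with the counting series up to a given degree. -/
noncomputable def truncatedSeries (N : ℕ) (i : ℤ) (b : Bool) : R⟦X⟧ :=
  ∑ t ∈ if b then {opening} else eulerianTreesLE N,
    PowerSeries.monomial (halfDegree t.nodeDegrees) (treeWeight g i t)

variable {g}

theorem coeff_prod_congr {ι : Type*} {s : Finset ι} {a b : ι → R⟦X⟧} {m : ℕ}
    (h : ∀ l ∈ s, ∀ m' ≤ m, PowerSeries.coeff m' (a l) = PowerSeries.coeff m' (b l)) :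
    PowerSeries.coeff m (∏ l ∈ s, a l) = PowerSeries.coeff m (∏ l ∈ s, b l) := by
  classical
  induction s using Finset.induction_on generalizing m with
  | empty => rfl
  | insert x s hx ih =>
    rw [Finset.prod_insert hx, Finset.prod_insert hx, PowerSeries.coeff_mul, PowerSeries.coeff_mul]
    refine Finset.sum_congr rfl fun y hy => ?_
    have hy' := Finset.HasAntidiagonal.mem_antidiagonal.1 hy
    rw [h x (Finset.mem_insert_self x s) y.1 (by omega),
      ih fun l hl m' hm' => h l (Finset.mem_insert_of_mem hl) m' (by omega)]

theorem coeff_pathSum_congr {r r' : ℕ → R⟦X⟧} {k i m : ℕ}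
    (h : ∀ j, ∀ m' ≤ m, PowerSeries.coeff m' (r j) = PowerSeries.coeff m' (r' j)) :
    PowerSeries.coeff m (pathSum r k i) = PowerSeries.coeff m (pathSum r' k i) := by
  rw [pathSum, pathSum, map_sum, map_sum]
  exact Finset.sum_congr rfl fun p _ => coeff_prod_congr fun l _ m' hm' => h _ m' hm'

theorem coeff_term (k i E : ℕ) (hk : k ≤ E) (r : ℕ → R⟦X⟧) :
    PowerSeries.coeff E (PowerSeries.X ^ k * PowerSeries.C (g k) * pathSum r k i) =
      g k * PowerSeries.coeff (E - k) (pathSum r k i) := by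
  rw [mul_assoc, PowerSeries.coeff_X_pow_mul', if_pos hk, PowerSeries.coeff_C_mul]

/-- The system has at most one solution. -/
theorem SatisfiesRecursion.unique {r r' : ℕ → R⟦X⟧} (h : SatisfiesRecursion g r)
    (h' : SatisfiesRecursion g r') : r = r' := by
  have key : ∀ E i, PowerSeries.coeff E (r i) = PowerSeries.coeff E (r' i) := by
    intro E
    induction E using Nat.strong_induction_on with
    | h E ih =>
      intro i
      rcases Nat.eq_zero_or_pos i with rfl | hi
      · rw [h.1, h'.1]
      · rw [h.2 i hi, h'.2 i hi]
        congr 1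
        refine Finset.sum_congr rfl fun k hk => ?_
        rw [Finset.mem_Icc] at hk
        rw [coeff_term k i E hk.2, coeff_term k i E hk.2,
          -- Only coefficients of index at most E - k < E enter, as k ≥ 1.
          coeff_pathSum_congr fun j m' hm' => ih m' (by omega) j]
  funext i
  exact PowerSeries.ext fun E => key E i

theorem coeff_truncatedSeries {N m : ℕ} (hm : m ≤ N) (i : ℕ) :
    PowerSeries.coeff m (truncatedSeries g N i false) = PowerSeries.coeff m (levelSeries g i) := by
  rw [truncatedSeries, levelSeries, PowerSeries.coeff_mk, map_sum]
  simp only [PowerSeries.coeff_monomial, Bool.false_eq_true, if_false]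
  rw [← Finset.sum_filter]
  refine Finset.sum_congr ?_ fun _ _ => rfl
  ext t
  rw [Finset.mem_filter, mem_eulerianTreesLE, mem_eulerianTrees]
  constructor
  · rintro ⟨⟨h1, h2, -⟩, h3⟩
    exact ⟨h1, h2, h3.symm⟩
  · rintro ⟨h1, h2, h3⟩
    exact ⟨⟨h1, h2, h3.le.trans hm⟩, h3.symm⟩

theorem truncatedSeries_true (N : ℕ) (i : ℤ) : truncatedSeries g N i true = 1 := by
  simp [truncatedSeries, treeWeight, nodeDegrees]

theorem treeWeight_node {n : ℕ} {child : Fin n → PlantedTree}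
    (h : ∀ j, (child j).IsEulerian) (i : ℕ) : treeWeight g i (node n child) =
      g ((n + 1) / 2) * ∏ j : Fin n, treeWeight g (pathHeight i (childPath child) j) (child j) := by
  simp only [treeWeight]
  rw [nodeDegrees, degreeWeight_cons g (Nat.succ_pos n), degreeWeight_sum, levelWeight_node_eq h,
    Finset.prod_mul_distrib, Nat.cast_prod, mul_assoc]

open Classical in
/-- The families of subtrees of a node, if the path followed by the levels is given. -/
noncomputable def childrenFamilies {n : ℕ} (N : ℕ) (p : Fin n → Bool) : Finset (Fin n → PlantedTree) :=
  Fintype.piFinset fun l => if p l then {opening} else eulerianTreesLE N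

theorem mem_childrenFamilies {n N : ℕ} {p : Fin n → Bool} {child : Fin n → PlantedTree} :
    child ∈ childrenFamilies N p ↔ childPath child = p ∧
      ∀ l, (child l).IsEulerian ∧ halfDegree (child l).nodeDegrees ≤ N := by
  rw [childrenFamilies, Fintype.mem_piFinset]
  constructor
  · intro h
    refine ⟨funext fun l => ?_, fun l => ?_⟩
    · have := h l
      cases hp : p l with
      | true =>
        rw [hp, if_pos rfl, Finset.mem_singleton] at this
        exact childPath_eq_true.2 this
      | false =>
        rw [hp, if_neg (by simp), mem_eulerianTreesLE] at this
        exact childPath_eq_false.2 this.2.1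
    · have := h l
      cases hp : p l with
      | true =>
        rw [hp, if_pos rfl, Finset.mem_singleton] at this
        rw [this]
        exact ⟨trivial, by simp [nodeDegrees]⟩
      | false =>
        rw [hp, if_neg (by simp), mem_eulerianTreesLE] at this
        exact ⟨this.1, this.2.2⟩
  · rintro ⟨rfl, h⟩ l
    cases hp : childPath child l with
    | true =>
      rw [if_pos rfl, Finset.mem_singleton]
      exact childPath_eq_true.1 hp
    | false =>
      rw [if_neg (by simp), mem_eulerianTreesLE]
      exact ⟨(h l).1, childPath_eq_false.1 hp, (h l).2⟩

/-- Up to degree N the series may be replaced by finite sums of monomials, whose product expands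
over families of children. An ascending step carries the single tree `opening`, of weight 1. -/
theorem coeff_prod_levelSeries {n N i : ℕ} {p : Fin n → Bool}
    (hp : ∀ j ≤ n, 0 ≤ pathHeight i p j) :
    PowerSeries.coeff N (∏ l ∈ Finset.univ.filter fun l => p l = false,
        levelSeries g (pathHeight i p l).toNat) =
      ∑ child ∈ (childrenFamilies N p).filter fun child =>
          ∑ l, halfDegree (child l).nodeDegrees = N,
        ∏ l : Fin n, treeWeight g (pathHeight i p l) (child l) := by
  have h1 : ∀ l : Fin n, ((pathHeight i p l).toNat : ℤ) = pathHeight i p l := fun l =>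
    Int.toNat_of_nonneg (hp l l.2.le)
  trans PowerSeries.coeff N (∏ l ∈ Finset.univ.filter fun l => p l = false,
    truncatedSeries g N (pathHeight i p l) (p l))
  · refine coeff_prod_congr fun l hl m hm => ?_
    rw [(Finset.mem_filter.1 hl).2, ← coeff_truncatedSeries hm, h1]
  rw [Finset.prod_filter]
  have h2 : ∀ l : Fin n, (if p l = false then truncatedSeries g N (pathHeight i p l) (p l) else 1) =
      truncatedSeries g N (pathHeight i p l) (p l) := by
    intro l
    split_ifs with h
    · rfl
    · rw [Bool.not_eq_false] at h
      rw [h, truncatedSeries_true]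
  rw [Finset.prod_congr rfl fun l _ => h2 l]
  simp only [truncatedSeries]
  rw [Finset.prod_univ_sum, map_sum]
  simp only [PowerSeries.prod_monomial, PowerSeries.coeff_monomial]
  rw [← Finset.sum_filter]
  refine Finset.sum_congr ?_ fun _ _ => rfl
  ext child
  rw [Finset.mem_filter, Finset.mem_filter, childrenFamilies, eq_comm]

theorem mem_dyckPaths {k i : ℕ} {p : Fin (2 * k - 1) → Bool} : p ∈ dyckPaths k i ↔
    (∀ j ≤ 2 * k - 1, 0 ≤ pathHeight i p j) ∧ pathHeight i p (2 * k - 1) = (i : ℤ) - 1 := by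
  simp [dyckPaths]

theorem nodeDegrees_node_halfDegree {n k : ℕ} (hn : n + 1 = 2 * k) (child : Fin n → PlantedTree) :
    halfDegree (node n child).nodeDegrees = k + ∑ l, halfDegree (child l).nodeDegrees := by
  rw [nodeDegrees, halfDegree_cons, halfDegree_sum, hn]
  simp

open Classical in
-- Decomposition at the root node of degree 2k: a tree is a path together with a family of children
-- compatible with it.
theorem sum_treeWeight_arity {k E : ℕ} (hk : 1 ≤ k) (hkE : k ≤ E) (i : ℕ) :
    ∑ t ∈ (eulerianTrees E).filter (fun t => (t.arity + 1) / 2 = k), treeWeight g i t =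
      g k * PowerSeries.coeff (E - k) (pathSum (levelSeries g) k i) := by
  have hn : 2 * k - 1 + 1 = 2 * k := by omega
  rw [pathSum, map_sum, Finset.mul_sum]
  symm
  rw [Finset.sum_congr rfl fun p hp => by
    rw [coeff_prod_levelSeries (mem_dyckPaths.1 hp).1, Finset.mul_sum], Finset.sum_sigma']
  refine Finset.sum_of_injOn (fun x => node (2 * k - 1) x.2) ?_ ?_ ?_ ?_
  · rintro ⟨p, c⟩ hx ⟨p', c'⟩ hx' h
    simp only [Finset.coe_sigma, Set.mem_sigma_iff, Finset.mem_coe, Finset.mem_filter,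
      mem_childrenFamilies] at hx hx'
    simp only [node.injEq, heq_eq_eq, true_and] at h
    subst h
    obtain rfl : p = p' := hx.2.1.1.symm.trans hx'.2.1.1
    rfl
  · rintro ⟨p, c⟩ hx
    simp only [Finset.coe_sigma, Set.mem_sigma_iff, Finset.mem_coe, Finset.mem_filter,
      mem_childrenFamilies, mem_dyckPaths] at hx
    obtain ⟨⟨-, hp⟩, ⟨rfl, hc⟩, hsum⟩ := hx
    refine Finset.mem_coe.2 (Finset.mem_filter.2 ⟨mem_eulerianTrees.2
      ⟨(isEulerian_node_iff hn (fun j => (hc j).1) i).2 hp, by simp, ?_⟩, ?_⟩)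
    · rw [nodeDegrees_node_halfDegree hn, hsum]
      omega
    · simp only [arity]
      omega
  -- A tree outside the image has a path that becomes negative; a child then starts to descend from
  -- level 0 and the weight is zero.
  · intro t ht hnot
    obtain ⟨⟨hE, hne, hdeg⟩, hk'⟩ : (t.IsEulerian ∧ t ≠ opening ∧
        halfDegree t.nodeDegrees = E) ∧ (t.arity + 1) / 2 = k := by
      rwa [Finset.mem_filter, mem_eulerianTrees] at ht
    cases t with
    | opening => exact absurd rfl hne
    | closing => simp [arity] at hk'; omega
    | node n child =>
      obtain ⟨⟨k', hk2, hk3⟩, hch⟩ := id hE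
      simp only [arity] at hk'
      obtain rfl : k' = k := by omega
      obtain rfl : n = 2 * k' - 1 := by omega
      rw [nodeDegrees_node_halfDegree hn] at hdeg
      have hlast := (isEulerian_node_iff hn hch i).1 hE
      by_cases hpos : ∀ j ≤ 2 * k' - 1, 0 ≤ pathHeight i (childPath child) j
      · refine absurd ⟨⟨childPath child, child⟩, ?_, rfl⟩ hnot
        simp only [Finset.coe_sigma, Set.mem_sigma_iff, Finset.mem_coe, Finset.mem_filter,
          mem_childrenFamilies, mem_dyckPaths]
        refine ⟨⟨hpos, hlast⟩, ⟨trivial, fun l => ⟨hch l, ?_⟩⟩, by omega⟩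
        have := Finset.single_le_sum (f := fun j => halfDegree (child j).nodeDegrees)
          (fun _ _ => Nat.zero_le _) (Finset.mem_univ l)
        omega
      · push Not at hpos
        obtain ⟨j, hj, hneg⟩ := hpos
        obtain ⟨l, hl, hl'⟩ := exists_pathHeight_eq_zero hj hneg
        rw [treeWeight_node hch]
        refine mul_eq_zero_of_right _ (Finset.prod_eq_zero (Finset.mem_univ l) ?_)
        rw [hl', treeWeight, (hch l).levelWeight_zero (childPath_eq_false.1 hl)]
        simp
  · rintro ⟨p, c⟩ hx
    simp only [Finset.mem_sigma, Finset.mem_filter, mem_childrenFamilies] at hx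
    obtain ⟨-, ⟨rfl, hc⟩, -⟩ := hx
    rw [treeWeight_node fun j => (hc j).1, hn]
    simp

theorem eulerianTrees_filter_zero (E : ℕ) :
    (eulerianTrees E).filter (fun t => (t.arity + 1) / 2 = 0) = if E = 0 then {closing} else ∅ := by
  ext t
  rw [Finset.mem_filter, mem_eulerianTrees]
  cases t with
  | opening => split_ifs <;> simp
  | closing =>
    split_ifs with h
    · simp [nodeDegrees, arity, h, IsEulerian]
    · simp [nodeDegrees, Ne.symm h]
  | node n child =>
    have : (node n child).IsEulerian → ¬ (n + 1) / 2 = 0 := by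
      rintro ⟨⟨k, hk, hk'⟩, -⟩ h
      omega
    have h0 : node n child ∉ (if E = 0 then {closing} else ∅ : Finset PlantedTree) := by
      split_ifs <;> simp
    simp only [arity, h0, iff_false]
    tauto

/-- The counting series satisfy the system. -/
theorem satisfiesRecursion_levelSeries : SatisfiesRecursion g (levelSeries g) := by
  classical
  constructor
  · ext E
    rw [levelSeries, PowerSeries.coeff_mk, map_zero]
    refine Finset.sum_eq_zero fun t ht => ?_
    rw [mem_eulerianTrees] at ht
    rw [treeWeight, Nat.cast_zero, ht.1.levelWeight_zero ht.2.1]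
    simp
  · intro i _ E
    rw [levelSeries, PowerSeries.coeff_mk]
    -- Sorted by half the degree of the root node; by the integer division the value 0 stands for
    -- the tree `closing`, which gives the constant term i.
    rw [← Finset.sum_fiberwise_of_maps_to (g := fun t : PlantedTree => (t.arity + 1) / 2)
      (t := insert 0 (Finset.Icc 1 E))]
    · rw [Finset.sum_insert (by simp), eulerianTrees_filter_zero]
      congr 1
      · have h1 : (i : R⟦X⟧) = PowerSeries.C (i : R) := by simp
        rw [h1, PowerSeries.coeff_C]
        split_ifs <;> simp [treeWeight, nodeDegrees]
      · refine Finset.sum_congr rfl fun k hk => ?_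
        rw [Finset.mem_Icc] at hk
        rw [coeff_term k i E hk.2, sum_treeWeight_arity hk.1 hk.2]
    · intro t ht
      rw [mem_eulerianTrees] at ht
      rw [Finset.mem_insert, Finset.mem_Icc]
      cases t with
      | opening => exact absurd rfl ht.2.1
      | closing => simp [arity]
      | node n child =>
        obtain ⟨⟨k, hk, hk'⟩, -⟩ := ht.1
        have := ht.2.2
        rw [nodeDegrees_node_halfDegree hk] at this
        simp only [arity]
        omega

/-! ### Counting series of the three families -/

/-- The matching-indices of an enriched Eulerian tree whose tree is given. -/
def EnrichedEulerianTree.indices {t : PlantedTree}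
    (S : {S : EnrichedEulerianTree // S.tree.tree = t}) (c : t.closingLeaves) :
    Fin (t.height c).toNat :=
  ⟨S.1.assignment.index ⟨c, by rw [S.2]; exact c.2⟩, by
    have := S.1.assignment.index_lt ⟨c, by rw [S.2]; exact c.2⟩
    have h2 := S.2
    simp only [h2] at this
    omega⟩

theorem EnrichedEulerianTree.indices_injective (t : PlantedTree) :
    Function.Injective (EnrichedEulerianTree.indices (t := t)) := by
  rintro ⟨⟨⟨t', hp, hc⟩, hE, hB, ⟨idx, hidx⟩⟩, rfl⟩
    ⟨⟨⟨t'', hp', hc'⟩, hE', hB', ⟨idx', hidx'⟩⟩, h⟩ hF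
  simp only at h
  subst h
  have : idx = idx' := by
    funext c
    exact congrArg Fin.val (congrFun hF c)
  subst this
  rfl

/-- Over a fixed tree only the indices vary, h of them per closing leaf. For an unbalanced tree both
sides are zero. -/
theorem card_enriched_fiber {t : PlantedTree} (ht : t.IsEulerian) (hne : t ≠ opening) :
    Nat.card {S : EnrichedEulerianTree // S.tree.tree = t} = t.levelWeight 1 := by
  have := Fintype.ofFinite t.closingLeaves
  have hcard : t.openingLeaves.ncard = t.closingLeaves.ncard :=
    t.ncard_openingLeaves_eq_iff.2 (ht.increment_eq.resolve_left hne)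
  have hsurj : Function.Surjective (EnrichedEulerianTree.indices (t := t)) := by
    intro ι
    refine ⟨⟨⟨⟨t, ht.isProper, hcard⟩, ht, fun c hc => ?_, ⟨fun c => ι c, fun c => ?_⟩⟩, rfl⟩, rfl⟩
    · have := (ι ⟨c, hc⟩).2
      simp only at this ⊢
      omega
    · have := (ι c).2
      simp only at this ⊢
      omega
  rw [Nat.card_congr (Equiv.ofBijective _ ⟨EnrichedEulerianTree.indices_injective t, hsurj⟩),
    Nat.card_pi, levelWeight_eq_prod]
  refine Finset.prod_congr rfl fun c _ => ?_
  rw [Nat.card_fin]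
  congr 1
  ring

theorem EnrichedEulerianTree.tree_ne_opening (S : EnrichedEulerianTree) :
    S.tree.tree ≠ opening := by
  intro h
  have h1 := S.tree.tree.ncard_openingLeaves_eq_iff.1 S.tree.card_eq
  rw [h, increment_opening] at h1
  norm_num at h1

theorem finite_enriched_fiber (t : PlantedTree) :
    {S : EnrichedEulerianTree | S.tree.tree = t}.Finite :=
  Finite.of_injective _ (EnrichedEulerianTree.indices_injective t)

theorem isCountingSeries_enriched :
    IsCountingSeries g EnrichedEulerianTree.degrees (levelSeries g 1) := by
  classical
  intro E
  have hmem : ∀ S : EnrichedEulerianTree, halfDegree S.degrees = E ↔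
      S.tree.tree ∈ eulerianTrees E := by
    intro S
    rw [mem_eulerianTrees]
    exact ⟨fun h => ⟨S.eulerian, S.tree_ne_opening, h⟩, fun h => h.2.2⟩
  have hfin : {S : EnrichedEulerianTree | halfDegree S.degrees = E}.Finite := by
    refine ((eulerianTrees E).finite_toSet.biUnion fun t _ => finite_enriched_fiber t).subset ?_
    intro S hS
    exact Set.mem_biUnion (x := S.tree.tree) ((hmem S).1 hS) rfl
  refine ⟨hfin, ?_⟩
  rw [finsum_mem_eq_finite_toFinset_sum _ hfin, levelSeries, PowerSeries.coeff_mk,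
    ← Finset.sum_fiberwise_of_maps_to (g := fun S : EnrichedEulerianTree => S.tree.tree)
      (t := eulerianTrees E) fun S hS => (hmem S).1 (hfin.mem_toFinset.1 hS)]
  refine Finset.sum_congr rfl fun t ht => ?_
  have ht' := mem_eulerianTrees.1 ht
  rw [Finset.sum_congr rfl fun S hS => show degreeWeight g S.degrees =
    degreeWeight g t.nodeDegrees by rw [← (Finset.mem_filter.1 hS).2]; rfl, Finset.sum_const,
    nsmul_eq_mul, treeWeight, mul_comm, Nat.cast_one, ← card_enriched_fiber ht'.1 ht'.2.1]
  congr 2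
  rw [← Set.ncard_coe_finset]
  change {S : EnrichedEulerianTree | S.tree.tree = t}.ncard = _
  congr 1
  ext S
  simp only [Set.mem_ofPred_eq, Finset.coe_filter, Set.Finite.mem_toFinset, hmem]
  exact ⟨fun h => ⟨h ▸ ht, h⟩, fun h => h.2⟩

/-- Asks for equal sizes and weights rather than equal degrees, because the map without edges has
degrees {0} while the nodeless tree has none. -/
theorem IsCountingSeries.of_equiv {A B : Type*} {degA : A → Multiset ℕ} {degB : B → Multiset ℕ}
    {F : R⟦X⟧} (h : IsCountingSeries g degA F) (e : A ≃ B)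
    (h1 : ∀ x, halfDegree (degB (e x)) = halfDegree (degA x))
    (h2 : ∀ x, degreeWeight g (degB (e x)) = degreeWeight g (degA x)) :
    IsCountingSeries g degB F := by
  intro E
  have hbij : Set.BijOn e {x | halfDegree (degA x) = E} {y | halfDegree (degB y) = E} := by
    refine ⟨fun x hx => (h1 x).trans hx, e.injective.injOn, fun y hy => ⟨e.symm y, ?_, by simp⟩⟩
    have := h1 (e.symm y)
    rw [e.apply_symm_apply] at this
    exact this.symm.trans hy
  refine ⟨hbij.finite_iff_finite.1 (h E).1, ?_⟩
  rw [(h E).2]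
  exact finsum_mem_eq_of_bijOn e hbij fun x _ => (h2 x).symm

end

/-! ### Rooted Eulerian maps and matched Eulerian trees -/

namespace PlantedTree

theorem openingLeaves_closing : closing.openingLeaves = {⊥} := by
  ext x
  simp only [openingLeaves, Set.mem_ofPred_eq, Set.mem_singleton_iff, or_iff_left_iff_imp]
  rintro ⟨_ | ⟨j, a⟩, -, h⟩ <;> simp [subtreeAt] at h

theorem closingLeaves_closing : closing.closingLeaves = {(([] : List ℕ) : LeafPosition)} := by
  ext x
  simp only [closingLeaves, Set.mem_ofPred_eq, Set.mem_singleton_iff]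
  constructor
  · rintro ⟨_ | ⟨j, a⟩, hx, h⟩
    · exact hx
    · simp [subtreeAt] at h
  · rintro rfl
    exact ⟨[], rfl, by simp [subtreeAt]⟩

end PlantedTree

theorem BlossomingTree.tree_eq_closing_or_isNode (T : BlossomingTree) :
    T.tree = closing ∨ T.tree.IsNode := by
  have h := T.tree.ncard_openingLeaves_eq_iff.1 T.card_eq
  cases hT : T.tree with
  | opening => rw [hT, increment_opening] at h; norm_num at h
  | closing => exact Or.inl rfl
  | node n child => exact Or.inr ⟨n, child, rfl⟩

/-- The Eulerian tree without nodes, with its forward matching. -/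
noncomputable def MatchedEulerianTree.nodeless : MatchedEulerianTree where
  tree := ⟨closing, trivial, closing.ncard_openingLeaves_eq_iff.2 increment_closing⟩
  eulerian := trivial
  matching :=
    { toEquiv := (Equiv.setCongr openingLeaves_closing).trans
        ((Equiv.ofUnique _ _).trans (Equiv.setCongr closingLeaves_closing).symm)
      forward := by
        intro o
        obtain ⟨a, ha, -⟩ := (((Equiv.setCongr openingLeaves_closing).trans
          ((Equiv.ofUnique _ _).trans (Equiv.setCongr closingLeaves_closing).symm)) o).2
        rw [show (o : LeafPosition) = ⊥ from openingLeaves_closing.subset o.2]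
        exact ha ▸ WithBot.bot_lt_coe a }

theorem MatchedEulerianTree.eq_nodeless {S : MatchedEulerianTree} (h : S.tree.tree = closing) :
    S = nodeless := by
  obtain ⟨⟨T, hp, hc⟩, hE, m⟩ := S
  obtain rfl : T = closing := h
  suffices m = nodeless.matching by subst this; rfl
  refine ForwardMatching.ext_symm fun c => Subtype.ext ?_
  exact (openingLeaves_closing.subset (m.toEquiv.symm c).2).trans
    (openingLeaves_closing.subset (nodeless.matching.toEquiv.symm c).2).symm

theorem RootedMap.exists_isClosure (S : MatchedEulerianTree) :
    ∃ M : RootedMap, M.IsClosure S.matching := by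
  obtain h | h := S.tree.tree_eq_closing_or_isNode
  · exact ⟨vertexMap, h⟩
  · obtain ⟨M, hM⟩ := HalfEdgeMap.exists_isClosure S.matching h
    exact ⟨ofClass (Quotient.mk _ M), M, rfl, hM⟩

/-- A closure with at least one half-edge requires a node, so the convention for the nodeless tree
does not interfere. -/
theorem RootedMap.IsClosure.unique {T : BlossomingTree} {m : ForwardMatching T} {M N : RootedMap}
    (hM : M.IsClosure m) (hN : N.IsClosure m) : M = N := by
  cases M with
  | vertexMap =>
    cases N with
    | vertexMap => rfl
    | ofClass c =>
      obtain ⟨N, -, hN⟩ := hN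
      exact absurd hN.isNode fun h => not_isNode_closing ((show T.tree = closing from hM) ▸ h)
  | ofClass c =>
    obtain ⟨M, rfl, hM⟩ := hM
    cases N with
    | vertexMap => exact absurd hM.isNode fun h => not_isNode_closing ((show T.tree = closing from hN) ▸ h)
    | ofClass c' =>
      obtain ⟨N, rfl, hN⟩ := hN
      exact congrArg ofClass (Quotient.sound (hM.iso hN))

theorem RootedMap.IsClosure.eq_tree {S S' : MatchedEulerianTree} {M : RootedMap}
    (h : M.IsClosure S.matching) (h' : M.IsClosure S'.matching) : S = S' := by
  cases M with
  | vertexMap => rw [MatchedEulerianTree.eq_nodeless h, MatchedEulerianTree.eq_nodeless h']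
  | ofClass c =>
    obtain ⟨M, rfl, hM⟩ := h
    obtain ⟨N, hNM, hN⟩ := h'
    exact MatchedEulerianTree.eq_of_isClosure hM (hN.of_iso (Quotient.exact hNM))

theorem RootedMap.IsEulerian.exists_isClosure {M : RootedMap} (hM : M.IsEulerian) :
    ∃ S : MatchedEulerianTree, M.IsClosure S.matching := by
  cases M with
  | vertexMap => exact ⟨MatchedEulerianTree.nodeless, rfl⟩
  | ofClass c =>
    induction c using Quotient.inductionOn with
    | h M =>
      obtain ⟨S, hS⟩ := M.exists_matchedEulerianTree hM
      exact ⟨S, M, rfl, hS⟩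

/-- The vertices of a closure have the degrees of the nodes of the tree, up to the convention for
the tree without nodes. -/
theorem RootedMap.IsClosure.degrees_eq {S : MatchedEulerianTree} {M : RootedMap}
    (h : M.IsClosure S.matching) :
    M.degrees = S.degrees ∨ M.degrees = {0} ∧ S.degrees = 0 := by
  cases M with
  | vertexMap =>
    refine Or.inr ⟨rfl, ?_⟩
    rw [MatchedEulerianTree.degrees, show S.tree.tree = closing from h, nodeDegrees]
  | ofClass c =>
    obtain ⟨M, rfl, hM⟩ := h
    exact Or.inl hM.degrees_eq

theorem RootedMap.IsClosure.isEulerian {S : MatchedEulerianTree} {M : RootedMap}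
    (h : M.IsClosure S.matching) : M.IsEulerian := by
  intro d hd
  obtain h | ⟨h, -⟩ := h.degrees_eq
  · exact (S.eulerian.even_nodeDegrees d (Multiset.mem_of_le h.le hd)).1
  · rw [h, Multiset.mem_singleton] at hd
    exact hd ▸ Even.zero

theorem two_mul_halfDegree {s : Multiset ℕ} (h : ∀ d ∈ s, Even d) : 2 * halfDegree s = s.sum := by
  rw [halfDegree, ← Multiset.sum_map_mul_left]
  conv_rhs => rw [← Multiset.map_id s]
  exact congrArg _ (Multiset.map_congr rfl fun d hd => Nat.two_mul_div_two_of_even (h d hd))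

theorem RootedMap.IsEulerian.numEdges_eq {M : RootedMap} (hM : M.IsEulerian) :
    M.numEdges = halfDegree M.degrees := by
  cases M with
  | vertexMap => rfl
  | ofClass c =>
    induction c using Quotient.inductionOn with
    | h M =>
      have h := two_mul_halfDegree (s := M.degrees) hM
      rw [M.sum_degrees] at h
      change M.numHalfEdges / 2 = halfDegree M.degrees
      omega

/-- The closure of an Eulerian tree endowed with a forward matching. -/
noncomputable def MatchedEulerianTree.closure (S : MatchedEulerianTree) : RootedEulerianMap :=
  ⟨(RootedMap.exists_isClosure S).choose, (RootedMap.exists_isClosure S).choose_spec.isEulerian⟩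

theorem MatchedEulerianTree.isClosure_closure (S : MatchedEulerianTree) :
    S.closure.1.IsClosure S.matching :=
  (RootedMap.exists_isClosure S).choose_spec

theorem MatchedEulerianTree.bijective_closure : Function.Bijective closure := by
  refine ⟨fun S S' h => ?_, fun M => ?_⟩
  · have hS := S.isClosure_closure
    rw [h] at hS
    exact hS.eq_tree S'.isClosure_closure
  · obtain ⟨S, hS⟩ := M.2.exists_isClosure
    exact ⟨S, Subtype.ext (S.isClosure_closure.unique hS)⟩

theorem MatchedEulerianTree.count_degrees_closure (S : MatchedEulerianTree) {k : ℕ} (hk : 1 ≤ k) :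
    S.closure.1.degrees.count (2 * k) = S.degrees.count (2 * k) := by
  obtain h | ⟨h, h'⟩ := S.isClosure_closure.degrees_eq
  · rw [h]
  · rw [h, h', Multiset.count_singleton, if_neg (by omega), Multiset.count_zero]

theorem MatchedEulerianTree.halfDegree_closure (S : MatchedEulerianTree) :
    halfDegree S.closure.1.degrees = halfDegree S.degrees := by
  obtain h | ⟨h, h'⟩ := S.isClosure_closure.degrees_eq
  · rw [h]
  · simp [h, h', halfDegree]

theorem MatchedEulerianTree.degreeWeight_closure {R : Type*} [CommRing R] (g : ℕ → R)
    (S : MatchedEulerianTree) :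
    degreeWeight g S.closure.1.degrees = degreeWeight g S.degrees := by
  obtain h | ⟨h, h'⟩ := S.isClosure_closure.degrees_eq
  · rw [h]
  · simp [h, h', degreeWeight, Multiset.filter_singleton]

theorem mainTheorem1 {R : Type*} [CommRing R] (g : ℕ → R) :
    (∃ (Φ : EnrichedEulerianTree ≃ MatchedEulerianTree)
       (Ψ : MatchedEulerianTree ≃ RootedEulerianMap),
      (∀ T hE hB a, ∃ m : ForwardMatching T, Φ ⟨T, hE, hB, a⟩ = ⟨T, hE, m⟩ ∧ a.Encodes m) ∧
      (∀ S, (Ψ S).1.IsClosure S.matching) ∧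
      (∀ S, ∀ k ≥ 1, (Φ S).degrees.count (2 * k) = S.degrees.count (2 * k)) ∧
      (∀ S, ∀ k ≥ 1, (Ψ S).1.degrees.count (2 * k) = S.degrees.count (2 * k)) ∧
      (∀ S, halfDegree (Φ S).degrees = halfDegree S.degrees) ∧
      (∀ S, halfDegree (Ψ S).1.degrees = halfDegree S.degrees) ∧
      (∀ S, (Ψ S).1.numEdges = halfDegree S.degrees)) ∧
    ∃ r : ℕ → PowerSeries R,
      SatisfiesRecursion g r ∧ (∀ r', SatisfiesRecursion g r' → r' = r) ∧
      IsCountingSeries g EnrichedEulerianTree.degrees (r 1) ∧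
      IsCountingSeries g MatchedEulerianTree.degrees (r 1) ∧
      IsCountingSeries g (fun M : RootedEulerianMap => M.1.degrees) (r 1) := by
  have hb : IsCountingSeries g MatchedEulerianTree.degrees (levelSeries g 1) :=
    isCountingSeries_enriched.of_equiv enrichedEquivMatched (fun _ => rfl) fun _ => rfl
  refine ⟨⟨enrichedEquivMatched, Equiv.ofBijective _ MatchedEulerianTree.bijective_closure,
    fun T hE hB a => ⟨a.matching, rfl, a.encodes_matching⟩,
    MatchedEulerianTree.isClosure_closure, fun _ _ _ => rfl,
    fun S k hk => S.count_degrees_closure hk, fun _ => rfl,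
    MatchedEulerianTree.halfDegree_closure,
    fun S => S.closure.2.numEdges_eq.trans S.halfDegree_closure⟩,
    levelSeries g, satisfiesRecursion_levelSeries,
    fun r' h => h.unique satisfiesRecursion_levelSeries, isCountingSeries_enriched, hb,
    hb.of_equiv (Equiv.ofBijective _ MatchedEulerianTree.bijective_closure)
      MatchedEulerianTree.halfDegree_closure (MatchedEulerianTree.degreeWeight_closure g)⟩
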